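/- Let $\Omega=\mathbb{Q}_2(\sqrt{-1},\sqrt{-3},\sqrt{2})$ and let $\rho: Q_8\to \mathrm{GL}_2(\Omega)$ be the faithful two-dimensional representation of the quaternion group $Q_8$ of order 8 (it exists and is unique up to conjugation). For an intermediate field $\mathbb{Q}_2\subseteq L\subseteq\Omega$ let $\mathcal{O}_L$ be its ring of integers. If $\rho_L:Q_8\to\mathrm{GL}_2(L)$ is a faithful representation, let $\mathrm{IF}(L)$ be the set of $\mathrm{GL}_2(\mathcal{O}_L)$-conjugacy classes of homomorphisms $Q_8\to \mathrm{GL}_2(\mathcal{O}_L)$ that are $\mathrm{GL}_2(L)$-conjugate to $\rho_L$ (the integral forms of $\rho_L$). Let $\mathrm{IF}(\Omega/L)\subseteq \mathrm{IF}(\Omega)$ be the set of classes that are defined over $\mathcal{O}_L$, i.e. that contain a homomorphism with values in $\mathrm{GL}_2(\mathcal{O}_L)$. Then: (1) $\mathrm{IF}(\Omega)$ has exactly $26$ elements. (2) If $L/\mathbb{Q}_2$ is quadratic, then $\mathrm{IF}(\Omega/L)$ has $4$ elements if $L\neq\mathbb{Q}_2(\sqrt{-3})$, and $2$ elements if $L=\mathbb{Q}_2(\sqrt{-3})$.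 (3) If $L/\mathbb{Q}_2$ has degree $4$, then $\mathrm{IF}(\Omega/L)$ has $10$ elements if $\sqrt{-3}\notin L$, and $6$ elements if $\sqrt{-3}\in L$. (4) In (2) and (3), $\mathrm{IF}(L)$ has the same number of elements as $\mathrm{IF}(\Omega/L)$. (5) There are pairwise disjoint subsets $S_*,S_\circ,S_\diamondsuit,S_\clubsuit,S_\spadesuit$ of $\mathrm{IF}(\Omega)$ with $2,3,3,3,1$ elements, respectively, such that $\mathrm{IF}(\Omega/L)$ equals - $S_\diamondsuit\cup S_\spadesuit$ for $L=\mathbb{Q}_2(\sqrt{-1})$ and $L=\mathbb{Q}_2(\sqrt{3})$; - $S_*$ for $L=\mathbb{Q}_2(\sqrt{-3})$; - $S_\circ\cup S_\spadesuit$ for $L=\mathbb{Q}_2(\sqrt{a})$ with $a\in\{2,-2,6,-6\}$; - $S_*\cup S_\diamondsuit\cup S_\spadesuit$ for $L=\mathbb{Q}_2(\sqrt{-1},\sqrt{3})$; - $S_\circ\cup S_\diamondsuit\cup S_\clubsuit\cup S_\spadesuit$ for $L=\mathbb{Q}_2(\sqrt{-1},\sqrt{2})$, $\mathbb{Q}_2(\sqrt{-1},\sqrt{6})$,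 $\mathbb{Q}_2(\sqrt{3},\sqrt{2})$ and $\mathbb{Q}_2(\sqrt{3},\sqrt{-2})$; - $S_*\cup S_\circ\cup S_\spadesuit$ for $L=\mathbb{Q}_2(\sqrt{-3},\sqrt{2})$ and $L=\mathbb{Q}_2(\sqrt{-3},\sqrt{-2})$. -/

import Mathlib

open scoped MatrixGroups

noncomputable section

/-- The ring of integers of an algebraic extension `K` of `ℚ_[2]`. -/
abbrev IntegerRing (K : Type*) [Field K] [Algebra ℤ_[2] K] : Type _ :=
  integralClosure ℤ_[2] K

section IntegralForms

variable {G : Type*} [Group G] {n : ℕ} {K : Type*} [Field K] [Algebra ℤ_[2] K]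

/-- The integral representations `G → GL_n(O_K)` that are `GL_n(K)`-conjugates of `ρ`. -/
def IntegralRep (ρ : G →* GL (Fin n) K) : Type _ :=
  {σ : G →* GL (Fin n) (IntegerRing K) //
    ∃ g : GL (Fin n) K, ∀ x : G,
      Matrix.GeneralLinearGroup.map (algebraMap (IntegerRing K) K) (σ x) = g * ρ x * g⁻¹}

/-- Conjugacy of integral representations under `GL_n(O_K)`. -/
instance IntegralRep.setoid (ρ : G →* GL (Fin n) K) : Setoid (IntegralRep ρ) where
  r σ τ := ∃ g : GL (Fin n) (IntegerRing K), ∀ x : G, τ.1 x = g * σ.1 x * g⁻¹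
  iseqv :=
    { refl := fun σ => ⟨1, fun x => by simp⟩
      symm := by
        rintro σ τ ⟨g, hg⟩
        exact ⟨g⁻¹, fun x => by rw [hg x]; group⟩
      trans := by
        rintro σ τ υ ⟨g, hg⟩ ⟨h, hh⟩
        exact ⟨h * g, fun x => by rw [hh x, hg x]; group⟩ }

/-- The set `IF_ρ(K)` of integral forms of `ρ`: the `GL_n(O_K)`-conjugacy classes of integral
representations that are `GL_n(K)`-conjugates of `ρ`. -/
def IntegralForms (ρ : G →* GL (Fin n) K) : Type _ :=
  Quotient (IntegralRep.setoid ρ)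

end IntegralForms

/-- The field `Ω = ℚ₂(√-1, √-3, √2)`, inside an algebraic closure of `ℚ₂`. -/
abbrev Omega : Type :=
  IntermediateField.adjoin ℚ_[2]
    {x : AlgebraicClosure ℚ_[2] | x ^ 2 = -1 ∨ x ^ 2 = -3 ∨ x ^ 2 = 2}

/-- The subfield of `Ω` generated over `ℚ₂` by the square roots in `Ω` of the integers in `S`. -/
def sqrtField (S : Set ℤ) : IntermediateField ℚ_[2] Omega :=
  IntermediateField.adjoin ℚ_[2] {x : Omega | ∃ a ∈ S, x ^ 2 = (a : Omega)}

/-- The inclusion `O_L → O_Ω` for an intermediate field `L`. -/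
def integerInclusion (L : IntermediateField ℚ_[2] Omega) :
    IntegerRing L →+* IntegerRing Omega :=
  ((L.val.restrictScalars ℤ_[2]).mapIntegralClosure : IntegerRing L →ₐ[ℤ_[2]] IntegerRing Omega)

/-- The set `IF_ρ(Ω/L)` of integral forms of `ρ` over `O_Ω` that are defined over `O_L`: the
classes that contain the extension of scalars of a homomorphism `G → GL_n(O_L)`. -/
def definedOver {G : Type*} [Group G] {n : ℕ} (ρ : G →* GL (Fin n) Omega)
    (L : IntermediateField ℚ_[2] Omega) : Set (IntegralForms ρ) :=
  {c | ∃ (σ : G →* GL (Fin n) (IntegerRing L)) (τ : IntegralRep ρ),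
    (∀ x : G, τ.1 x = Matrix.GeneralLinearGroup.map (integerInclusion L) (σ x)) ∧
      (Quotient.mk (IntegralRep.setoid ρ) τ : IntegralForms ρ) = c}

end

open scoped MatrixGroups

noncomputable section

set_option linter.unusedSectionVars false

/-! By Schur's lemma an integral form of `ρ` is a coset of some `g` in `GL₂(O) \ GL₂(Ω) / Ωˣ` such
that `g` conjugates a fixed model `A₀`, `B₀` of the representation into integral matrices.
Equivalently, it is a vertex of the Bruhat–Tits tree of `Ω` fixed by `Q₈`. Since `Ω` has
ramification index 4 and residue field `F₄`, every vertex has 5 neighbours. The model is chosen so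
that both generators are scalar modulo `√2`: the diagonal entries `±√-3/3` are congruent modulo 2.
As `√2` has valuation 2, the ball of radius 2 about the base vertex is fixed. Nothing else is,
because the `O`-span of `A₀`, `B₀`, `A₀B₀` contains, up to units, `√2` times both off-diagonal
elementary matrices. This gives 1 + 5 + 20 = 26 forms (`exists_M`, `M_injective`).

If `√-3 ∈ L`, rescaling one coordinate makes the model rational over `L`, so the forms defined over
`L` are the translates of one vertex by `GL₂(L)`. A normal form over the valuation ring of `L` lists
those in the ball: 6 when `L` is quartic, where neighbours in the tree of `L` are at distance 2 in
the tree of `Ω`, and 2 when `L = ℚ₂(√-3)`, where they are at distance 4 and the centre of the ball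
is the midpoint of an edge.

If `√-3 ∉ L`, some `τ` fixes `L` and moves `√-3`. A form defined over `L` is invariant under a
twisted action of `τ`, which on parameters is `t ↦ 1/τ(t)` up to a factor congruent to 1 modulo 2.
Invariance says `t τ(t) ≡ 1` to the precision of the form. This leaves the centre, three forms at
distance 1 and six at distance 2, where the second digit is subject to a trace condition
(`DefOver.M_cases_of_conj`). Conversely, a solution of the norm equation `y τ(y) = -3u²/2` with `u ∈
L` of the valuation of `√2` gives Galois descent (`defOver_of_descent`). Such solutions are written
down for each relevant square root. The class of `u/√2` modulo `√2`, which is 1 or `ζ₈`, decides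
which distance-two forms arise. For quadratic `L` the upper bound is intersected with the one for a
quartic field containing `L` and `√-3`.

Over `O_L` itself the count agrees with that over `O_Ω`: an `L`-rational intertwiner differs from an
integral one over `Ω` by a scalar, and division by a suitable entry makes it unimodular
(`conj_descends`). -/

/-- A field with a nonarchimedean absolute value extending the dyadic one, with chosen square
roots of `-1`, `-3` and `2`. -/
structure DyadicData (E : Type*) [Field E] where
  N : AbsoluteValue E ℝ
  nonarch : IsNonarchimedean N
  I : E
  r : E
  s : E
  hI : I ^ 2 = -1
  hr : r ^ 2 = -3
  hs : s ^ 2 = 2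
  two : N 2 = 1 / 2

/-! ### Valuations of the standard elements, and residue representatives. -/

namespace DyadicData

variable {E : Type*} [Field E] (D : DyadicData E)

lemma add_le {x y : E} {c : ℝ} (hx : D.N x ≤ c) (hy : D.N y ≤ c) : D.N (x + y) ≤ c :=
  (D.nonarch x y).trans (max_le hx hy)

lemma sub_le {x y : E} {c : ℝ} (hx : D.N x ≤ c) (hy : D.N y ≤ c) : D.N (x - y) ≤ c := by
  rw [sub_eq_add_neg]; exact D.add_le hx (by rwa [D.N.map_neg])

lemma mul_le {x y : E} {c : ℝ} (hx : D.N x ≤ 1) (hy : D.N y ≤ c) : D.N (x * y) ≤ c := by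
  rw [map_mul]
  calc D.N x * D.N y ≤ 1 * D.N y := by gcongr
    _ ≤ c := by rwa [one_mul]

lemma mul_le' {x y : E} {c : ℝ} (hx : D.N x ≤ c) (hy : D.N y ≤ 1) : D.N (x * y) ≤ c := by
  rw [mul_comm]; exact D.mul_le hy hx

lemma add_eq_left {x y : E} (h : D.N y < D.N x) : D.N (x + y) = D.N x := by
  apply le_antisymm (D.add_le le_rfl h.le)
  by_contra! h'
  have : D.N x ≤ max (D.N (x + y)) (D.N y) := by
    have := D.sub_le (le_max_left (D.N (x + y)) (D.N y)) (le_max_right (D.N (x + y)) (D.N y))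
    simpa using this
  exact absurd this (not_le.mpr (max_lt h' h))

lemma eq_of_sub_lt {x y : E} (h : D.N (x - y) < D.N y) : D.N x = D.N y := by
  have := D.add_eq_left h
  simpa using this

lemma one_of_pow {x : E} {n : ℕ} (hn : n ≠ 0) (h : D.N (x ^ n) = 1) : D.N x = 1 := by
  rw [map_pow] at h
  exact (pow_eq_one_iff_of_nonneg (D.N.nonneg x) hn).mp h

lemma ne_zero_of_N {x : E} {c : ℝ} (hc : 0 < c) (h : D.N x = c) : x ≠ 0 := by
  rintro rfl; simp at h; linarith

lemma two_ne (D : DyadicData E) : (2 : E) ≠ 0 := D.ne_zero_of_N (by norm_num) D.two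

lemma N_three : D.N 3 = 1 := by
  have : D.N (1 + 2 : E) = D.N 1 := D.add_eq_left (by rw [D.two, map_one]; norm_num)
  rw [map_one] at this
  rw [← this]; norm_num

lemma three_ne (D : DyadicData E) : (3 : E) ≠ 0 := D.ne_zero_of_N one_pos D.N_three

lemma N_I : D.N D.I = 1 := D.one_of_pow two_ne_zero (by rw [D.hI]; simp)

lemma N_r : D.N D.r = 1 := D.one_of_pow two_ne_zero (by rw [D.hr, D.N.map_neg, D.N_three])

lemma N_s_sq : D.N D.s ^ 2 = 1 / 2 := by rw [← map_pow, D.hs, D.two]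

lemma s_ne : D.s ≠ 0 := by
  intro h; have := D.hs; rw [h] at this; exact D.two_ne (by rw [← this]; ring)
lemma r_ne : D.r ≠ 0 := D.ne_zero_of_N one_pos D.N_r
lemma I_ne : D.I ≠ 0 := D.ne_zero_of_N one_pos D.N_I

lemma N_s_pos : 0 < D.N D.s := D.N.pos D.s_ne

lemma N_s_lt : D.N D.s < 1 := by
  have := D.N_s_sq; have := D.N_s_pos; nlinarith

lemma N_two_lt_s : D.N 2 < D.N D.s := by
  rw [← D.hs, map_pow]; have := D.N_s_lt; have := D.N_s_pos; nlinarith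

lemma N_two_eq : D.N 2 = D.N D.s ^ 2 := by rw [← D.hs, map_pow]

/-- A primitive cube root of unity. -/
def w : E := (-1 + D.r) / 2

lemma r_eq : D.r = 2 * D.w + 1 := by
  have := D.two_ne; simp only [w]; field_simp; ring

lemma w_sq : D.w ^ 2 = -1 - D.w := by
  have h := D.hr
  have := D.two_ne
  have h4 : (4 : E) ≠ 0 := by
    have : (4 : E) = 2 * 2 := by norm_num
    rw [this]; exact mul_ne_zero D.two_ne D.two_ne
  rw [D.r_eq] at h
  apply mul_left_cancel₀ h4
  linear_combination h

lemma w_cube : D.w ^ 3 = 1 := by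
  linear_combination (D.w - 1) * D.w_sq

lemma N_w : D.N D.w = 1 := D.one_of_pow three_ne_zero (by rw [D.w_cube]; simp)
lemma w_ne : D.w ≠ 0 := D.ne_zero_of_N one_pos D.N_w

/-- A primitive eighth root of unity. -/
def z : E := (1 + D.I) / D.s

lemma z_sq : D.z ^ 2 = D.I := by
  have := D.s_ne
  have := D.two_ne
  rw [z, div_pow, D.hs]; field_simp; linear_combination D.hI

lemma z_s : D.z * D.s = 1 + D.I := by
  rw [z, div_mul_cancel₀ _ D.s_ne]

lemma N_z : D.N D.z = 1 := D.one_of_pow two_ne_zero (by rw [D.z_sq, D.N_I])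
/-- A uniformizer. -/
def p : E := D.z - 1

lemma N_I_sub_one : D.N (D.I - 1) = D.N D.s := by
  have : D.I - 1 = D.I * (D.z * D.s) := by rw [D.z_s]; linear_combination -D.hI
  rw [this, map_mul, map_mul, D.N_I, D.N_z]; ring

lemma p_eq : D.p ^ 2 + 2 * D.p = D.I - 1 := by
  rw [p]; linear_combination D.z_sq

lemma N_p_le : D.N D.p ≤ 1 := D.sub_le D.N_z.le (by simp)

/-- As `z ^ 2 = I`, one has `p ^ 2 + 2 * p = I - 1`, and the term `2 * p` is strictly smaller than
`I - 1`. Hence `p` has a quarter of the valuation of 2. -/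
lemma N_p_sq : D.N D.p ^ 2 = D.N D.s := by
  have h : D.N (2 * D.p) < D.N (D.I - 1) := by
    rw [D.N_I_sub_one]; exact (D.mul_le' le_rfl D.N_p_le).trans_lt D.N_two_lt_s
  have h2 : D.N (D.I - 1 + -(2 * D.p)) = D.N (D.I - 1) := D.add_eq_left (by rwa [D.N.map_neg])
  rw [← map_pow, ← D.N_I_sub_one, ← h2]
  congr 1; linear_combination D.p_eq

lemma N_p_pos : 0 < D.N D.p := by
  rcases (D.N.nonneg D.p).lt_or_eq with h | h
  · exact h
  · have h' := D.N_p_sq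
    rw [← h, zero_pow two_ne_zero] at h'
    exact absurd h' D.N_s_pos.ne

lemma p_ne : D.p ≠ 0 := by intro h; have := D.N_p_pos; rw [h] at this; simp at this

lemma N_p_lt : D.N D.p < 1 := by
  have := D.N_p_sq; have := D.N_s_lt; have := D.N_p_pos; nlinarith

lemma N_s_lt_p : D.N D.s < D.N D.p := by
  rw [← D.N_p_sq]; have := D.N_p_lt; have := D.N_p_pos; nlinarith

/-- Representatives of the residue field with four elements. -/
def rep : Fin 4 → E := ![0, 1, D.w, D.w ^ 2]

/-- The square of `w - 1` is `-3 * w`, a unit. This keeps the cube roots of unity distinct in the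
residue field. -/
lemma N_w_sub_one : D.N (D.w - 1) = 1 := by
  apply D.one_of_pow two_ne_zero
  have : (D.w - 1) ^ 2 = -(3 * D.w) := by linear_combination D.w_sq
  rw [this, D.N.map_neg, map_mul, D.N_three, D.N_w, one_mul]

lemma rep_sub {a b : Fin 4} (h : a ≠ b) : D.N (D.rep a - D.rep b) = 1 := by
  have h1 := D.N_w_sub_one
  have h1' : D.N (1 - D.w) = 1 := by rw [D.N.map_sub, h1]
  have h2 : D.N (D.w ^ 2 - 1) = 1 := by
    have : D.w ^ 2 - 1 = - (D.w ^ 2 * (D.w - 1)) := by linear_combination D.w_cube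
    rw [this, D.N.map_neg, map_mul, map_pow, D.N_w, h1]; norm_num
  have h2' : D.N (1 - D.w ^ 2) = 1 := by rw [D.N.map_sub, h2]
  have h3 : D.N (D.w ^ 2 - D.w) = 1 := by
    have : D.w ^ 2 - D.w = D.w * (D.w - 1) := by ring
    rw [this, map_mul, D.N_w, h1]; norm_num
  have h3' : D.N (D.w - D.w ^ 2) = 1 := by rw [D.N.map_sub, h3]
  fin_cases a <;> fin_cases b <;> first | exact absurd rfl h | skip
  all_goals simp [rep, D.N_w, h1, h1', h2, h2', h3, h3', D.N.map_neg]

lemma N_rep_le (a : Fin 4) : D.N (D.rep a) ≤ 1 := by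
  fin_cases a <;> simp [rep, D.N_w]

lemma rep_eq {a b : Fin 4} (h : D.N (D.rep a - D.rep b) < 1) : a = b := by
  by_contra h'
  rw [D.rep_sub h'] at h; exact lt_irrefl _ h

lemma N_rep {a : Fin 4} (h : a ≠ 0) : D.N (D.rep a) = 1 := by
  have := D.rep_sub h
  simpa [rep] using this

end DyadicData

/-! ### Lattice classes and the integrality criterion. -/

namespace DyadicData

variable {E : Type*} [Field E] (D : DyadicData E)

/-- The matrix has entries in the valuation ring. -/
def IntM (M : Matrix (Fin 2) (Fin 2) E) : Prop := ∀ i j, D.N (M i j) ≤ 1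

/-- The matrix is invertible over the valuation ring. -/
def Unim (U : Matrix (Fin 2) (Fin 2) E) : Prop := D.IntM U ∧ D.N U.det = 1

/-- Equality of cosets in `GL₂(O) \ GL₂(E) / Eˣ`. -/
def Eqv (g g' : Matrix (Fin 2) (Fin 2) E) : Prop :=
  ∃ c : E, c ≠ 0 ∧ ∃ U, D.Unim U ∧ c • g' = U * g

variable {D}

lemma intM_of {a b c d : E} (ha : D.N a ≤ 1) (hb : D.N b ≤ 1) (hc : D.N c ≤ 1) (hd : D.N d ≤ 1) :
    D.IntM !![a, b; c, d] := by
  intro i j; fin_cases i <;> fin_cases j <;> simpa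

lemma IntM.mul {A B : Matrix (Fin 2) (Fin 2) E} (hA : D.IntM A) (hB : D.IntM B) :
    D.IntM (A * B) := by
  intro i j
  rw [Matrix.mul_apply, Fin.sum_univ_two]
  exact D.add_le (D.mul_le (hA _ _) (hB _ _)) (D.mul_le (hA _ _) (hB _ _))

lemma Unim.mul {A B : Matrix (Fin 2) (Fin 2) E} (hA : D.Unim A) (hB : D.Unim B) :
    D.Unim (A * B) :=
  ⟨hA.1.mul hB.1, by rw [Matrix.det_mul, map_mul, hA.2, hB.2, one_mul]⟩

lemma Unim.exists_inv {U : Matrix (Fin 2) (Fin 2) E} (hU : D.Unim U) :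
    ∃ U', D.Unim U' ∧ U' * U = 1 ∧ U * U' = 1 := by
  have hd : U.det ≠ 0 := D.ne_zero_of_N one_pos hU.2
  have hdu : IsUnit U.det := isUnit_iff_ne_zero.mpr hd
  refine ⟨U⁻¹, ⟨?_, ?_⟩, Matrix.nonsing_inv_mul _ hdu, Matrix.mul_nonsing_inv _ hdu⟩
  · intro i j
    rw [Matrix.inv_def, Matrix.smul_apply, smul_eq_mul, Ring.inverse_eq_inv', map_mul, map_inv₀,
      hU.2, inv_one, one_mul, Matrix.adjugate_fin_two]
    have := hU.1
    fin_cases i <;> fin_cases j <;> simp [D.N.map_neg, this _ _]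
  · rw [Matrix.det_nonsing_inv, Ring.inverse_eq_inv', map_inv₀, hU.2, inv_one]

lemma unim_one : D.Unim 1 := by
  refine ⟨fun i j => ?_, by simp⟩
  fin_cases i <;> fin_cases j <;> simp

lemma Eqv.refl (g : Matrix (Fin 2) (Fin 2) E) : D.Eqv g g :=
  ⟨1, one_ne_zero, 1, unim_one, by simp⟩

lemma Eqv.symm {g g' : Matrix (Fin 2) (Fin 2) E} (h : D.Eqv g g') : D.Eqv g' g := by
  obtain ⟨c, hc, U, hU, h⟩ := h
  obtain ⟨U', hU', h1, -⟩ := hU.exists_inv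
  refine ⟨c⁻¹, inv_ne_zero hc, U', hU', ?_⟩
  have : U' * (c • g') = g := by rw [h, ← mul_assoc, h1, one_mul]
  rw [← this, Matrix.mul_smul, smul_smul, inv_mul_cancel₀ hc, one_smul]

lemma Eqv.trans {g g' g'' : Matrix (Fin 2) (Fin 2) E} (h : D.Eqv g g') (h' : D.Eqv g' g'') :
    D.Eqv g g'' := by
  obtain ⟨c, hc, U, hU, h⟩ := h
  obtain ⟨c', hc', U', hU', h'⟩ := h'
  refine ⟨c * c', mul_ne_zero hc hc', U' * U, hU'.mul hU, ?_⟩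
  rw [mul_smul, h', ← Matrix.mul_smul, h, mul_assoc]

lemma Eqv.mul_right {g g' : Matrix (Fin 2) (Fin 2) E} (h : D.Eqv g g')
    (k : Matrix (Fin 2) (Fin 2) E) : D.Eqv (g * k) (g' * k) := by
  obtain ⟨c, hc, U, hU, h⟩ := h
  refine ⟨c, hc, U, hU, ?_⟩
  rw [← Matrix.smul_mul, h, mul_assoc]

lemma Eqv.det_ne {g g' : Matrix (Fin 2) (Fin 2) E} (h : D.Eqv g g') (hg : g.det ≠ 0) :
    g'.det ≠ 0 := by
  obtain ⟨c, hc, U, hU, h⟩ := h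
  intro h'
  have := congrArg Matrix.det h
  rw [Matrix.det_smul, h', Matrix.det_mul, mul_zero] at this
  exact mul_ne_zero (D.ne_zero_of_N one_pos hU.2) hg this.symm

variable (D)

/-- The image of the generator `i` under the explicit quaternion representation. -/
def A₀ : Matrix (Fin 2) (Fin 2) E := !![-(D.r / 3), D.s; -(D.s / 3), D.r / 3]

/-- The image of the generator `j` under the explicit quaternion representation. -/
def B₀ : Matrix (Fin 2) (Fin 2) E :=
  !![-(D.r / 3), D.w ^ 2 * D.s; -(D.w * D.s / 3), D.r / 3]

/-- The conjugate of the explicit representation by `g` is integral. -/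
def Intg (g : Matrix (Fin 2) (Fin 2) E) : Prop :=
  ∃ A B, D.IntM A ∧ D.IntM B ∧ A * g = g * D.A₀ ∧ B * g = g * D.B₀

section
variable [CharZero E]

lemma A₀_sq : D.A₀ * D.A₀ = -1 := by
  ext i j
  fin_cases i <;> fin_cases j <;> simp [A₀, Matrix.mul_apply, Fin.sum_univ_two]
  · linear_combination (1 / 9 : E) * D.hr - (1 / 3 : E) * D.hs
  · ring
  · ring
  · linear_combination (1 / 9 : E) * D.hr - (1 / 3 : E) * D.hs

lemma B₀_sq : D.B₀ * D.B₀ = -1 := by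
  ext i j
  fin_cases i <;> fin_cases j <;> simp [B₀, Matrix.mul_apply, Fin.sum_univ_two]
  · linear_combination (1 / 9 : E) * D.hr - (1 / 3 : E) * D.hs - (1 / 3 * D.s ^ 2) * D.w_cube
  · ring
  · ring
  · linear_combination (1 / 9 : E) * D.hr - (1 / 3 : E) * D.hs - (1 / 3 * D.s ^ 2) * D.w_cube

lemma A₀_mul_B₀ : D.A₀ * D.B₀ =
    !![-(D.r / 3), D.w * D.s; -(D.w ^ 2 * D.s / 3), D.r / 3] := by
  ext i j
  fin_cases i <;> fin_cases j <;> simp [A₀, B₀, Matrix.mul_apply, Fin.sum_univ_two]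
  · linear_combination (1 / 9 : E) * D.hr - (D.w / 3 : E) * D.hs + (1 / 3 : E) * D.r_eq
  · linear_combination (- D.w ^ 2 * D.s / 3 + D.s / 3) * D.r_eq
      + (-(2 * D.w + 1) * D.s / 3 + 2 / 3 * D.s) * D.w_sq
  · linear_combination (D.s / 9 - D.w * D.s / 9) * D.r_eq + (D.s / 9) * D.w_sq
  · linear_combination (1 / 9 : E) * D.hr - (D.w ^ 2 / 3 : E) * D.hs - (1 / 3 : E) * D.r_eq - 2/3 * D.w_sq

lemma B₀_mul_A₀ : D.B₀ * D.A₀ = -(D.A₀ * D.B₀) := by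
  rw [A₀_mul_B₀]
  ext i j
  fin_cases i <;> fin_cases j <;> simp [A₀, B₀, Matrix.mul_apply, Fin.sum_univ_two]
  · linear_combination (1 / 9 : E) * D.hr - (D.w ^ 2 / 3 : E) * D.hs - (1 / 3 : E) * D.r_eq - 2/3 * D.w_sq
  · linear_combination -((- D.w ^ 2 * D.s / 3 + D.s / 3) * D.r_eq
      + (-(2 * D.w + 1) * D.s / 3 + 2 / 3 * D.s) * D.w_sq)
  · linear_combination -((D.s / 9 - D.w * D.s / 9) * D.r_eq + (D.s / 9) * D.w_sq)
  · linear_combination (1 / 9 : E) * D.hr - (D.w / 3 : E) * D.hs + (1 / 3 : E) * D.r_eq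

end

variable {D}

lemma Eqv.intg {g g' : Matrix (Fin 2) (Fin 2) E} (h : D.Eqv g g') (hg : D.Intg g) :
    D.Intg g' := by
  obtain ⟨c, hc, U, hU, h⟩ := h
  obtain ⟨U', hU', h1, h2⟩ := hU.exists_inv
  obtain ⟨A, B, hA, hB, hAg, hBg⟩ := hg
  have key : ∀ X Y : Matrix (Fin 2) (Fin 2) E, X * g = g * Y → U * X * U' * g' = g' * Y := by
    intro X Y hXY
    have : c • (U * X * U' * g') = c • (g' * Y) := by
      rw [← Matrix.mul_smul, h, ← Matrix.smul_mul, h]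
      calc U * X * U' * (U * g) = U * X * (U' * U) * g := by simp only [mul_assoc]
        _ = U * g * Y := by rw [h1, mul_one, mul_assoc, hXY, mul_assoc]
    exact smul_right_injective _ hc this
  exact ⟨_, _, (hU.1.mul hA).mul hU'.1, (hU.1.mul hB).mul hU'.1, key A _ hAg, key B _ hBg⟩

/-- A lower triangular matrix. -/
def V (P t : E) : Matrix (Fin 2) (Fin 2) E := !![P, 0; t, 1]

/-- A lower triangular matrix with its columns swapped. -/
def W (P t : E) : Matrix (Fin 2) (Fin 2) E := !![0, P; 1, t]

variable (E) in
/-- The matrix that swaps the two coordinates. -/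
def S : Matrix (Fin 2) (Fin 2) E := !![0, 1; 1, 0]

lemma V_mul_S (P t : E) : V P t * S E = W P t := by
  ext i j
  fin_cases i <;> fin_cases j <;> simp [V, W, S, Matrix.mul_apply, Fin.sum_univ_two]

lemma S_mul_S : S E * S E = 1 := by
  ext i j
  fin_cases i <;> fin_cases j <;> simp [S, Matrix.mul_apply, Fin.sum_univ_two]

lemma unim_S : D.Unim (S E) := by
  refine ⟨intM_of ?_ ?_ ?_ ?_, ?_⟩ <;> simp [S, Matrix.det_fin_two_of, D.N.map_neg]

lemma eqv_S_mul (g : Matrix (Fin 2) (Fin 2) E) : D.Eqv (S E * g) g :=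
  ⟨1, one_ne_zero, S E, unim_S, by rw [one_smul, ← mul_assoc, S_mul_S, one_mul]⟩

lemma det_V (P t : E) : (V P t).det = P := by simp [V, Matrix.det_fin_two_of]
lemma det_W (P t : E) : (W P t).det = -P := by simp [W, Matrix.det_fin_two_of]

lemma N_div_le {x y : E} (hy : y ≠ 0) (h : D.N x ≤ D.N y) : D.N (x / y) ≤ 1 := by
  rw [map_div₀]; exact (div_le_one (D.N.pos hy)).mpr h

lemma eqv_V {P P' t t' : E} (hP : P ≠ 0) (hPP : D.N P = D.N P') (ht : D.N (t - t') ≤ D.N P) :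
    D.Eqv (V P t) (V P' t') := by
  refine ⟨1, one_ne_zero, !![P' / P, 0; (t' - t) / P, 1], ⟨intM_of ?_ ?_ ?_ ?_, ?_⟩, ?_⟩
  · exact N_div_le hP hPP.ge
  · simp
  · exact N_div_le hP (by rwa [D.N.map_sub])
  · simp
  · rw [Matrix.det_fin_two_of]; simp [map_div₀, hPP, div_self (hPP ▸ (D.N.pos hP).ne')]
  · rw [one_smul]
    ext i j
    fin_cases i <;> fin_cases j <;> simp [V, Matrix.mul_apply, Fin.sum_univ_two, hP]

lemma eqv_W {P P' t t' : E} (hP : P ≠ 0) (hPP : D.N P = D.N P') (ht : D.N (t - t') ≤ D.N P) :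
    D.Eqv (W P t) (W P' t') := by
  rw [← V_mul_S, ← V_mul_S]; exact (eqv_V hP hPP ht).mul_right _

/-- The upper right entry forces the unimodular factor to be lower triangular. Its diagonal entries
have norm at most 1 and their product has norm 1, so both are units. -/
lemma Eqv.of_V {P P' t t' : E} (h : D.Eqv (V P t) (V P' t')) :
    D.N P = D.N P' ∧ D.N (t - t') ≤ D.N P := by
  obtain ⟨c, hc, U, hU, h⟩ := h
  have h00 := congrFun (congrFun h 0) 0
  have h01 := congrFun (congrFun h 0) 1
  have h10 := congrFun (congrFun h 1) 0
  have h11 := congrFun (congrFun h 1) 1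
  simp [V, Matrix.mul_apply, Fin.sum_univ_two] at h00 h01 h10 h11
  have hd := hU.2
  rw [Matrix.det_fin_two, ← h01, zero_mul, sub_zero, map_mul] at hd
  have h0 := hU.1 0 0
  have h1 := hU.1 1 1
  have hU0 : D.N (U 0 0) = 1 := by nlinarith [D.N.nonneg (U 0 0), D.N.nonneg (U 1 1)]
  have hU1 : D.N (U 1 1) = 1 := by rwa [hU0, one_mul] at hd
  have hcN : D.N c = 1 := by rw [h11, hU1]
  constructor
  · have := congrArg D.N h00
    rw [← h01, zero_mul, add_zero, map_mul, map_mul, hcN, hU0] at this; linarith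
  · have : c * (t' - t) = U 1 0 * P := by rw [← h11] at h10; linear_combination h10
    have := congrArg D.N this
    rw [map_mul, hcN, one_mul] at this
    rw [D.N.map_sub, this]; exact D.mul_le (hU.1 1 0) le_rfl

lemma Eqv.of_W {P P' t t' : E} (h : D.Eqv (W P t) (W P' t')) :
    D.N P = D.N P' ∧ D.N (t - t') ≤ D.N P := by
  have := h.mul_right (S E)
  simp only [← V_mul_S, mul_assoc, S_mul_S, mul_one] at this
  exact this.of_V

/-- Used contrapositively, to separate the two charts. The second row gives `c * (1 - t' * t) = U 1
0 * P` with `1 - t' * t` a unit, so `c` is at most as large as `P`; the determinants give `N c ^ 2 *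
N P' = N P`. -/
lemma Eqv.of_V_W {P P' t t' : E} (hP : P ≠ 0) (hP' : P' ≠ 0) (ht : D.N t ≤ 1) (ht' : D.N t' < 1)
    (h : D.Eqv (V P t) (W P' t')) : 1 ≤ D.N P * D.N P' := by
  obtain ⟨c, hc, U, hU, h⟩ := h
  have h10 := congrFun (congrFun h 1) 0
  have h11 := congrFun (congrFun h 1) 1
  simp [V, W, Matrix.mul_apply, Fin.sum_univ_two] at h10 h11
  have hd := congrArg (fun M => D.N (Matrix.det M)) h
  simp only [Matrix.det_smul, Matrix.det_mul, det_V, det_W, map_mul, hU.2, one_mul, Fintype.card_fin,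
    map_pow, D.N.map_neg] at hd
  have hu : D.N (1 - t' * t) = 1 := by
    have : D.N (1 + -(t' * t)) = D.N 1 := D.add_eq_left (by
      rw [D.N.map_neg, map_one]; exact (D.mul_le' le_rfl ht).trans_lt ht')
    rwa [map_one, ← sub_eq_add_neg] at this
  have h1 : c * (1 - t' * t) = U 1 0 * P := by rw [← h11] at h10; linear_combination h10
  have h2 := congrArg D.N h1
  rw [map_mul, hu, mul_one] at h2
  have h3 : D.N c ≤ D.N P := by rw [h2]; exact D.mul_le (hU.1 1 0) le_rfl
  have hPpos := D.N.pos hP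
  have hPpos' := D.N.pos hP'
  have hcp := D.N.pos hc
  have h4 : D.N P ≤ D.N P ^ 2 * D.N P' :=
    hd.ge.trans (mul_le_mul_of_nonneg_right (pow_le_pow_left₀ hcp.le h3 2) hPpos'.le)
  have : D.N P * 1 ≤ D.N P * (D.N P * D.N P') := by linarith
  exact le_of_mul_le_mul_left this hPpos

/-- Two combinations of the generators with cube roots of unity as coefficients are multiples of
elementary matrices: `A₀ + w² B₀ + w A₀B₀` is `-s` in the lower left corner, and `A₀ + w B₀ + w²
A₀B₀` is `3 s` in the upper right one. After conjugation by `V P t` their lower left entries are `-s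
/ P` and `-3 t² s / P`. -/
lemma Intg.of_V [CharZero E] {P t : E} (h : D.Intg (V P t)) :
    D.N D.s ≤ D.N P ∧ D.N (t ^ 2 * D.s) ≤ D.N P := by
  obtain ⟨A, B, hA, hB, h1, h2⟩ := h
  have h3 : (A * B) * V P t = V P t * (D.A₀ * D.B₀) := by
    rw [mul_assoc, h2, ← mul_assoc, h1, mul_assoc]
  have hAB := hA.mul hB
  generalize A * B = C at h3 hAB
  rw [A₀_mul_B₀] at h3
  have a0 := congrFun (congrFun h1 1) 0
  have a1 := congrFun (congrFun h1 1) 1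
  have b0 := congrFun (congrFun h2 1) 0
  have b1 := congrFun (congrFun h2 1) 1
  have c0 := congrFun (congrFun h3 1) 0
  have c1 := congrFun (congrFun h3 1) 1
  simp [V, A₀, B₀, Matrix.mul_apply, Fin.sum_univ_two] at a0 a1 b0 b1 c0 c1
  rw [a1] at a0
  rw [b1] at b0
  rw [c1] at c0
  have hw : D.N (D.w ^ 2) ≤ 1 := by rw [map_pow, D.N_w]; norm_num
  constructor
  · have : -D.s = (A 1 0 + D.w ^ 2 * B 1 0 + D.w * C 1 0) * P := by
      linear_combination -a0 - D.w ^ 2 * b0 - D.w * c0 + (2 / 3 * t * D.r) * D.w_sq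
        + (2 / 3 * D.s) * D.w_cube + t ^ 2 * D.s * (D.w * D.w_cube + D.w_sq)
    rw [← D.N.map_neg, this]
    exact D.mul_le (D.add_le (D.add_le (hA _ _) (D.mul_le hw (hB _ _)))
      (D.mul_le D.N_w.le (hAB _ _))) le_rfl
  · have : -3 * (t ^ 2 * D.s) = (A 1 0 + D.w * B 1 0 + D.w ^ 2 * C 1 0) * P := by
      linear_combination -a0 - D.w * b0 - D.w ^ 2 * c0 + (2 / 3 * t * D.r) * D.w_sq
        + D.s / 3 * (D.w * D.w_cube + D.w_sq) + 2 * t ^ 2 * D.s * D.w_cube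
    have h3 : D.N (-3 * (t ^ 2 * D.s)) = D.N (t ^ 2 * D.s) := by
      rw [map_mul, D.N.map_neg, D.N_three, one_mul]
    rw [← h3, this]
    exact D.mul_le (D.add_le (D.add_le (hA _ _) (D.mul_le D.N_w.le (hB _ _)))
      (D.mul_le hw (hAB _ _))) le_rfl

/-- With the columns swapped, the combination supported in the upper right corner is the one that
bounds `P`. -/
lemma Intg.of_W [CharZero E] {P t : E} (h : D.Intg (W P t)) : D.N D.s ≤ D.N P := by
  obtain ⟨A, B, hA, hB, h1, h2⟩ := h
  have h3 : (A * B) * W P t = W P t * (D.A₀ * D.B₀) := by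
    rw [mul_assoc, h2, ← mul_assoc, h1, mul_assoc]
  have hAB := hA.mul hB
  generalize A * B = C at h3 hAB
  rw [A₀_mul_B₀] at h3
  have a0 := congrFun (congrFun h1 1) 0
  have a1 := congrFun (congrFun h1 1) 1
  have b0 := congrFun (congrFun h2 1) 0
  have b1 := congrFun (congrFun h2 1) 1
  have c0 := congrFun (congrFun h3 1) 0
  have c1 := congrFun (congrFun h3 1) 1
  simp [W, A₀, B₀, Matrix.mul_apply, Fin.sum_univ_two] at a0 a1 b0 b1 c0 c1
  rw [a0] at a1
  rw [b0] at b1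
  rw [c0] at c1
  have hw : D.N (D.w ^ 2) ≤ 1 := by rw [map_pow, D.N_w]; norm_num
  have : 3 * D.s = (A 1 0 + D.w * B 1 0 + D.w ^ 2 * C 1 0) * P := by
    linear_combination -a1 - D.w * b1 - D.w ^ 2 * c1 - (2 / 3 * t * D.r) * D.w_sq
      - t ^ 2 * D.s / 3 * (D.w * D.w_cube + D.w_sq) - 2 * D.s * D.w_cube
  have h3 : D.N (3 * D.s) = D.N D.s := by rw [map_mul, D.N_three, one_mul]
  rw [← h3, this]
  exact D.mul_le (D.add_le (D.add_le (hA _ _) (D.mul_le D.N_w.le (hB _ _)))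
    (D.mul_le hw (hAB _ _))) le_rfl

lemma N_div_three (x : E) : D.N (x / 3) = D.N x := by rw [map_div₀, D.N_three, div_one]

/-- The generators are scalar modulo `s`. Only the lower left entry of the conjugate has the
denominator `P`, and its numerator is a combination of 2 and `s`, both divisible by `P`. -/
lemma intg_V [CharZero E] {P t : E} (hP : P ≠ 0) (hs : D.N D.s ≤ D.N P) (hP1 : D.N P ≤ 1)
    (ht : D.N t ≤ 1) : D.Intg (V P t) := by
  have hs1 := D.N_s_lt.le
  have hr := D.N_r.le
  have hw := D.N_w.le
  have hw2 : D.N (D.w ^ 2) ≤ 1 := by rw [map_pow, D.N_w]; norm_num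
  have ht2 : D.N (t ^ 2) ≤ 1 := by rw [map_pow]; exact pow_le_one₀ (D.N.nonneg _) ht
  have h2 : D.N 2 ≤ D.N P := D.N_two_lt_s.le.trans hs
  -- One computation covers both generators: `x = y = 1` for `A₀`, and `x = w²`, `y = w` for `B₀`.
  have key : ∀ x y : E, D.N x ≤ 1 → D.N y ≤ 1 →
      D.IntM !![-(D.r / 3) - t * (x * D.s), P * (x * D.s);
        (-(2 * (t * D.r / 3)) - y * D.s / 3 - t ^ 2 * x * D.s) / P, t * (x * D.s) + D.r / 3] := by
    intro x y hx hy
    have hr3 : D.N (D.r / 3) ≤ 1 := by rwa [N_div_three]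
    have hxs : D.N (x * D.s) ≤ 1 := D.mul_le hx hs1
    refine intM_of (D.sub_le (by rwa [D.N.map_neg]) (D.mul_le ht hxs)) (D.mul_le hP1 hxs)
      (N_div_le hP ?_) (D.add_le (D.mul_le ht hxs) hr3)
    refine D.sub_le (D.sub_le ?_ ?_) ?_
    · rw [D.N.map_neg]; refine D.mul_le' h2 ?_; rw [N_div_three]; exact D.mul_le ht hr
    · rw [N_div_three]; exact D.mul_le hy hs
    · exact D.mul_le (D.mul_le ht2 hx) hs
  refine ⟨_, _, key 1 1 (by simp) (by simp), key (D.w ^ 2) D.w hw2 hw, ?_, ?_⟩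
  · ext i j
    fin_cases i <;> fin_cases j <;>
      simp [V, A₀, Matrix.mul_apply, Fin.sum_univ_two, hP] <;> ring
  · ext i j
    fin_cases i <;> fin_cases j <;>
      simp [V, B₀, Matrix.mul_apply, Fin.sum_univ_two, hP] <;> ring

lemma intg_W [CharZero E] {P t : E} (hP : P ≠ 0) (hs : D.N D.s ≤ D.N P) (hP1 : D.N P ≤ 1)
    (ht : D.N t ≤ 1) : D.Intg (W P t) := by
  have hs1 := D.N_s_lt.le
  have hr := D.N_r.le
  have hw := D.N_w.le
  have hw2 : D.N (D.w ^ 2) ≤ 1 := by rw [map_pow, D.N_w]; norm_num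
  have ht2 : D.N (t ^ 2) ≤ 1 := by rw [map_pow]; exact pow_le_one₀ (D.N.nonneg _) ht
  have h2 : D.N 2 ≤ D.N P := D.N_two_lt_s.le.trans hs
  have key : ∀ x y : E, D.N x ≤ 1 → D.N y ≤ 1 →
      D.IntM !![D.r / 3 + t * (y * D.s) / 3, -(P * (y * D.s) / 3);
        (2 * (t * D.r / 3) + x * D.s + t ^ 2 * y * D.s / 3) / P,
        -(D.r / 3) - t * (y * D.s) / 3] := by
    intro x y hx hy
    have hr3 : D.N (D.r / 3) ≤ 1 := by rwa [N_div_three]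
    have hys : D.N (y * D.s) ≤ 1 := D.mul_le hy hs1
    refine intM_of (D.add_le hr3 ?_) ?_
      (N_div_le hP ?_) (D.sub_le (by rwa [D.N.map_neg]) ?_)
    · rw [N_div_three]; exact D.mul_le ht hys
    · rw [D.N.map_neg, N_div_three]; exact D.mul_le hP1 hys
    · refine D.add_le (D.add_le ?_ ?_) ?_
      · refine D.mul_le' h2 ?_; rw [N_div_three]; exact D.mul_le ht hr
      · exact D.mul_le hx hs
      · rw [N_div_three]; exact D.mul_le (D.mul_le ht2 hy) hs
    · rw [N_div_three]; exact D.mul_le ht hys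
  refine ⟨_, _, key 1 1 (by simp) (by simp), key (D.w ^ 2) D.w hw2 hw, ?_, ?_⟩
  · ext i j
    fin_cases i <;> fin_cases j <;>
      simp [W, A₀, Matrix.mul_apply, Fin.sum_univ_two, hP] <;> ring
  · ext i j
    fin_cases i <;> fin_cases j <;>
      simp [W, B₀, Matrix.mul_apply, Fin.sum_univ_two, hP] <;> ring

end DyadicData

/-! ### Uniformizers of subfields and normal forms of matrices over them. -/

namespace DyadicData

variable {E : Type*} [Field E] {D : DyadicData E}

variable (D) in
/-- `u` is a uniformizer of the subfield `L`, whose residue field has at most four elements. -/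
structure Unif (L : Subfield E) (u : E) : Prop where
  mem : u ∈ L
  ne : u ≠ 0
  lt : D.N u < 1
  val : ∀ x ∈ L, x ≠ 0 → ∃ n : ℤ, D.N x = D.N u ^ n
  res : ∀ x ∈ L, D.N x ≤ 1 → ∃ a, D.N (x - D.rep a) ≤ D.N u

lemma exists_nat_of_zpow_le {c : ℝ} (hc : 0 < c) (hc1 : c < 1) {n : ℤ} (h : c ^ n ≤ 1) :
    ∃ m : ℕ, n = m := by
  refine ⟨n.toNat, (Int.toNat_of_nonneg ?_).symm⟩
  by_contra! h'
  exact absurd h (not_le.mpr (one_lt_zpow_of_neg₀ hc hc1 h'))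

lemma Unif.exists_pow {L : Subfield E} {u : E} (hu : D.Unif L u) {x : E} (hx : x ∈ L)
    (h0 : x ≠ 0) (h1 : D.N x ≤ 1) : ∃ n : ℕ, D.N x = D.N u ^ n := by
  obtain ⟨n, hn⟩ := hu.val x hx h0
  obtain ⟨m, rfl⟩ := exists_nat_of_zpow_le (D.N.pos hu.ne) hu.lt (hn ▸ h1)
  exact ⟨m, by rw [hn, zpow_natCast]⟩

lemma Unif.le_of_lt {L : Subfield E} {u : E} (hu : D.Unif L u) {x : E} (hx : x ∈ L)
    (h1 : D.N x < 1) : D.N x ≤ D.N u := by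
  rcases eq_or_ne x 0 with rfl | h0
  · simp
  obtain ⟨n, hn⟩ := hu.exists_pow hx h0 h1.le
  rw [hn] at h1 ⊢
  rcases Nat.eq_zero_or_pos n with rfl | h
  · simp at h1
  · exact pow_le_of_le_one (D.N.nonneg u) hu.lt.le h.ne'

/-- Iwasawa decomposition: the lower right entry is scaled to 1, a row operation clears the entry
above it, and the remaining diagonal entry is a unit times a power of `u`. -/
lemma Unif.eqv_V_of_max {L : Subfield E} {u : E} (hu : D.Unif L u)
    {g : Matrix (Fin 2) (Fin 2) E} (hg : ∀ i j, g i j ∈ L) (hdet : g.det ≠ 0)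
    (hmax : ∀ i j, D.N (g i j) ≤ D.N (g 1 1)) :
    ∃ n : ℕ, D.Eqv g (V (u ^ n) (g 1 0 / g 1 1)) := by
  have h11 : g 1 1 ≠ 0 := by
    intro h0
    have : ∀ i j, g i j = 0 := fun i j => by
      have := hmax i j
      rw [h0, map_zero] at this
      exact (AbsoluteValue.nonpos_iff D.N).mp this
    apply hdet
    rw [Matrix.det_fin_two, this, this 0 1]; ring
  have hle : ∀ i j, D.N (g i j / g 1 1) ≤ 1 := fun i j => N_div_le h11 (hmax i j)
  set d := g 0 0 / g 1 1 - (g 0 1 / g 1 1) * (g 1 0 / g 1 1) with hd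
  have hd0 : d ≠ 0 := by
    have : d = g.det / g 1 1 ^ 2 := by rw [hd, Matrix.det_fin_two]; field_simp
    rw [this]; exact div_ne_zero hdet (pow_ne_zero _ h11)
  have hdL : d ∈ L := L.sub_mem (L.div_mem (hg _ _) (hg _ _))
    (L.mul_mem (L.div_mem (hg _ _) (hg _ _)) (L.div_mem (hg _ _) (hg _ _)))
  have hd1 : D.N d ≤ 1 := D.sub_le (hle _ _) (D.mul_le (hle _ _) (hle _ _))
  obtain ⟨n, hn⟩ := hu.exists_pow hdL hd0 hd1
  have hud : D.N (u ^ n / d) = 1 := by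
    rw [map_div₀, map_pow, hn, div_self (pow_ne_zero _ (D.N.pos hu.ne).ne')]
  refine ⟨n, g 1 1, h11, !![u ^ n / d, -(u ^ n / d) * (g 0 1 / g 1 1); 0, 1],
    ⟨intM_of hud.le ?_ (by simp) (by simp), ?_⟩, ?_⟩
  · exact D.mul_le (by rw [D.N.map_neg]; exact hud.le) (hle _ _)
  · rw [Matrix.det_fin_two_of]; simpa using hud
  · ext i j
    fin_cases i <;> fin_cases j <;> simp [V, Matrix.mul_apply, Fin.sum_univ_two]
    · have : u ^ n / d * g 0 0 + -(u ^ n / d * (g 0 1 / g 1 1) * g 1 0)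
        = g 1 1 * ((u ^ n / d) * d) := by
        rw [hd]; field_simp; ring
      rw [this, div_mul_cancel₀ _ hd0]
    · field_simp; ring
    · field_simp

/-- The two alternatives are the two charts of the projective line. The strict inequality in the
second puts its parameter in the maximal ideal, so that the charts do not overlap. -/
lemma Unif.eqv_V_or_W {L : Subfield E} {u : E} (hu : D.Unif L u)
    {g : Matrix (Fin 2) (Fin 2) E} (hg : ∀ i j, g i j ∈ L) (hdet : g.det ≠ 0) :
    ∃ n : ℕ, ∃ t ∈ L, (D.N t ≤ 1 ∧ D.Eqv g (V (u ^ n) t)) ∨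
      (D.N t < 1 ∧ D.Eqv g (W (u ^ n) t)) := by
  have hdS : (S E).det = -1 := by simp [S, Matrix.det_fin_two_of]
  have hrow : ∀ g : Matrix (Fin 2) (Fin 2) E, (∀ i j, g i j ∈ L) → g.det ≠ 0 →
      (∀ i j, D.N (g i j) ≤ D.N (g 1 1)) ∨ ((∀ i j, D.N (g i j) ≤ D.N (g 1 0)) ∧
        D.N (g 1 1) < D.N (g 1 0)) →
      ∃ n : ℕ, ∃ t ∈ L, (D.N t ≤ 1 ∧ D.Eqv g (V (u ^ n) t)) ∨
      (D.N t < 1 ∧ D.Eqv g (W (u ^ n) t)) := by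
    intro g hg hdet h
    rcases h with h | ⟨h, hlt⟩
    · obtain ⟨n, hn⟩ := hu.eqv_V_of_max hg hdet h
      refine ⟨n, _, L.div_mem (hg 1 0) (hg 1 1), Or.inl ⟨?_, hn⟩⟩
      rw [map_div₀]; exact div_le_one_of_le₀ (h _ _) (D.N.nonneg _)
    · have hgS : g * S E = !![g 0 1, g 0 0; g 1 1, g 1 0] := by
        ext i j
        fin_cases i <;> fin_cases j <;> simp [S, Matrix.mul_apply, Fin.sum_univ_two]
      obtain ⟨n, hn⟩ := hu.eqv_V_of_max (g := g * S E)
        (by rw [hgS]; intro i j; fin_cases i <;> fin_cases j <;> simp [hg])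
        (by rw [Matrix.det_mul, hdS]; simpa using hdet)
        (by rw [hgS]; intro i j; fin_cases i <;> fin_cases j <;> simp [h])
      have h2 := hn.mul_right (S E)
      rw [mul_assoc, S_mul_S, mul_one, V_mul_S, hgS] at h2
      refine ⟨n, _, L.div_mem (hg 1 1) (hg 1 0), Or.inr ⟨?_, h2⟩⟩
      rw [map_div₀]; exact (div_lt_one ((D.N.nonneg _).trans_lt hlt)).mpr hlt
  have hSg : S E * g = !![g 1 0, g 1 1; g 0 0, g 0 1] := by
    ext i j
    fin_cases i <;> fin_cases j <;> simp [S, Matrix.mul_apply, Fin.sum_univ_two]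
  have hswap : (∀ i j, D.N ((S E * g) i j) ≤ D.N ((S E * g) 1 1)) ∨
      ((∀ i j, D.N ((S E * g) i j) ≤ D.N ((S E * g) 1 0)) ∧
        D.N ((S E * g) 1 1) < D.N ((S E * g) 1 0)) →
      ∃ n : ℕ, ∃ t ∈ L, (D.N t ≤ 1 ∧ D.Eqv g (V (u ^ n) t)) ∨
      (D.N t < 1 ∧ D.Eqv g (W (u ^ n) t)) := by
    intro h
    obtain ⟨n, t, ht, h⟩ := hrow (S E * g)
      (by rw [hSg]; intro i j; fin_cases i <;> fin_cases j <;> simp [hg])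
      (by rw [Matrix.det_mul, hdS]; simpa using hdet) h
    exact ⟨n, t, ht, h.imp (fun h => ⟨h.1, (eqv_S_mul g).symm.trans h.2⟩)
      (fun h => ⟨h.1, (eqv_S_mul g).symm.trans h.2⟩)⟩
  -- Position of a largest entry, each row preferring its second column in case of a tie; rows may
  -- be swapped by a unimodular matrix.
  have hcases : ∀ a b c d : ℝ, (a ≤ d ∧ b ≤ d ∧ c ≤ d) ∨ (a ≤ c ∧ b ≤ c ∧ d < c) ∨
      (c ≤ b ∧ d ≤ b ∧ a ≤ b) ∨ (c ≤ a ∧ d ≤ a ∧ b < a) := by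
    intro a b c d
    grind
  rcases hcases (D.N (g 0 0)) (D.N (g 0 1)) (D.N (g 1 0)) (D.N (g 1 1)) with h | h | h | h
  · refine hrow g hg hdet (Or.inl ?_)
    intro i j; fin_cases i <;> fin_cases j <;> simp [h]
  · refine hrow g hg hdet (Or.inr ⟨?_, h.2.2⟩)
    intro i j; fin_cases i <;> fin_cases j <;> simp [h, h.2.2.le]
  · refine hswap (Or.inl ?_)
    rw [hSg]; intro i j; fin_cases i <;> fin_cases j <;> simp [h]
  · refine hswap (Or.inr ⟨?_, ?_⟩)
    · rw [hSg]; intro i j; fin_cases i <;> fin_cases j <;> simp [h, h.2.2.le]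
    · rw [hSg]; simpa using h.2.2

/-- A totally ramified quadratic step. Elements of `L` have even valuation in units of `v` and their
multiples by `v` have odd valuation, so the two terms of `x₀ + x₁ * v` never cancel and no new
residue classes appear. -/
lemma Unif.quadratic {L L' : Subfield E} {u v : E} (hu : D.Unif L u) (hv : v ∈ L')
    (hL : ∀ x ∈ L', ∃ x₀ ∈ L, ∃ x₁ ∈ L, x = x₀ + x₁ * v) (h : D.N v ^ 2 = D.N u) :
    D.Unif L' v := by
  have hvp : 0 < D.N v := by
    rcases (D.N.nonneg v).lt_or_eq with h' | h'
    · exact h'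
    · rw [← h', zero_pow two_ne_zero] at h
      exact absurd h (D.N.pos hu.ne).ne
  have hv0 : v ≠ 0 := (D.N.pos_iff).mp hvp
  have hv1 : D.N v < 1 := by have := hu.lt; rw [← h] at this; nlinarith
  have huv : D.N u ≤ D.N v := by rw [← h]; nlinarith
  have hdata : ∀ x₀ ∈ L, ∀ x₁ ∈ L, x₀ + x₁ * v ≠ 0 → ∃ n : ℤ, D.N (x₀ + x₁ * v) = D.N v ^ n ∧
      (D.N (x₀ + x₁ * v) ≤ 1 → D.N x₀ ≤ 1 ∧ D.N (x₁ * v) ≤ D.N v) := by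
    intro x₀ h₀ x₁ h₁ hx
    have heven : ∀ x ∈ L, x ≠ 0 → ∃ n : ℤ, D.N x = D.N v ^ (2 * n) := by
      intro x hx hx0
      obtain ⟨n, hn⟩ := hu.val x hx hx0
      refine ⟨n, ?_⟩
      rw [hn, ← h, zpow_mul]; norm_cast
    have hodd : ∀ x ∈ L, x ≠ 0 → ∃ n : ℤ, D.N (x * v) = D.N v ^ (2 * n + 1) := by
      intro x hx hx0
      obtain ⟨n, hn⟩ := heven x hx hx0
      exact ⟨n, by rw [map_mul, hn, zpow_add_one₀ hvp.ne']⟩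
    have hle : ∀ n : ℤ, D.N v ^ (2 * n + 1) ≤ 1 → D.N v ^ (2 * n + 1) ≤ D.N v := by
      intro n hn
      obtain ⟨m, hm⟩ := exists_nat_of_zpow_le hvp hv1 hn
      rw [hm, zpow_natCast]
      exact pow_le_of_le_one hvp.le hv1.le (by omega)
    rcases eq_or_ne x₁ 0 with rfl | hx1
    · simp only [zero_mul, add_zero] at hx ⊢
      obtain ⟨n, hn⟩ := heven x₀ h₀ hx
      exact ⟨_, hn, fun h => ⟨h, by simp [hvp.le]⟩⟩
    obtain ⟨n, hn⟩ := hodd x₁ h₁ hx1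
    rcases eq_or_ne x₀ 0 with rfl | hx0
    · simp only [zero_add]
      exact ⟨_, hn, fun h => ⟨by simp, by rw [hn] at h ⊢; exact hle n h⟩⟩
    obtain ⟨m, hm⟩ := heven x₀ h₀ hx0
    have hne : D.N x₀ ≠ D.N (x₁ * v) := by
      rw [hm, hn]
      intro h'
      have := zpow_right_injective₀ hvp hv1.ne h'
      omega
    rcases hne.lt_or_gt with hlt | hlt
    · have heq : D.N (x₀ + x₁ * v) = D.N (x₁ * v) := by rw [add_comm]; exact D.add_eq_left hlt
      refine ⟨_, heq.trans hn, fun h => ?_⟩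
      rw [heq] at h
      exact ⟨hlt.le.trans h, by rw [hn] at h ⊢; exact hle n h⟩
    · have heq := D.add_eq_left hlt
      refine ⟨_, heq.trans hm, fun h => ?_⟩
      rw [heq] at h
      exact ⟨h, by have := hlt.le.trans h; rw [hn] at this ⊢; exact hle n this⟩
  refine ⟨hv, hv0, hv1, ?_, ?_⟩
  · intro x hx hx0
    obtain ⟨x₀, h₀, x₁, h₁, rfl⟩ := hL x hx
    obtain ⟨n, hn, -⟩ := hdata x₀ h₀ x₁ h₁ hx0
    exact ⟨n, hn⟩
  · intro x hx hx1
    obtain ⟨x₀, h₀, x₁, h₁, rfl⟩ := hL x hx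
    rcases eq_or_ne (x₀ + x₁ * v) 0 with h0 | h0
    · exact ⟨0, by rw [h0]; simp [rep, hvp.le]⟩
    obtain ⟨n, -, hle⟩ := hdata x₀ h₀ x₁ h₁ h0
    obtain ⟨hle0, hle1⟩ := hle hx1
    obtain ⟨a, ha⟩ := hu.res x₀ h₀ hle0
    refine ⟨a, ?_⟩
    have : x₀ + x₁ * v - D.rep a = (x₀ - D.rep a) + x₁ * v := by ring
    rw [this]
    exact D.add_le (ha.trans huv) hle1

/-- The unramified step: the residue field of `F` is `F₂`, over which 1 and the class of `w` are
independent. The norm of `x₀ + x₁ * w` is therefore the larger of those of the coefficients. -/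
lemma unif_two {F L : Subfield E}
    (hF : ∀ x ∈ F, x ≠ 0 → ∃ n : ℤ, D.N x = D.N 2 ^ n)
    (hres : ∀ x ∈ F, D.N x ≤ 1 → D.N x ≤ D.N 2 ∨ D.N (x - 1) ≤ D.N 2)
    (hL : ∀ x ∈ L, ∃ x₀ ∈ F, ∃ x₁ ∈ F, x = x₀ + x₁ * D.w) : D.Unif L 2 := by
  have h2 : D.N 2 < 1 := D.N_two_lt_s.trans D.N_s_lt
  have h2p := D.N.pos D.two_ne
  have hint : ∀ x₀ ∈ F, ∀ x₁ ∈ F, D.N x₀ ≤ 1 → D.N x₁ ≤ 1 →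
      ∃ a, D.N (x₀ + x₁ * D.w - D.rep a) ≤ D.N 2 ∧ (a = 0 → D.N x₀ < 1 ∧ D.N x₁ < 1) := by
    intro x₀ h₀ x₁ h₁ hx0 hx1
    have hw : ∀ {x : E}, D.N x ≤ D.N 2 → D.N (x * D.w) ≤ D.N 2 :=
      fun h => D.mul_le' h D.N_w.le
    rcases hres x₀ h₀ hx0 with a0 | a0 <;> rcases hres x₁ h₁ hx1 with a1 | a1
    · refine ⟨0, ?_, fun _ => ⟨a0.trans_lt h2, a1.trans_lt h2⟩⟩
      simpa [rep] using D.add_le a0 (hw a1)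
    · refine ⟨2, ?_, by simp⟩
      have := D.add_le a0 (hw a1)
      convert this using 2
      simp only [rep]; simp; ring
    · refine ⟨1, ?_, by simp⟩
      have := D.add_le a0 (hw a1)
      convert this using 2
      simp only [rep]; simp; ring
    · refine ⟨3, ?_, by simp⟩
      -- The residue class of `1 + w` is represented by `w ^ 2 = -1 - w`, which differs from it by
      -- this multiple of 2.
      have hk : D.N (2 * (1 + D.w)) ≤ D.N 2 :=
        D.mul_le' le_rfl (D.add_le (by simp) D.N_w.le)
      have := D.add_le (D.add_le a0 (hw a1)) hk
      convert this using 2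
      simp only [rep]; simp
      linear_combination -D.w_sq
  have hmain : ∀ x₀ ∈ F, ∀ x₁ ∈ F, x₀ + x₁ * D.w ≠ 0 → ∃ n : ℤ,
      D.N (x₀ + x₁ * D.w) = D.N 2 ^ n ∧ D.N x₀ ≤ D.N 2 ^ n ∧ D.N x₁ ≤ D.N 2 ^ n := by
    intro x₀ h₀ x₁ h₁ hx
    obtain ⟨n, hn0, hn1, hn⟩ : ∃ n : ℤ, D.N x₀ ≤ D.N 2 ^ n ∧ D.N x₁ ≤ D.N 2 ^ n ∧
        (D.N x₀ = D.N 2 ^ n ∨ D.N x₁ = D.N 2 ^ n) := by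
      rcases le_total (D.N x₀) (D.N x₁) with hle | hle
      · have : x₁ ≠ 0 := by
          rintro rfl
          have : x₀ = 0 := by rw [map_zero] at hle; exact (AbsoluteValue.nonpos_iff D.N).mp hle
          simp [this] at hx
        obtain ⟨n, hn⟩ := hF x₁ h₁ this
        exact ⟨n, hn ▸ hle, hn.le, Or.inr hn⟩
      · have : x₀ ≠ 0 := by
          rintro rfl
          have : x₁ = 0 := by rw [map_zero] at hle; exact (AbsoluteValue.nonpos_iff D.N).mp hle
          simp [this] at hx
        obtain ⟨n, hn⟩ := hF x₀ h₀ this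
        exact ⟨n, hn.le, hn ▸ hle, Or.inl hn⟩
    refine ⟨n, ?_, hn0, hn1⟩
    have hpn : (2 : E) ^ n ≠ 0 := zpow_ne_zero _ D.two_ne
    have hpF : (2 : E) ^ n ∈ F := F.zpow_mem (by exact_mod_cast natCast_mem F 2) n
    have hNp : D.N ((2 : E) ^ n) = D.N 2 ^ n := map_zpow₀ D.N 2 n
    obtain ⟨a, ha, ha0⟩ := hint (x₀ / 2 ^ n) (F.div_mem h₀ hpF) (x₁ / 2 ^ n) (F.div_mem h₁ hpF)
      (N_div_le hpn (hNp ▸ hn0)) (N_div_le hpn (hNp ▸ hn1))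
    have hane : a ≠ 0 := by
      intro h
      have := ha0 h
      rw [map_div₀, map_div₀, hNp] at this
      have hpos : 0 < D.N 2 ^ n := zpow_pos h2p n
      rcases hn with hn | hn
      · rw [hn, div_self hpos.ne'] at this; exact lt_irrefl _ this.1
      · rw [hn, div_self hpos.ne'] at this; exact lt_irrefl _ this.2
    have hra := D.N_rep hane
    have := D.eq_of_sub_lt (ha.trans_lt (h2.trans_eq hra.symm))
    have hx' : x₀ + x₁ * D.w = 2 ^ n * (x₀ / 2 ^ n + x₁ / 2 ^ n * D.w) := by field_simp
    rw [hx', map_mul, this, hra, hNp, mul_one]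
  refine ⟨by exact_mod_cast natCast_mem L 2, D.two_ne, h2, ?_, ?_⟩
  · intro x hx hx0
    obtain ⟨x₀, h₀, x₁, h₁, rfl⟩ := hL x hx
    obtain ⟨n, hn, -⟩ := hmain x₀ h₀ x₁ h₁ hx0
    exact ⟨n, hn⟩
  · intro x hx hx1
    obtain ⟨x₀, h₀, x₁, h₁, rfl⟩ := hL x hx
    rcases eq_or_ne (x₀ + x₁ * D.w) 0 with h0 | h0
    · exact ⟨0, by rw [h0]; simp [rep, h2p.le]⟩
    obtain ⟨n, hn, hn0, hn1⟩ := hmain x₀ h₀ x₁ h₁ h0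
    rw [hn] at hx1
    obtain ⟨a, ha, -⟩ := hint x₀ h₀ x₁ h₁ (hn0.trans hx1) (hn1.trans hx1)
    exact ⟨a, ha⟩

end DyadicData

/-! ### Quaternion pairs and Schur's lemma. -/

section QuaternionPairs

variable {F : Type*} [Field F]

/-- A pair of matrices satisfying the relations of the quaternion units `i`, `j`. -/
structure QuatPair {R : Type*} [Ring R] (A B : Matrix (Fin 2) (Fin 2) R) : Prop where
  sq_left : A * A = -1
  sq_right : B * B = -1
  anti : B * A = -(A * B)

namespace QuatPair

/-- Since `B * A * B = A` and `B * B = -1`, cyclicity of the trace gives `tr A = -tr A`. -/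
lemma trace_left [CharZero F] {A B : Matrix (Fin 2) (Fin 2) F} (h : QuatPair A B) :
    A.trace = 0 := by
  have h1 : B * A * B = A := by rw [h.anti, neg_mul, mul_assoc, h.sq_right]; simp
  have h2 : A.trace = -A.trace := by
    conv_lhs => rw [← h1, mul_assoc, Matrix.trace_mul_comm, mul_assoc, h.sq_right]
    simp
  exact self_eq_neg.mp h2

lemma trace_right [CharZero F] {A B : Matrix (Fin 2) (Fin 2) F} (h : QuatPair A B) :
    B.trace = 0 :=
  trace_left (A := B) (B := A) ⟨h.sq_right, h.sq_left, by rw [h.anti, neg_neg]⟩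

lemma trace_mul [CharZero F] {A B : Matrix (Fin 2) (Fin 2) F} (h : QuatPair A B) :
    (A * B).trace = 0 := by
  have : (A * B).trace = -(A * B).trace := by
    conv_lhs => rw [Matrix.trace_mul_comm, h.anti, Matrix.trace_neg]
  exact self_eq_neg.mp this

/-- Irreducibility. On a common eigenvector the matrices would commute as well as anticommute, so `a
* b = 0`, while `a² = b² = -1`. -/
lemma no_eigenvector [CharZero F] {A B : Matrix (Fin 2) (Fin 2) F} (h : QuatPair A B)
    {v : Fin 2 → F} (hv : v ≠ 0) {a b : F} (ha : A.mulVec v = a • v) (hb : B.mulVec v = b • v) :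
    False := by
  have h1 : (B * A).mulVec v = (a * b) • v := by
    rw [← Matrix.mulVec_mulVec, ha, Matrix.mulVec_smul, hb, smul_smul]
  have h2 : (A * B).mulVec v = (a * b) • v := by
    rw [← Matrix.mulVec_mulVec, hb, Matrix.mulVec_smul, ha, smul_smul, mul_comm]
  rw [h.anti, Matrix.neg_mulVec, h2] at h1
  have h3 : (a * b) • v = 0 := self_eq_neg.mp h1.symm
  have h4 : (A * A).mulVec v = (a * a) • v := by
    rw [← Matrix.mulVec_mulVec, ha, Matrix.mulVec_smul, ha, smul_smul]
  have h5 : (B * B).mulVec v = (b * b) • v := by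
    rw [← Matrix.mulVec_mulVec, hb, Matrix.mulVec_smul, hb, smul_smul]
  rw [h.sq_left, Matrix.neg_mulVec, Matrix.one_mulVec] at h4
  rw [h.sq_right, Matrix.neg_mulVec, Matrix.one_mulVec] at h5
  rcases mul_eq_zero.mp ((smul_eq_zero.mp h3).resolve_right hv) with rfl | rfl
  · simp at h4; exact hv h4
  · simp at h5; exact hv h5

/-- A nonzero singular intertwiner has a one-dimensional kernel, spanned by the vector orthogonal to
a nonzero row. The kernel is stable under `A` and `B`, against irreducibility. -/
lemma det_ne_zero [CharZero F] {A B A' B' h : Matrix (Fin 2) (Fin 2) F} (hAB : QuatPair A B)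
    (h0 : h ≠ 0) (hA : A' * h = h * A) (hB : B' * h = h * B) : h.det ≠ 0 := by
  intro hdet
  obtain ⟨i, hi⟩ : ∃ i, h i ≠ 0 := by
    by_contra! hc
    exact h0 (by ext i j; rw [hc i]; rfl)
  have hker : ∀ x : Fin 2 → F, h.mulVec x = 0 → ∃ a : F, x = a • ![-h i 1, h i 0] := by
    intro x hx
    have hxi := congrFun hx i
    simp [Matrix.mulVec, dotProduct, Fin.sum_univ_two] at hxi
    by_cases h1 : h i 1 = 0
    · have h2 : h i 0 ≠ 0 := by
        intro h2; apply hi; ext j; fin_cases j <;> simp [h1, h2]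
      rw [h1] at hxi
      have hx0 : x 0 = 0 := by simpa [h2] using hxi
      refine ⟨x 1 / h i 0, ?_⟩
      ext j; fin_cases j <;> simp [h1, h2, hx0]
    · refine ⟨-x 0 / h i 1, ?_⟩
      ext j; fin_cases j
      · simp; field_simp
      · simp; field_simp; linear_combination hxi
  have hn : h.mulVec ![-h i 1, h i 0] = 0 := by
    rw [Matrix.det_fin_two] at hdet
    ext j
    fin_cases i <;> fin_cases j <;> simp [Matrix.mulVec, dotProduct, Fin.sum_univ_two] <;>
      first | linear_combination (0 : F) * hdet | linear_combination hdet | linear_combination -hdet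
  have hn0 : ![-h i 1, h i 0] ≠ 0 := by
    intro hc
    apply hi
    have c0 := congrFun hc 0
    have c1 := congrFun hc 1
    simp at c0 c1
    ext j; fin_cases j <;> simp [c0, c1]
  obtain ⟨a, ha⟩ := hker (A.mulVec ![-h i 1, h i 0])
    (by rw [Matrix.mulVec_mulVec, ← hA, ← Matrix.mulVec_mulVec, hn, Matrix.mulVec_zero])
  obtain ⟨b, hb⟩ := hker (B.mulVec ![-h i 1, h i 0])
    (by rw [Matrix.mulVec_mulVec, ← hB, ← Matrix.mulVec_mulVec, hn, Matrix.mulVec_zero])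
  exact hAB.no_eigenvector hn0 ha hb

lemma _root_.Subfield.matrix_mul_mem {L : Subfield F} {A B : Matrix (Fin 2) (Fin 2) F}
    (hA : ∀ i j, A i j ∈ L) (hB : ∀ i j, B i j ∈ L) : ∀ i j, (A * B) i j ∈ L := by
  intro i j
  rw [Matrix.mul_apply, Fin.sum_univ_two]
  exact L.add_mem (L.mul_mem (hA _ _) (hB _ _)) (L.mul_mem (hA _ _) (hB _ _))

lemma _root_.Subfield.matrix_inv_mem {L : Subfield F} {A : Matrix (Fin 2) (Fin 2) F}
    (hA : ∀ i j, A i j ∈ L) : ∀ i j, A⁻¹ i j ∈ L := by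
  intro i j
  rw [Matrix.inv_def, Matrix.smul_apply, smul_eq_mul, Ring.inverse_eq_inv',
    Matrix.adjugate_fin_two, Matrix.det_fin_two]
  refine L.mul_mem (L.inv_mem (L.sub_mem (L.mul_mem (hA _ _) (hA _ _))
    (L.mul_mem (hA _ _) (hA _ _)))) ?_
  fin_cases i <;> fin_cases j <;> simp [hA]

/-- Two quaternion pairs over a field are conjugate over that field. -/
lemma exists_conj [CharZero F] {A B A' B' : Matrix (Fin 2) (Fin 2) F} (h : QuatPair A B)
    (h' : QuatPair A' B') (L : Subfield F) (hA : ∀ i j, A i j ∈ L) (hB : ∀ i j, B i j ∈ L)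
    (hA' : ∀ i j, A' i j ∈ L) (hB' : ∀ i j, B' i j ∈ L) :
    ∃ g : Matrix (Fin 2) (Fin 2) F, (∀ i j, g i j ∈ L) ∧ g.det ≠ 0 ∧
      A' * g = g * A ∧ B' * g = g * B := by
  -- Averaging over `Q₈` modulo its centre; the minus signs come from `A⁻¹ = -A` and its analogues.
  let f : Matrix (Fin 2) (Fin 2) F → Matrix (Fin 2) (Fin 2) F := fun X =>
    X - A' * X * A - B' * X * B - (A' * B') * X * (A * B)
  have hf : ∀ X, f X = X - A' * X * A - B' * X * B - (A' * B') * X * (A * B) := fun _ => rfl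
  have lA : ∀ X, A' * (A' * X) = -X := fun X => by rw [← mul_assoc, h'.sq_left]; simp
  have lB : ∀ X, B' * (B' * X) = -X := fun X => by rw [← mul_assoc, h'.sq_right]; simp
  have lBA : ∀ X, B' * (A' * X) = -(A' * (B' * X)) := fun X => by
    rw [← mul_assoc, h'.anti]; simp [mul_assoc]
  have rA : ∀ X, A * (A * X) = -X := fun X => by rw [← mul_assoc, h.sq_left]; simp
  have hfA : ∀ X, A' * f X = f X * A := by
    intro X
    simp only [hf, mul_sub, sub_mul, mul_assoc, lA, h.anti, h.sq_left, mul_neg, rA]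
    simp
    abel
  have hfB : ∀ X, B' * f X = f X * B := by
    intro X
    simp only [hf, mul_sub, sub_mul, mul_assoc, lB, lBA, h.sq_right, mul_neg]
    simp
    abel
  have hex : ∃ a b : Fin 2, f (Matrix.single a b 1) ≠ 0 := by
    by_contra! hc
    have t1 := h.trace_left
    have t2 := h.trace_right
    have t3 := h.trace_mul
    have e00 := congrFun (congrFun (hc 0 0) 0) 0
    have e01 := congrFun (congrFun (hc 0 1) 0) 1
    have e10 := congrFun (congrFun (hc 1 0) 1) 0
    have e11 := congrFun (congrFun (hc 1 1) 1) 1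
    simp only [hf] at e00 e01 e10 e11
    generalize A * B = C at *
    generalize A' * B' = C' at *
    simp [Matrix.mul_apply, Fin.sum_univ_two, Matrix.single_apply] at e00 e01 e10 e11
    rw [Matrix.trace_fin_two] at t1 t2 t3
    -- The trace of `f` as a linear operator is 4, since `X ↦ A' * X * A` has trace `tr A' * tr A =
    -- 0`, and likewise for the other terms. So `f` cannot vanish on every matrix unit.
    have : (4 : F) = 0 := by
      linear_combination e00 + e01 + e10 + e11 + (A' 0 0 + A' 1 1) * t1 + (B' 0 0 + B' 1 1) * t2
        + (C' 0 0 + C' 1 1) * t3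
    norm_num at this
  obtain ⟨a, b, hab⟩ := hex
  refine ⟨_, ?_, h.det_ne_zero hab (hfA _) (hfB _), hfA _, hfB _⟩
  have hX : ∀ i j, (Matrix.single a b (1 : F)) i j ∈ L := by
    intro i j
    rw [Matrix.single_apply]
    split_ifs
    · exact L.one_mem
    · exact L.zero_mem
  intro i j
  simp only [hf, Matrix.sub_apply]
  have m := @Subfield.matrix_mul_mem F _ L
  exact L.sub_mem (L.sub_mem (L.sub_mem (hX _ _) (m (m hA' hX) hA _ _)) (m (m hB' hX) hB _ _))
    (m (m (m hA' hB') hX) (m hA hB) _ _)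

end QuatPair

end QuaternionPairs

/-! ### The twenty-six integral forms over `Ω`. -/

namespace DyadicData

variable {E : Type*} [Field E] [CharZero E] {D : DyadicData E}

variable (D) in
lemma quatPair : QuatPair D.A₀ D.B₀ := ⟨D.A₀_sq, D.B₀_sq, D.B₀_mul_A₀⟩

lemma scalar_of_commute {X : Matrix (Fin 2) (Fin 2) E} (hA : D.A₀ * X = X * D.A₀)
    (hB : D.B₀ * X = X * D.B₀) : X = X 0 0 • (1 : Matrix (Fin 2) (Fin 2) E) := by
  have a00 := congrFun (congrFun hA 0) 0
  have b00 := congrFun (congrFun hB 0) 0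
  have a01 := congrFun (congrFun hA 0) 1
  simp [A₀, B₀, Matrix.mul_apply, Fin.sum_univ_two] at a00 b00 a01
  have hs := D.s_ne
  have hw := D.w_ne
  have hw1 : D.w - 1 ≠ 0 := D.ne_zero_of_N one_pos D.N_w_sub_one
  have h1 : X 1 0 = -(X 0 1) / 3 := mul_left_cancel₀ hs (by linear_combination a00)
  have h2 : D.w * X 1 0 = -(X 0 1) / 3 :=
    mul_left_cancel₀ (mul_ne_zero hw hs) (by linear_combination b00)
  have h3 : X 1 0 = 0 :=
    mul_left_cancel₀ hw1 (by linear_combination h2 - h1)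
  have h4 : X 0 1 = 0 := by linear_combination 3 * h1 - 3 * h3
  have h5 : X 1 1 = X 0 0 := mul_left_cancel₀ hs (by rw [h4] at a01; linear_combination a01)
  ext i j
  fin_cases i <;> fin_cases j <;> simp [h3, h4, h5]

/-- The quotient `g⁻¹ * g'` commutes with the irreducible model and so is scalar. This is what makes
the coset of `g` modulo scalars an invariant of the integral form. -/
lemma smul_of_intertwine {A B g g' : Matrix (Fin 2) (Fin 2) E} (hg : g.det ≠ 0)
    (hA : A * g = g * D.A₀) (hB : B * g = g * D.B₀) (hA' : A * g' = g' * D.A₀)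
    (hB' : B * g' = g' * D.B₀) : ∃ c : E, g' = c • g := by
  have hu : IsUnit g.det := isUnit_iff_ne_zero.mpr hg
  have key : ∀ {X Y : Matrix (Fin 2) (Fin 2) E}, X * g = g * Y → X * g' = g' * Y →
      Y * (g⁻¹ * g') = g⁻¹ * g' * Y := by
    intro X Y h1 h2
    calc Y * (g⁻¹ * g') = g⁻¹ * (g * Y) * g⁻¹ * g' := by
          rw [← mul_assoc g⁻¹, Matrix.nonsing_inv_mul _ hu, one_mul, mul_assoc]
      _ = g⁻¹ * X * (g * g⁻¹) * g' := by rw [← h1]; simp only [mul_assoc]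
      _ = g⁻¹ * g' * Y := by rw [Matrix.mul_nonsing_inv _ hu, mul_one, mul_assoc, h2, mul_assoc]
  refine ⟨(g⁻¹ * g') 0 0, ?_⟩
  have := scalar_of_commute (key hA hA') (key hB hB')
  calc g' = g * (g⁻¹ * g') := by rw [← mul_assoc, Matrix.mul_nonsing_inv _ hu, one_mul]
    _ = _ := by rw [this]; simp

lemma eqv_of_intertwine {A B g g' : Matrix (Fin 2) (Fin 2) E} (hg : g.det ≠ 0)
    (hg' : g'.det ≠ 0)
    (hA : A * g = g * D.A₀) (hB : B * g = g * D.B₀) (hA' : A * g' = g' * D.A₀)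
    (hB' : B * g' = g' * D.B₀) : D.Eqv g g' := by
  obtain ⟨c, rfl⟩ := smul_of_intertwine hg hA hB hA' hB'
  have hc : c ≠ 0 := by rintro rfl; simp at hg'
  exact ⟨c⁻¹, inv_ne_zero hc, 1, unim_one, by rw [smul_smul, inv_mul_cancel₀ hc]; simp⟩

/-- Labels for the integral forms. -/
abbrev Idx : Type := Unit ⊕ (Fin 4 ⊕ Unit) ⊕ ((Fin 4 × Fin 4) ⊕ Fin 4)

variable (D) in
/-- The matrix conjugating the explicit representation into the integral form with given label. -/
def M : Idx → Matrix (Fin 2) (Fin 2) E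
  | .inl () => V 1 0
  | .inr (.inl (.inl a)) => V D.p (D.rep a)
  | .inr (.inl (.inr ())) => W D.p 0
  | .inr (.inr (.inl (a, b))) => V (D.p ^ 2) (D.rep a + D.p * D.rep b)
  | .inr (.inr (.inr b)) => W (D.p ^ 2) (D.p * D.rep b)

lemma det_M (i : Idx) : (D.M i).det ≠ 0 := by
  have := D.p_ne
  rcases i with _ | (_ | _) | (_ | _) <;> simp [M, det_V, det_W, this]

lemma N_digits (a b : Fin 4) : D.N (D.rep a + D.p * D.rep b) ≤ 1 :=
  D.add_le (D.N_rep_le a) (D.mul_le D.N_p_le (D.N_rep_le b))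

lemma N_p_mul_rep (b : Fin 4) : D.N (D.p * D.rep b) ≤ D.N D.p :=
  D.mul_le' le_rfl (D.N_rep_le b)

/-- The diagonal parameters are `1`, `p` and `p ^ 2`, and `p ^ 2` has exactly the norm of `s`, the
smallest one permitted by the criterion. -/
lemma intg_M (i : Idx) : D.Intg (D.M i) := by
  have hp := D.p_ne
  have hp2 := pow_ne_zero 2 hp
  have h1 := D.N_s_lt.le
  have h2 := D.N_s_lt_p.le
  have h3 : D.N (D.p ^ 2) = D.N D.s := by rw [map_pow, D.N_p_sq]
  rcases i with _ | (a | _) | (⟨a, b⟩ | b)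
  · exact intg_V one_ne_zero (by simpa using h1) (by simp) (by simp)
  · exact intg_V hp h2 D.N_p_le (D.N_rep_le a)
  · exact intg_W hp h2 D.N_p_le (by simp)
  · exact intg_V hp2 h3.ge (h3 ▸ h1) (N_digits a b)
  · exact intg_W hp2 h3.ge (h3 ▸ h1) ((N_p_mul_rep b).trans D.N_p_le)

lemma digits_eq {a b a' b' : Fin 4}
    (h : D.N (D.rep a + D.p * D.rep b - (D.rep a' + D.p * D.rep b')) ≤ D.N (D.p ^ 2)) :
    a = a' ∧ b = b' := by
  have hp := D.N_p_lt
  have hp0 := D.N_p_pos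
  have h2 : D.N (D.p ^ 2) ≤ D.N D.p := by rw [map_pow]; nlinarith
  have ha : a = a' := by
    apply D.rep_eq
    have : D.rep a - D.rep a' = (D.rep a + D.p * D.rep b - (D.rep a' + D.p * D.rep b')) -
      (D.p * D.rep b - D.p * D.rep b') := by ring
    rw [this]
    exact (D.sub_le (h.trans h2) (D.sub_le (N_p_mul_rep b) (N_p_mul_rep b'))).trans_lt hp
  subst ha
  refine ⟨rfl, D.rep_eq ?_⟩
  have : D.rep a + D.p * D.rep b - (D.rep a + D.p * D.rep b') = D.p * (D.rep b - D.rep b') := by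
    ring
  rw [this, map_mul, map_pow, sq] at h
  exact (le_of_mul_le_mul_left h hp0).trans_lt hp

/-- The distance of an integral form from the central one. -/
def lev : Idx → ℕ
  | .inl () => 0
  | .inr (.inl _) => 1
  | .inr (.inr _) => 2

variable (D) in
/-- The off-diagonal parameter of `M`. -/
def par : Idx → E
  | .inl () => 0
  | .inr (.inl (.inl a)) => D.rep a
  | .inr (.inl (.inr ())) => 0
  | .inr (.inr (.inl (a, b))) => D.rep a + D.p * D.rep b
  | .inr (.inr (.inr b)) => D.p * D.rep b

lemma M_cases (i : Idx) : (D.M i = V (D.p ^ lev i) (D.par i) ∧ D.N (D.par i) ≤ 1) ∨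
    (D.M i = W (D.p ^ lev i) (D.par i) ∧ D.N (D.par i) < 1 ∧ 1 ≤ lev i) := by
  rcases i with _ | (a | _) | (⟨a, b⟩ | b)
  · left; simp [M, lev, par]
  · left; simp [M, lev, par, N_rep_le]
  · right; simp [M, lev, par]
  · left; simpa [M, lev, par] using N_digits a b
  · right; simpa [M, lev, par] using (N_p_mul_rep b).trans_lt D.N_p_lt

lemma not_eqv_V_W {m n : ℕ} {t t' : E} (ht : D.N t ≤ 1) (ht' : D.N t' < 1) (hn : 1 ≤ n) :
    ¬ D.Eqv (V (D.p ^ m) t) (W (D.p ^ n) t') := by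
  intro h
  have := h.of_V_W (pow_ne_zero m D.p_ne) (pow_ne_zero n D.p_ne) ht ht'
  rw [← map_mul, ← pow_add, map_pow] at this
  exact absurd this (not_le.mpr (pow_lt_one₀ D.N_p_pos.le D.N_p_lt (by omega)))

lemma lev_eq {m n : ℕ} (h : D.N (D.p ^ m) = D.N (D.p ^ n)) : m = n := by
  rw [map_pow, map_pow] at h
  exact pow_right_injective₀ D.N_p_pos D.N_p_lt.ne h

/-- The chart and the norm of the diagonal parameter are invariants of the coset. They leave the
off-diagonal parameter modulo the diagonal one, that is, its digits. -/
lemma M_injective {i j : Idx} (h : D.Eqv (D.M i) (D.M j)) : i = j := by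
  have hlev : lev i = lev j := by
    rcases M_cases (D := D) i with ⟨hi, hi1⟩ | ⟨hi, hi1, hi2⟩ <;>
      rcases M_cases (D := D) j with ⟨hj, hj1⟩ | ⟨hj, hj1, hj2⟩ <;> rw [hi, hj] at h
    · exact lev_eq h.of_V.1
    · exact absurd h (not_eqv_V_W hi1 hj1 hj2)
    · exact absurd h.symm (not_eqv_V_W hj1 hi1 hi2)
    · exact lev_eq h.of_W.1
  have hpr : ∀ b, D.N (D.p * D.rep b) < 1 := fun b => (N_p_mul_rep b).trans_lt D.N_p_lt
  have hn1 : ∀ {t t' : E}, D.N t ≤ 1 → D.N t' < 1 → ¬ D.Eqv (V D.p t) (W D.p t') := by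
    intro t t' ht ht'
    simpa using not_eqv_V_W (m := 1) (n := 1) ht ht' le_rfl
  rcases i with _ | (a | _) | (⟨a, b⟩ | b) <;> rcases j with _ | (a' | _) | (⟨a', b'⟩ | b') <;>
    simp only [lev] at hlev <;> try first | rfl | omega
  · have h' : D.Eqv (V D.p (D.rep a)) (V D.p (D.rep a')) := h
    rw [D.rep_eq (h'.of_V.2.trans_lt D.N_p_lt)]
  · exact absurd h (hn1 (D.N_rep_le a) (by simp))
  · exact absurd h.symm (hn1 (D.N_rep_le a') (by simp))
  · have h' : D.Eqv (V (D.p ^ 2) (D.rep a + D.p * D.rep b))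
      (V (D.p ^ 2) (D.rep a' + D.p * D.rep b')) := h
    obtain ⟨rfl, rfl⟩ := digits_eq h'.of_V.2; rfl
  · exact absurd h (not_eqv_V_W (N_digits a b) (hpr b') one_le_two)
  · exact absurd h.symm (not_eqv_V_W (N_digits a' b') (hpr b) one_le_two)
  · have h' : D.Eqv (W (D.p ^ 2) (D.p * D.rep b)) (W (D.p ^ 2) (D.p * D.rep b')) := h
    obtain ⟨-, rfl⟩ := digits_eq (D := D) (a := 0) (a' := 0) (b := b) (b' := b')
      (by simpa [rep] using h'.of_W.2)
    rfl

/-- Only `n` digits of `t` to the base `p` matter: none, `a`, or `a + p b`. -/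
lemma exists_M_of_V {P t : E} (hP : P ≠ 0) {n : ℕ} (hPn : D.N P = D.N D.p ^ n) (hn : n ≤ 2)
    (hres : ∀ x : E, D.N x ≤ 1 → ∃ a, D.N (x - D.rep a) ≤ D.N D.p) (ht : D.N t ≤ 1) :
    ∃ i, D.Eqv (V P t) (D.M i) := by
  obtain ⟨a, ha⟩ := hres t ht
  interval_cases n
  · exact ⟨.inl (), eqv_V hP (by simpa using hPn) (by rw [hPn]; simpa using ht)⟩
  · exact ⟨.inr (.inl (.inl a)), eqv_V hP (by simpa using hPn) (by rw [hPn]; simpa using ha)⟩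
  · have h2 : D.N ((t - D.rep a) / D.p) ≤ 1 := N_div_le D.p_ne ha
    obtain ⟨b, hb⟩ := hres _ h2
    refine ⟨.inr (.inr (.inl (a, b))), eqv_V hP (by simpa using hPn) ?_⟩
    have : t - (D.rep a + D.p * D.rep b) = D.p * ((t - D.rep a) / D.p - D.rep b) := by
      have := D.p_ne
      field_simp; ring
    rw [this, hPn, map_mul, sq]
    exact mul_le_mul_of_nonneg_left hb D.N_p_pos.le

lemma exists_M_of_W {P t : E} (hP : P ≠ 0) {n : ℕ} (hPn : D.N P = D.N D.p ^ n) (hn : n ≤ 2)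
    (hres : ∀ x : E, D.N x ≤ 1 → ∃ a, D.N (x - D.rep a) ≤ D.N D.p) (ht : D.N t ≤ D.N D.p) :
    ∃ i, D.Eqv (W P t) (D.M i) := by
  interval_cases n
  -- For a unit `P` both charts give the central class: `W 1 0` is the identity with its rows
  -- swapped.
  · refine ⟨.inl (), (eqv_W (P' := 1) (t' := 0) hP (by simpa using hPn) ?_).trans ?_⟩
    · rw [hPn]; simpa using ht.trans D.N_p_le
    · refine (eqv_S_mul (W 1 0)).symm.trans ?_
      have : S E * W 1 0 = V 1 0 := by
        ext i j; fin_cases i <;> fin_cases j <;>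
          simp [S, W, V, Matrix.mul_apply, Fin.sum_univ_two]
      rw [this]; exact Eqv.refl _
  · exact ⟨.inr (.inl (.inr ())), eqv_W hP (by simpa using hPn) (by rw [hPn]; simpa using ht)⟩
  · obtain ⟨b, hb⟩ := hres _ (N_div_le D.p_ne ht)
    refine ⟨.inr (.inr (.inr b)), eqv_W hP (by simpa using hPn) ?_⟩
    have : t - D.p * D.rep b = D.p * (t / D.p - D.rep b) := by
      have := D.p_ne
      field_simp
    rw [this, hPn, map_mul, sq]
    exact mul_le_mul_of_nonneg_left hb D.N_p_pos.le

lemma exists_M {g : Matrix (Fin 2) (Fin 2) E} (hu : D.Unif ⊤ D.p) (hg : g.det ≠ 0)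
    (h : D.Intg g) : ∃ i, D.Eqv g (D.M i) := by
  have hres : ∀ x : E, D.N x ≤ 1 → ∃ a, D.N (x - D.rep a) ≤ D.N D.p := fun x => hu.res x trivial
  have hn : ∀ n : ℕ, D.N D.s ≤ D.N (D.p ^ n) → n ≤ 2 := by
    intro n hn
    rw [map_pow, ← D.N_p_sq] at hn
    exact (pow_le_pow_iff_right_of_lt_one₀ D.N_p_pos D.N_p_lt).mp hn
  obtain ⟨n, t, -, h' | h'⟩ := hu.eqv_V_or_W (fun _ _ => trivial) hg
  · obtain ⟨i, hi⟩ := exists_M_of_V (pow_ne_zero n D.p_ne) (map_pow _ _ _)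
      (hn n (h'.2.intg h).of_V.1) hres h'.1
    exact ⟨i, h'.2.trans hi⟩
  · obtain ⟨i, hi⟩ := exists_M_of_W (pow_ne_zero n D.p_ne) (map_pow _ _ _)
      (hn n (h'.2.intg h).of_W) hres (hu.le_of_lt trivial h'.1)
    exact ⟨i, h'.2.trans hi⟩

end DyadicData

/-! ### Fields of definition containing `√-3`. -/

namespace DyadicData

variable {E : Type*} [Field E] [CharZero E] {D : DyadicData E}

variable (D) in
/-- The integral form attached to `g` contains a representation with entries in `L`. -/
def DefOver (L : Subfield E) (g : Matrix (Fin 2) (Fin 2) E) : Prop :=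
  ∃ g', D.Eqv g g' ∧ ∃ A B : Matrix (Fin 2) (Fin 2) E, (∀ i j, A i j ∈ L) ∧ (∀ i j, B i j ∈ L) ∧
    A * g' = g' * D.A₀ ∧ B * g' = g' * D.B₀

lemma DefOver.mono {L L' : Subfield E} (hL : L ≤ L') {g : Matrix (Fin 2) (Fin 2) E}
    (h : D.DefOver L g) : D.DefOver L' g := by
  obtain ⟨g', h1, A, B, hA, hB, h2⟩ := h
  exact ⟨g', h1, A, B, fun i j => hL (hA i j), fun i j => hL (hB i j), h2⟩

lemma DefOver.of_eqv {L : Subfield E} {g k : Matrix (Fin 2) (Fin 2) E} (hgk : D.Eqv g k)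
    (h : D.DefOver L g) : D.DefOver L k := by
  obtain ⟨g', h1, h2⟩ := h
  exact ⟨g', hgk.symm.trans h1, h2⟩

/-- A diagonal matrix rescaling the first coordinate. -/
def T (e : E) : Matrix (Fin 2) (Fin 2) E := !![e, 0; 0, 1]

lemma det_T (e : E) : (T e).det = e := by simp [T, Matrix.det_fin_two_of]

variable (D) in
/-- A rescaling of `A₀` with upper right entry `b`. -/
def A₁ (b : E) : Matrix (Fin 2) (Fin 2) E := !![-(D.r / 3), b; -(2 / (3 * b)), D.r / 3]

variable (D) in
/-- The rescaling of `B₀` matching `A₁`. -/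
def B₁ (b : E) : Matrix (Fin 2) (Fin 2) E :=
  !![-(D.r / 3), D.w ^ 2 * b; -(2 * D.w / (3 * b)), D.r / 3]

lemma A₁_mul_T {b : E} (hb : b ≠ 0) : D.A₁ b * T (b / D.s) = T (b / D.s) * D.A₀ := by
  have hs := D.s_ne
  ext i j
  fin_cases i <;> fin_cases j <;> simp [A₁, T, A₀, Matrix.mul_apply, Fin.sum_univ_two]
  · ring
  · field_simp
  · field_simp; rw [D.hs]

lemma B₁_mul_T {b : E} (hb : b ≠ 0) : D.B₁ b * T (b / D.s) = T (b / D.s) * D.B₀ := by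
  have hs := D.s_ne
  ext i j
  fin_cases i <;> fin_cases j <;> simp [B₁, T, B₀, Matrix.mul_apply, Fin.sum_univ_two]
  · ring
  · field_simp
  · field_simp; rw [D.hs]; ring

lemma mul_right_cancel_of_det {X Y g : Matrix (Fin 2) (Fin 2) E} (hg : g.det ≠ 0)
    (h : X * g = Y * g) : X = Y := by
  have hu : IsUnit g.det := isUnit_iff_ne_zero.mpr hg
  rw [← Matrix.mul_nonsing_inv_cancel_right g X hu, h, mul_assoc, Matrix.mul_nonsing_inv _ hu,
    mul_one]

lemma quatPair_of_intertwine {A B g : Matrix (Fin 2) (Fin 2) E} (hg : g.det ≠ 0)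
    (hA : A * g = g * D.A₀) (hB : B * g = g * D.B₀) : QuatPair A B := by
  refine ⟨mul_right_cancel_of_det hg ?_, mul_right_cancel_of_det hg ?_,
    mul_right_cancel_of_det hg ?_⟩
  · rw [mul_assoc, hA, ← mul_assoc, hA, mul_assoc, A₀_sq]; simp
  · rw [mul_assoc, hB, ← mul_assoc, hB, mul_assoc, B₀_sq]; simp
  · rw [mul_assoc, hA, ← mul_assoc, hB, mul_assoc, B₀_mul_A₀, neg_mul, mul_assoc, hB, ← mul_assoc,
      hA, mul_neg, mul_assoc]

lemma w_mem {L : Subfield E} (hr : D.r ∈ L) : D.w ∈ L :=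
  L.div_mem (L.add_mem (L.neg_mem L.one_mem) hr) (by exact_mod_cast natCast_mem L 2)

lemma rep_mem {L : Subfield E} (hr : D.r ∈ L) (a : Fin 4) : D.rep a ∈ L := by
  have := w_mem hr
  fin_cases a
  · exact L.zero_mem
  · exact L.one_mem
  · exact this
  · exact L.pow_mem this 2

lemma A₁_mem {L : Subfield E} (hr : D.r ∈ L) {b : E} (hb : b ∈ L) : ∀ i j, D.A₁ b i j ∈ L := by
  have h3 : (3 : E) ∈ L := by exact_mod_cast natCast_mem L 3
  have h2 : (2 : E) ∈ L := by exact_mod_cast natCast_mem L 2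
  have h := L.div_mem hr h3
  intro i j
  fin_cases i <;> fin_cases j <;> simp [A₁, -neg_mem_iff]
  · exact L.neg_mem h
  · exact hb
  · exact L.neg_mem (L.div_mem h2 (L.mul_mem h3 hb))
  · exact h

lemma B₁_mem {L : Subfield E} (hr : D.r ∈ L) {b : E} (hb : b ∈ L) : ∀ i j, D.B₁ b i j ∈ L := by
  have h3 : (3 : E) ∈ L := by exact_mod_cast natCast_mem L 3
  have h2 : (2 : E) ∈ L := by exact_mod_cast natCast_mem L 2
  have hw := w_mem hr
  have h := L.div_mem hr h3
  intro i j
  fin_cases i <;> fin_cases j <;> simp [B₁, -neg_mem_iff]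
  · exact L.neg_mem h
  · exact L.mul_mem (L.pow_mem hw 2) hb
  · exact L.neg_mem (L.div_mem (L.mul_mem h2 hw) (L.mul_mem h3 hb))
  · exact h

/-- Conjugation by `T (b / s)` carries the model to `A₁ b`, `B₁ b`, from which `s` has disappeared.
Together with `DefOver.exists_mul_T` it identifies the forms defined over `L` with the classes of `k
* T (b / s)`, `k ∈ GL₂(L)`. -/
lemma defOver_mul_T {L : Subfield E} (hr : D.r ∈ L) {b : E} (hb : b ∈ L) (hb0 : b ≠ 0)
    {h : Matrix (Fin 2) (Fin 2) E} (hh : ∀ i j, h i j ∈ L) (hdet : h.det ≠ 0) :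
    D.DefOver L (h * T (b / D.s)) := by
  have hu : IsUnit h.det := isUnit_iff_ne_zero.mpr hdet
  have m := @Subfield.matrix_mul_mem E _ L
  refine ⟨_, Eqv.refl _, h * D.A₁ b * h⁻¹, h * D.B₁ b * h⁻¹,
    m (m hh (A₁_mem hr hb)) (Subfield.matrix_inv_mem hh),
    m (m hh (B₁_mem hr hb)) (Subfield.matrix_inv_mem hh), ?_, ?_⟩
  · rw [← mul_assoc, Matrix.nonsing_inv_mul_cancel_right _ _ hu, mul_assoc, A₁_mul_T hb0, mul_assoc]
  · rw [← mul_assoc, Matrix.nonsing_inv_mul_cancel_right _ _ hu, mul_assoc, B₁_mul_T hb0, mul_assoc]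

/-- The representation over `L` and the rescaled model are both quaternion pairs over `L`, hence
conjugate by some `k` over `L`; uniqueness of intertwiners identifies the classes. -/
lemma DefOver.exists_mul_T {L : Subfield E} (hr : D.r ∈ L) {b : E} (hb : b ∈ L) (hb0 : b ≠ 0)
    {g : Matrix (Fin 2) (Fin 2) E} (hg : g.det ≠ 0) (h : D.DefOver L g) :
    ∃ k : Matrix (Fin 2) (Fin 2) E, (∀ i j, k i j ∈ L) ∧ k.det ≠ 0 ∧
      D.Eqv g (k * T (b / D.s)) := by
  obtain ⟨g', hgg, A, B, hA, hB, hAg, hBg⟩ := h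
  have hg' := hgg.det_ne hg
  have hT : (T (b / D.s)).det ≠ 0 := by rw [det_T]; exact div_ne_zero hb0 D.s_ne
  obtain ⟨k, hk, hkd, hkA, hkB⟩ := QuatPair.exists_conj
    (quatPair_of_intertwine hT (A₁_mul_T hb0) (B₁_mul_T hb0))
    (quatPair_of_intertwine hg' hAg hBg) L (A₁_mem hr hb) (B₁_mem hr hb) hA hB
  refine ⟨k, hk, hkd, hgg.trans (eqv_of_intertwine hg' ?_ hAg hBg ?_ ?_)⟩
  · rw [Matrix.det_mul]; exact mul_ne_zero hkd hT
  · rw [← mul_assoc, hkA, mul_assoc, A₁_mul_T hb0, mul_assoc]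
  · rw [← mul_assoc, hkB, mul_assoc, B₁_mul_T hb0, mul_assoc]

lemma V_mul_T (P t e : E) : V P t * T e = V (P * e) (t * e) := by
  ext i j
  fin_cases i <;> fin_cases j <;> simp [V, T, Matrix.mul_apply, Fin.sum_univ_two]

lemma eqv_W_mul_T (P t : E) {e : E} (he : e ≠ 0) : D.Eqv (W P t * T e) (W (P / e) (t / e)) := by
  refine ⟨e, he, 1, unim_one, ?_⟩
  ext i j
  fin_cases i <;> fin_cases j <;> simp [W, T, Matrix.mul_apply, Fin.sum_univ_two] <;> field_simp

/-- A normal form over `L` for the integral forms defined over a field `L` containing `√-3`. -/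
lemma DefOver.normal_form {L : Subfield E} {u : E} (hu : D.Unif L u) (hr : D.r ∈ L) {b : E}
    (hb : b ∈ L) (hb0 : b ≠ 0) {g : Matrix (Fin 2) (Fin 2) E} (hg : g.det ≠ 0)
    (h : D.DefOver L g) : ∃ n : ℕ, ∃ t ∈ L,
      (D.N t ≤ 1 ∧ D.Eqv g (V (u ^ n * (b / D.s)) (t * (b / D.s)))) ∨
      (D.N t < 1 ∧ D.Eqv g (W (u ^ n / (b / D.s)) (t / (b / D.s)))) := by
  obtain ⟨k, hk, hkd, hgk⟩ := h.exists_mul_T hr hb hb0 hg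
  obtain ⟨n, t, ht, h'⟩ := hu.eqv_V_or_W hk hkd
  refine ⟨n, t, ht, h'.imp (fun h' => ⟨h'.1, ?_⟩) (fun h' => ⟨h'.1, ?_⟩)⟩
  · rw [← V_mul_T]; exact hgk.trans (h'.2.mul_right _)
  · exact (hgk.trans (h'.2.mul_right _)).trans (eqv_W_mul_T _ _ (div_ne_zero hb0 D.s_ne))

lemma V_mem {L : Subfield E} {P t : E} (hP : P ∈ L) (ht : t ∈ L) : ∀ i j, V P t i j ∈ L := by
  intro i j
  fin_cases i <;> fin_cases j <;> simp [V, hP, ht]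

lemma W_mem {L : Subfield E} {P t : E} (hP : P ∈ L) (ht : t ∈ L) : ∀ i j, W P t i j ∈ L := by
  intro i j
  fin_cases i <;> fin_cases j <;> simp [W, hP, ht]

lemma defOver_V {L : Subfield E} (hr : D.r ∈ L) {b P t : E} (hb : b ∈ L) (hb0 : b ≠ 0)
    (hP : P ∈ L) (hP0 : P ≠ 0) (ht : t ∈ L) :
    D.DefOver L (V (P * (b / D.s)) (t * (b / D.s))) := by
  rw [← V_mul_T]
  exact defOver_mul_T hr hb hb0 (V_mem hP ht) (by rwa [det_V])

lemma defOver_W {L : Subfield E} (hr : D.r ∈ L) {b P t : E} (hb : b ∈ L) (hb0 : b ≠ 0)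
    (hP : P ∈ L) (hP0 : P ≠ 0) (ht : t ∈ L) :
    D.DefOver L (W (P / (b / D.s)) (t / (b / D.s))) :=
  (defOver_mul_T hr hb hb0 (W_mem hP ht) (by rw [det_W]; exact neg_ne_zero.mpr hP0)).of_eqv
    (eqv_W_mul_T _ _ (div_ne_zero hb0 D.s_ne))

/-- The label of the central integral form. -/
abbrev central : Idx := .inl ()

/-- The label of a form at distance two in a finite direction. -/
abbrev fin₂ (a b : Fin 4) : Idx := .inr (.inr (.inl (a, b)))

/-- The label of a form at distance two in the infinite direction. -/
abbrev inf₂ (b : Fin 4) : Idx := .inr (.inr (.inr b))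

/-- The label of a form at distance one in a finite direction. -/
abbrev fin₁ (a : Fin 4) : Idx := .inr (.inl (.inl a))

lemma N_p_sq' : D.N (D.p ^ 2) = D.N D.s := by rw [map_pow, D.N_p_sq]

/-- The forms defined over a field containing `√-3` of absolute ramification index two. -/
lemma defOver_M_iff {L : Subfield E} {u c : E} (hu : D.Unif L u) (hus : D.N u = D.N D.s)
    (hr : D.r ∈ L) (hc : D.N (u / D.s - c) ≤ D.N D.s) {f : Fin 4 → Idx}
    (hf : ∀ a, D.M (f a) = V (D.p ^ 2) (c * D.rep a)) (i : Idx) :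
    D.DefOver L (D.M i) ↔ i = central ∨ i = inf₂ 0 ∨ ∃ a, i = f a := by
  -- The choice `b = u` makes the rescaling `T (u / s)` unimodular, so the base vertex of the tree
  -- of `L` is the central form.
  have he0 : u / D.s ≠ 0 := div_ne_zero hu.ne D.s_ne
  have he : D.N (u / D.s) = 1 := by
    rw [map_div₀, hus, div_self D.N_s_pos.ne']
  -- One step in the tree of `L` already uses up the whole radius of the ball, since `u` has the
  -- norm of `s`.
  have hun : ∀ n : ℕ, D.N D.s ≤ D.N u ^ n → n ≤ 1 := by
    intro n hn
    by_contra! h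
    have h1 : D.N u ^ n ≤ D.N u ^ 2 := pow_le_pow_of_le_one (D.N.nonneg u) hu.lt.le h
    rw [hus] at hn h1
    have h2 := D.N_s_lt
    have h3 := D.N_s_pos
    nlinarith
  have hV0 : D.Eqv (V (1 * (u / D.s)) (0 * (u / D.s))) (D.M central) :=
    eqv_V (by simpa using he0) (by simpa using he) (by rw [one_mul, he]; simp)
  have hV : ∀ {t : E} {a : Fin 4}, D.N (t - D.rep a) ≤ D.N u →
      D.Eqv (V (u * (u / D.s)) (t * (u / D.s))) (D.M (f a)) := by
    intro t a hta
    rw [hf]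
    refine eqv_V (mul_ne_zero hu.ne he0) (by rw [map_mul, he, mul_one, hus, N_p_sq']) ?_
    have : t * (u / D.s) - c * D.rep a = (t - D.rep a) * (u / D.s) +
      D.rep a * (u / D.s - c) := by ring
    rw [this, map_mul D.N u, he, mul_one]
    exact D.add_le (D.mul_le' hta he.le) (D.mul_le (D.N_rep_le a) (hc.trans hus.ge))
  have hW : ∀ {t : E}, D.N t ≤ D.N u →
      D.Eqv (W (u / (u / D.s)) (t / (u / D.s))) (D.M (inf₂ 0)) := by
    intro t ht
    refine eqv_W (div_ne_zero hu.ne he0) (by rw [map_div₀, he, div_one, hus, N_p_sq']) ?_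
    simpa [rep, he, map_div₀] using ht
  constructor
  · intro h
    obtain ⟨n, t, htL, ⟨ht, h'⟩ | ⟨ht, h'⟩⟩ := h.normal_form hu hr hu.mem hu.ne (det_M i)
    · have hn := (h'.intg (intg_M i)).of_V.1
      rw [map_mul, he, mul_one, map_pow] at hn
      have hn := hun n hn
      interval_cases n
      · left
        refine M_injective (h'.trans (Eqv.trans ?_ hV0))
        exact eqv_V (by simpa using he0) (by simp) (by simpa [he] using ht)
      · obtain ⟨a, ha⟩ := hu.res t htL ht
        right; right
        exact ⟨a, M_injective (h'.trans (by rw [pow_one]; exact hV ha))⟩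
    · have hn := (h'.intg (intg_M i)).of_W
      rw [map_div₀, he, div_one, map_pow] at hn
      have hn := hun n hn
      interval_cases n
      · left
        refine M_injective (h'.trans ?_)
        refine Eqv.trans (g' := W 1 0) ?_ ?_
        · have h1 : D.N (u ^ 0 / (u / D.s)) = 1 := by rw [map_div₀, he]; simp
          refine eqv_W (by simpa [hu.ne] using D.s_ne) (by rw [h1]; simp) ?_
          rw [h1, sub_zero, map_div₀, he, div_one]; exact ht.le
        · refine (eqv_S_mul (W 1 0)).symm.trans ?_
          have : S E * W 1 0 = V 1 0 := by
            ext i j; fin_cases i <;> fin_cases j <;>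
              simp [S, W, V, Matrix.mul_apply, Fin.sum_univ_two]
          rw [this]; exact Eqv.refl _
      · right; left
        exact M_injective (h'.trans (by rw [pow_one]; exact hW (hu.le_of_lt htL ht)))
  · rintro (rfl | rfl | ⟨a, rfl⟩)
    · exact (defOver_V hr hu.mem hu.ne L.one_mem one_ne_zero L.zero_mem).of_eqv hV0
    · exact (defOver_W hr hu.mem hu.ne hu.mem hu.ne L.zero_mem).of_eqv (hW (by simp))
    · exact (defOver_V hr hu.mem hu.ne hu.mem hu.ne (rep_mem hr a)).of_eqv
        (hV (by simp))

/-- The forms defined over the unramified quadratic extension. -/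
lemma defOver_M_iff_of_unif_two {L : Subfield E} (hu : D.Unif L 2) (hr : D.r ∈ L) (i : Idx) :
    D.DefOver L (D.M i) ↔ i = fin₂ 0 0 ∨ i = inf₂ 0 := by
  have hs := D.s_ne
  have hsp := D.N_s_pos
  have hs1 := D.N_s_lt
  have h2 := D.two_ne
  have h2p := D.N.pos D.two_ne
  have h2s := D.N_two_eq
  -- Here `b = 1`, and `T (1 / s)` moves the base vertex to distance two from the centre. Two
  -- adjacent vertices of the tree of `L` become `inf₂ 0` and `fin₂ 0 0`, on opposite sides of the
  -- central form.
  have hV : ∀ {t : E}, D.N t ≤ D.N 2 →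
      D.Eqv (V (2 * (1 / D.s)) (t * (1 / D.s))) (D.M (fin₂ 0 0)) := by
    intro t ht
    have hN : D.N (2 * (1 / D.s)) = D.N D.s := by
      rw [map_mul, map_div₀, h2s, map_one, sq]; field_simp
    refine eqv_V (mul_ne_zero h2 (one_div_ne_zero hs)) (by rw [hN, N_p_sq']) ?_
    rw [hN]
    simp only [rep, Matrix.cons_val_zero, mul_zero, add_zero, sub_zero]
    rw [← hN, map_mul, map_mul]
    exact mul_le_mul_of_nonneg_right ht (D.N.nonneg _)
  have hW : ∀ {t : E}, D.N t ≤ 1 → D.Eqv (W (1 / (1 / D.s)) (t / (1 / D.s))) (D.M (inf₂ 0)) := by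
    intro t ht
    simp only [one_div, one_mul, div_inv_eq_mul]
    refine eqv_W hs N_p_sq'.symm ?_
    simpa [rep] using D.mul_le (y := D.s) ht le_rfl
  have hV0 : ∀ {t : E}, D.N t ≤ 1 → D.Eqv (V (1 * (1 / D.s)) (t * (1 / D.s))) (W D.s 0) := by
    intro t ht
    refine ⟨1 / D.s, one_div_ne_zero hs, !![-t, 1; 1, 0],
      ⟨intM_of (by rwa [D.N.map_neg]) (by simp) (by simp) (by simp), ?_⟩, ?_⟩
    · simp [Matrix.det_fin_two_of, D.N.map_neg]
    · ext i j
      fin_cases i <;> fin_cases j <;> simp [V, W, Matrix.mul_apply, Fin.sum_univ_two, hs]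
  have hWW : D.Eqv (W D.s 0) (D.M (inf₂ 0)) := by
    have := hW (t := 0) (by simp)
    simpa using this
  constructor
  · intro h
    obtain ⟨n, t, htL, ⟨ht, h'⟩ | ⟨ht, h'⟩⟩ :=
      h.normal_form hu hr L.one_mem one_ne_zero (det_M i)
    · obtain ⟨hn, hn'⟩ := (h'.intg (intg_M i)).of_V
      have hn1 : n ≤ 1 := by
        rw [map_mul, map_div₀, map_one, map_pow, mul_one_div, le_div_iff₀ hsp, ← sq, ← h2s] at hn
        have hn : D.N 2 ^ 1 ≤ D.N 2 ^ n := by rwa [pow_one]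
        exact (pow_le_pow_iff_right_of_lt_one₀ h2p hu.lt).mp hn
      interval_cases n
      · right
        exact M_injective ((h'.trans (by rw [pow_zero]; exact hV0 ht)).trans hWW)
      · left
        -- The off-diagonal parameter `t / s` need not be integral, so the second bound of the
        -- integrality criterion is needed. It gives `N (t ^ 2) ≤ N 2 < 1`, and `t ∈ L` has norm an
        -- integral power of that of 2.
        have ht2 : D.N t ≤ D.N 2 := by
          apply hu.le_of_lt htL
          have e1 : (t * (1 / D.s)) ^ 2 * D.s = t ^ 2 * (1 / D.s) := by field_simp
          rw [e1, map_mul, map_mul] at hn'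
          have := le_of_mul_le_mul_right hn' (D.N.pos (one_div_ne_zero hs))
          rw [pow_one, map_pow] at this
          have := this.trans_lt hu.lt
          have := D.N.nonneg t
          nlinarith
        exact M_injective (h'.trans (by rw [pow_one]; exact hV ht2))
    · have hn := (h'.intg (intg_M i)).of_W
      have hn0 : n = 0 := by
        by_contra hn0
        rw [one_div, div_inv_eq_mul, map_mul, map_pow] at hn
        have := pow_lt_one₀ h2p.le hu.lt hn0
        nlinarith
      subst hn0
      right
      exact M_injective (h'.trans (by rw [pow_zero]; exact hW ht.le))
  · rintro (rfl | rfl)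
    · exact (defOver_V hr L.one_mem one_ne_zero hu.mem h2 L.zero_mem).of_eqv (hV (by simp))
    · exact (defOver_W hr L.one_mem one_ne_zero L.one_mem one_ne_zero L.zero_mem).of_eqv
        (hW (by simp))

end DyadicData

/-! ### Upper bound for fields of definition not containing `√-3`. -/

namespace DyadicData

variable {E : Type*} [Field E] [CharZero E] {D : DyadicData E}

variable (D) in
/-- An isometric endomorphism moving `√-3`. -/
structure Conj (τ : E →+* E) : Prop where
  isom : ∀ x, D.N (τ x) = D.N x
  map_r : τ D.r = -D.r

lemma sq_root_map (τ : E →+* E) {x : E} {n : ℤ} (hx : x ^ 2 = n) : τ x = x ∨ τ x = -x := by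
  apply sq_eq_sq_iff_eq_or_eq_neg.mp
  rw [← map_pow, hx, map_intCast]

lemma map_I (D : DyadicData E) (τ : E →+* E) : τ D.I = D.I ∨ τ D.I = -D.I :=
  sq_root_map τ (n := -1) (by rw [D.hI]; simp)

lemma map_s (D : DyadicData E) (τ : E →+* E) : τ D.s = D.s ∨ τ D.s = -D.s :=
  sq_root_map τ (n := 2) (by rw [D.hs]; simp)

/-- The sign changes of `I` and `s` move `z` only by multiples of `s`, so `p` is fixed to second
order. -/
lemma N_map_p_sub (D : DyadicData E) (τ : E →+* E) : D.N (τ D.p - D.p) ≤ D.N D.s := by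
  have hs := D.s_ne
  have hz : ∀ y : E, D.N y ≤ 1 → D.N (y * D.s) ≤ D.N D.s := fun y hy => D.mul_le hy le_rfl
  have h2 : (2 : E) = D.s * D.s := by rw [← D.hs]; ring
  have e : τ D.p - D.p = τ D.z - D.z := by rw [p, map_sub, map_one]; ring
  rw [e, z, map_div₀, map_add, map_one]
  have hI := D.N_I
  rcases map_I D τ with h1 | h1 <;> rcases map_s D τ with h2' | h2' <;> rw [h1, h2']
  · simp [D.N_s_pos.le]
  · have : (1 + D.I) / -D.s - (1 + D.I) / D.s = -(1 + D.I) * D.s := by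
      field_simp; rw [D.hs]; ring
    rw [this]; exact hz _ (by rw [D.N.map_neg]; exact D.add_le (by simp) hI.le)
  · have : (1 + -D.I) / D.s - (1 + D.I) / D.s = -D.I * D.s := by
      field_simp; rw [D.hs]; ring
    rw [this]; exact hz _ (by rw [D.N.map_neg]; exact hI.le)
  · have : (1 + -D.I) / -D.s - (1 + D.I) / D.s = -1 * D.s := by
      field_simp; rw [D.hs]; ring
    rw [this]; exact hz _ (by simp [D.N.map_neg])

lemma Conj.map_w {τ : E →+* E} (hτ : D.Conj τ) : τ D.w = D.w ^ 2 := by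
  rw [D.w_sq, w, map_div₀, map_add, map_neg, map_one, hτ.map_r, map_ofNat]
  field_simp; ring

/-- The matrix intertwining the explicit representation with its conjugate. -/
def Q (x : E) : Matrix (Fin 2) (Fin 2) E := !![0, x; 1, 0]

lemma det_Q (x : E) : (Q x).det = -x := by simp [Q, Matrix.det_fin_two_of]

/-- The twist of the model by `τ` is again a quaternion pair, and this antidiagonal matrix is an
explicit isomorphism with the model. The sign `d` records the action on `s`. -/
lemma Conj.Q_mul_A₀ {τ : E →+* E} (hτ : D.Conj τ) {d : E} (hd : τ D.s = d * D.s)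
    (hd2 : d ^ 2 = 1) : τ.mapMatrix D.A₀ * Q (-3 * d) = Q (-3 * d) * D.A₀ := by
  have h3 : τ 3 = 3 := map_ofNat τ 3
  ext i j
  fin_cases i <;> fin_cases j <;>
    simp [A₀, Q, Matrix.mul_apply, Fin.sum_univ_two, hτ.map_r, hd, h3]
  · ring
  · ring
  · ring
  · linear_combination D.s * hd2

lemma Conj.Q_mul_B₀ {τ : E →+* E} (hτ : D.Conj τ) {d : E} (hd : τ D.s = d * D.s)
    (hd2 : d ^ 2 = 1) : τ.mapMatrix D.B₀ * Q (-3 * d) = Q (-3 * d) * D.B₀ := by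
  have h3 : τ 3 = 3 := map_ofNat τ 3
  ext i j
  fin_cases i <;> fin_cases j <;>
    simp [B₀, Q, Matrix.mul_apply, Fin.sum_univ_two, hτ.map_r, hτ.map_w, hd, h3]
  · linear_combination (D.w * d * D.s) * D.w_cube
  · ring
  · ring
  · linear_combination (D.w ^ 2 * D.s) * hd2

lemma mapMatrix_eq {τ : E →+* E} {L : Subfield E} (hL : ∀ x ∈ L, τ x = x)
    {A : Matrix (Fin 2) (Fin 2) E} (hA : ∀ i j, A i j ∈ L) : τ.mapMatrix A = A := by
  ext i j; exact hL _ (hA i j)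

lemma Conj.unim {τ : E →+* E} (hτ : D.Conj τ) {U : Matrix (Fin 2) (Fin 2) E} (hU : D.Unim U) :
    D.Unim (τ.mapMatrix U) :=
  ⟨fun i j => by simpa [hτ.isom] using hU.1 i j, by rw [← RingHom.map_det, hτ.isom, hU.2]⟩

lemma Conj.eqv {τ : E →+* E} (hτ : D.Conj τ) {g g' : Matrix (Fin 2) (Fin 2) E}
    (h : D.Eqv g g') : D.Eqv (τ.mapMatrix g) (τ.mapMatrix g') := by
  obtain ⟨c, hc, U, hU, h⟩ := h
  refine ⟨τ c, (map_ne_zero τ).mpr hc, _, hτ.unim hU, ?_⟩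
  rw [← map_mul, ← h]
  ext i j; simp

/-- An integral form defined over `L` agrees with its Galois conjugates over `L`. -/
lemma DefOver.eqv_conj {L : Subfield E} {τ : E →+* E} (hτ : D.Conj τ) (hL : ∀ x ∈ L, τ x = x)
    {d : E} (hd : τ D.s = d * D.s) (hd2 : d ^ 2 = 1) {g : Matrix (Fin 2) (Fin 2) E}
    (hg : g.det ≠ 0) (h : D.DefOver L g) : D.Eqv g (τ.mapMatrix g * Q (-3 * d)) := by
  obtain ⟨g', hgg, A, B, hA, hB, hAg, hBg⟩ := h
  have hg' := hgg.det_ne hg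
  refine (hgg.trans ?_).trans ((hτ.eqv hgg).mul_right _).symm
  have hd0 : d ≠ 0 := by rintro rfl; norm_num at hd2
  refine eqv_of_intertwine hg' ?_ hAg hBg ?_ ?_
  · rw [Matrix.det_mul, det_Q, ← RingHom.map_det]
    exact mul_ne_zero ((map_ne_zero τ).mpr hg') (by simpa using hd0)
  · have := congrArg τ.mapMatrix hAg
    rw [map_mul, map_mul, mapMatrix_eq hL hA] at this
    rw [← mul_assoc, this, mul_assoc, hτ.Q_mul_A₀ hd hd2, mul_assoc]
  · have := congrArg τ.mapMatrix hBg
    rw [map_mul, map_mul, mapMatrix_eq hL hB] at this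
    rw [← mul_assoc, this, mul_assoc, hτ.Q_mul_B₀ hd hd2, mul_assoc]

/-- The change of chart `t ↦ 1/t` on the projective line. -/
lemma eqv_W_of_unit {P t : E} (hP : D.N P ≤ 1) (ht : D.N t = 1) :
    D.Eqv (W P t) (V P (1 / t)) := by
  have ht0 : t ≠ 0 := D.ne_zero_of_N one_pos ht
  refine ⟨t, ht0, !![-t ^ 2, t * P; 0, 1], ⟨intM_of ?_ ?_ (by simp) (by simp), ?_⟩, ?_⟩
  · rw [D.N.map_neg, map_pow, ht, one_pow]
  · exact D.mul_le ht.le hP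
  · rw [Matrix.det_fin_two_of]; simp [D.N.map_neg, ht]
  · ext i j
    fin_cases i <;> fin_cases j <;> simp [V, W, Matrix.mul_apply, Fin.sum_univ_two]
    · ring
    · field_simp

lemma map_V_mul_Q (τ : E →+* E) (P t x : E) :
    τ.mapMatrix (V P t) * Q x = W (x * τ P) (x * τ t) := by
  ext i j
  fin_cases i <;> fin_cases j <;> simp [V, W, Q, Matrix.mul_apply, Fin.sum_univ_two, mul_comm]

lemma eqv_map_W_mul_Q (τ : E →+* E) (P t : E) {x : E} (hx : x ≠ 0) :
    D.Eqv (τ.mapMatrix (W P t) * Q x) (V (τ P / x) (τ t / x)) := by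
  refine ⟨x, hx, 1, unim_one, ?_⟩
  ext i j
  fin_cases i <;> fin_cases j <;> simp [V, W, Q, Matrix.mul_apply, Fin.sum_univ_two] <;> field_simp

/-- For `d = 1` or `d = -1` the number `-3 * d - 1` is `-4` or `2`. The twisting factor is therefore
1 modulo 2 and invisible at the precision of the forms. -/
lemma exists_sign (τ : E →+* E) : ∃ d : E, τ D.s = d * D.s ∧ d ^ 2 = 1 ∧ D.N (-3 * d) = 1 ∧
    D.N (-3 * d - 1) ≤ D.N 2 := by
  rcases map_s D τ with h | h
  · refine ⟨1, by simpa using h, by simp, by simp [D.N.map_neg, D.N_three], ?_⟩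
    have : (-3 * 1 - 1 : E) = 2 * (-2) := by norm_num
    rw [this]; exact D.mul_le' le_rfl (by rw [D.N.map_neg]; exact (D.N_two_lt_s.trans D.N_s_lt).le)
  · refine ⟨-1, by simpa using h, by simp, by simp [D.N_three], ?_⟩
    norm_num

/-- The twisted action exchanges 0 and ∞ in the residual projective line, so it moves every
noncentral vertex in the direction of `W`. -/
lemma DefOver.not_W {L : Subfield E} {τ : E →+* E} (hτ : D.Conj τ) (hL : ∀ x ∈ L, τ x = x)
    {n : ℕ} (hn : 1 ≤ n) {t : E} (ht : D.N t < 1) : ¬ D.DefOver L (W (D.p ^ n) t) := by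
  intro h
  obtain ⟨d, hd, hd2, hd3, -⟩ := exists_sign (D := D) τ
  have hx0 : -3 * d ≠ 0 := D.ne_zero_of_N one_pos hd3
  have hp := pow_ne_zero n D.p_ne
  have h1 := h.eqv_conj hτ hL hd hd2 (by rw [det_W]; exact neg_ne_zero.mpr hp)
  have h2 := (h1.trans (eqv_map_W_mul_Q τ _ _ hx0)).symm.of_V_W
    (div_ne_zero ((map_ne_zero τ).mpr hp) hx0) hp
    (by rw [map_div₀, hd3, hτ.isom, div_one]; exact ht.le) ht
  rw [map_div₀, hd3, hτ.isom, div_one, map_pow, ← pow_add] at h2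
  exact absurd h2 (not_le.mpr (pow_lt_one₀ D.N_p_pos.le D.N_p_lt (by omega)))

/-- The twisted action sends the parameter `t` to `1 / (-3 * d * τ t)`. A nonunit `t` would change
chart; for a unit, invariance is the congruence `-3 * d * t * τ t ≡ 1`. -/
lemma DefOver.V_unit {L : Subfield E} {τ : E →+* E} (hτ : D.Conj τ) (hL : ∀ x ∈ L, τ x = x)
    {n : ℕ} (hn : 1 ≤ n) (hn4 : n ≤ 4) {t : E} (ht : D.N t ≤ 1)
    (h : D.DefOver L (V (D.p ^ n) t)) : D.N t = 1 ∧ D.N (t * τ t - 1) ≤ D.N (D.p ^ n) := by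
  obtain ⟨d, hd, hd2, hd3, hd4⟩ := exists_sign (D := D) τ
  have hx0 : -3 * d ≠ 0 := D.ne_zero_of_N one_pos hd3
  have hp := pow_ne_zero n D.p_ne
  have hτp : τ (D.p ^ n) ≠ 0 := (map_ne_zero τ).mpr hp
  have hP1 : D.N (-3 * d * τ (D.p ^ n)) = D.N (D.p ^ n) := by
    rw [map_mul, hd3, hτ.isom, one_mul]
  have hle : D.N (D.p ^ n) ≤ 1 := by
    rw [map_pow]; exact pow_le_one₀ D.N_p_pos.le D.N_p_le
  have h1 := h.eqv_conj hτ hL hd hd2 (by rwa [det_V])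
  rw [map_V_mul_Q] at h1
  have ht1 : D.N t = 1 := by
    refine ht.eq_of_not_lt fun hlt => ?_
    have h2 := h1.of_V_W hp (mul_ne_zero hx0 hτp) ht
      (by rw [map_mul, hd3, hτ.isom, one_mul]; exact hlt)
    rw [hP1, map_pow, ← pow_add] at h2
    exact absurd h2 (not_le.mpr (pow_lt_one₀ D.N_p_pos.le D.N_p_lt (by omega)))
  refine ⟨ht1, ?_⟩
  have hxt : D.N (-3 * d * τ t) = 1 := by rw [map_mul, hd3, hτ.isom, one_mul, ht1]
  have hxt0 : -3 * d * τ t ≠ 0 := D.ne_zero_of_N one_pos hxt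
  have h2 := (h1.trans (eqv_W_of_unit (hP1.trans_le hle) hxt)).of_V.2
  have h3 : (t - 1 / (-3 * d * τ t)) * (-3 * d * τ t) = -3 * d * (t * τ t) - 1 := by
    rw [sub_mul, div_mul_cancel₀ _ hxt0]; ring
  have h4 : D.N (-3 * d * (t * τ t) - 1) ≤ D.N (D.p ^ n) := by
    rw [← h3]; exact D.mul_le' h2 hxt.le
  have h5 : t * τ t - 1 = (-3 * d * (t * τ t) - 1) - (-3 * d - 1) * (t * τ t) := by ring
  rw [h5]
  -- The factor `-3 * d` may be dropped modulo 2, which has the norm of `p ^ 4`; hence the bound `n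
  -- ≤ 4`.
  refine D.sub_le h4 (D.mul_le' (hd4.trans ?_) (D.mul_le ht (by rw [hτ.isom]; exact ht)))
  rw [D.N_two_eq, ← D.N_p_sq, map_pow, ← pow_mul]
  exact pow_le_pow_of_le_one D.N_p_pos.le D.N_p_le hn4

/-- For `t = α (1 + p γ)` with `α` of norm 1, one has `t τ(t) - 1 = p (γ + τ γ)` up to multiples of
`s`. Trace `-1` leaves a first-order term that is not divisible by `p ^ 2`. -/
lemma Conj.not_norm_one {τ : E →+* E} (hτ : D.Conj τ) {α γ : E} (hα : α * τ α = 1)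
    (hγ : γ + τ γ = -1) (hγ1 : D.N γ ≤ 1) :
    ¬ D.N ((α + D.p * (α * γ)) * τ (α + D.p * (α * γ)) - 1) ≤ D.N (D.p ^ 2) := by
  intro h
  have e : (α + D.p * (α * γ)) * τ (α + D.p * (α * γ)) - 1 =
      -D.p + ((τ D.p - D.p) * τ γ + D.p * τ D.p * (γ * τ γ)) := by
    simp only [map_add, map_mul]
    linear_combination (1 + D.p * γ) * (1 + τ D.p * τ γ) * hα + D.p * hγ
  have hγ2 : D.N (τ γ) ≤ 1 := by rwa [hτ.isom]
  have hlt : D.N D.s < D.N D.p := D.N_s_lt_p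
  have hsmall : D.N ((τ D.p - D.p) * τ γ + D.p * τ D.p * (γ * τ γ)) ≤ D.N D.s := by
    refine D.add_le (D.mul_le' (N_map_p_sub D τ) hγ2) (D.mul_le' ?_ (D.mul_le hγ1 hγ2))
    rw [map_mul, hτ.isom, ← sq, D.N_p_sq]
  rw [e, D.add_eq_left (by rw [D.N.map_neg]; exact hsmall.trans_lt hlt), D.N.map_neg, N_p_sq'] at h
  linarith

/-- The forms that can be defined over a field not containing `√-3`. -/
lemma DefOver.M_cases_of_conj {L : Subfield E} {τ : E →+* E} (hτ : D.Conj τ)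
    (hL : ∀ x ∈ L, τ x = x) {i : Idx} (h : D.DefOver L (D.M i)) :
    i = central ∨ (∃ a, a ≠ 0 ∧ i = fin₁ a) ∨ ∃ a, a ≠ 0 ∧ (i = fin₂ a 0 ∨ i = fin₂ a a) := by
  have hw1 : D.w * τ D.w = 1 := by rw [hτ.map_w]; linear_combination D.w_cube
  have hw2 : D.w ^ 2 * τ (D.w ^ 2) = 1 := by rw [map_pow, ← mul_pow, hw1, one_pow]
  have hww : D.w + τ D.w = -1 := by rw [hτ.map_w]; linear_combination D.w_sq
  have hww2 : D.w ^ 2 + τ (D.w ^ 2) = -1 := by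
    rw [map_pow, hτ.map_w]; linear_combination D.w_sq + D.w * D.w_cube
  have hN2 : D.N (D.w ^ 2) ≤ 1 := by rw [map_pow, D.N_w]; norm_num
  have hc1 := D.w_cube
  rcases i with _ | (a | _) | (⟨a, b⟩ | b)
  · exact Or.inl rfl
  · refine Or.inr (Or.inl ⟨a, ?_, rfl⟩)
    rintro rfl
    have h' : D.DefOver L (V (D.p ^ 1) (D.rep 0)) := by simpa [M] using h
    have := (h'.V_unit hτ hL le_rfl (by norm_num) (D.N_rep_le 0)).1
    simp [rep] at this
  · have h' : D.DefOver L (W (D.p ^ 1) 0) := by simpa [M] using h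
    exact absurd h' (not_W hτ hL le_rfl (by simp))
  · have h' : D.DefOver L (V (D.p ^ 2) (D.rep a + D.p * D.rep b)) := h
    obtain ⟨h1, h2⟩ := h'.V_unit hτ hL one_le_two (by norm_num) (N_digits a b)
    refine Or.inr (Or.inr ⟨a, ?_, ?_⟩)
    · rintro rfl
      have := (N_p_mul_rep (D := D) b).trans_lt D.N_p_lt
      simp only [rep, Matrix.cons_val_zero, zero_add] at h1 this
      rw [h1] at this
      exact lt_irrefl _ this
    · by_contra! hc
      -- In the excluded cases the ratio `γ` of the second digit to the first is `w` or `w²`, of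
      -- trace `-1`; the permitted ratios 0 and 1 have even trace.
      have key : ∀ α γ : E, D.rep a = α → D.rep b = α * γ → α * τ α = 1 → γ + τ γ = -1 →
          D.N γ ≤ 1 → False := by
        intro α γ ha hb h3 h4 h5
        rw [ha, hb] at h2
        exact hτ.not_norm_one h3 h4 h5 h2
      have ha0 : a ≠ 0 := by
        rintro rfl
        have := (N_p_mul_rep (D := D) b).trans_lt D.N_p_lt
        simp only [rep, Matrix.cons_val_zero, zero_add] at h1 this
        rw [h1] at this
        exact lt_irrefl _ this
      have h11 : (1 : E) * τ 1 = 1 := by simp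
      fin_cases a <;> fin_cases b <;> simp at hc ha0
      · exact key 1 D.w (by simp [rep]) (by simp [rep]) h11 hww D.N_w.le
      · exact key 1 (D.w ^ 2) (by simp [rep]) (by simp [rep]) h11 hww2 hN2
      · exact key D.w (D.w ^ 2) (by simp [rep]) (by simp [rep]; linear_combination -hc1)
          hw1 hww2 hN2
      · exact key D.w D.w (by simp [rep]) (by simp [rep]; ring) hw1 hww D.N_w.le
      · exact key (D.w ^ 2) D.w (by simp [rep]) (by simp [rep]; linear_combination -hc1)
          hw2 hww D.N_w.le
      · exact key (D.w ^ 2) (D.w ^ 2) (by simp [rep])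
          (by simp [rep]; linear_combination -D.w * hc1) hw2 hww2 hN2
  · have h' : D.DefOver L (W (D.p ^ 2) (D.p * D.rep b)) := h
    exact absurd h' (not_W hτ hL one_le_two ((N_p_mul_rep b).trans_lt D.N_p_lt))

end DyadicData

/-! ### Galois descent of forms to fields not containing `√-3`. -/

namespace DyadicData

variable {E : Type*} [Field E] [CharZero E] {D : DyadicData E}

/-- The descent criterion: if `K` relates `X` to its twist and `G` is semi-invariant with respect to
`K` up to a scalar, the conjugate of `X` by `G` has `τ`-fixed entries. -/
lemma mapMatrix_eq_of_intertwine {τ : E →+* E} {A X G K : Matrix (Fin 2) (Fin 2) E} {c : E}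
    (hG : G.det ≠ 0) (hc : c ≠ 0) (hA : A * G = G * X) (hX : τ.mapMatrix X * K = K * X)
    (hK : τ.mapMatrix G * K = c • G) : τ.mapMatrix A = A := by
  apply mul_right_cancel_of_det hG
  apply smul_right_injective _ hc
  have h := congrArg τ.mapMatrix hA
  rw [map_mul, map_mul] at h
  calc c • (τ.mapMatrix A * G) = τ.mapMatrix A * (τ.mapMatrix G * K) := by
        rw [hK, Matrix.mul_smul]
    _ = τ.mapMatrix G * (τ.mapMatrix X * K) := by rw [← mul_assoc, h, mul_assoc]
    _ = c • (A * G) := by rw [hX, ← mul_assoc, hK, Matrix.smul_mul, hA]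

/-- A matrix whose rows are semilinearly invariant, used for Galois descent. -/
def descentMatrix (D : DyadicData E) (P a y : E) : Matrix (Fin 2) (Fin 2) E :=
  !![P * (a * D.w) ^ 2 / y, P * (a * D.w); a ^ 2 / y, a]

lemma det_descentMatrix {P a y : E} :
    (descentMatrix D P a y).det = P * a ^ 3 * D.w * (D.w - 1) / y := by
  rw [descentMatrix, Matrix.det_fin_two_of]; ring

/-- Subtracting `P * w` times the second row from the first clears the upper right entry, and what
remains in the upper left is a unit times `P`. -/
lemma descentMatrix_mul_T_eqv {P a y e : E} (hP : D.N P ≤ 1) (ha : D.N a = 1) (hy : D.N y = 1)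
    (he : D.N e = 1) : D.Eqv (descentMatrix D P a y * T e) (V P (e * a / y)) := by
  have ha0 := D.ne_zero_of_N one_pos ha
  have hy0 := D.ne_zero_of_N one_pos hy
  have he0 := D.ne_zero_of_N one_pos he
  have hw0 := D.w_ne
  have hw1 : D.w - 1 ≠ 0 := D.ne_zero_of_N one_pos D.N_w_sub_one
  have hk : D.N (y / (a * e * (D.w * (D.w - 1)))) = 1 := by
    simp only [map_div₀, map_mul, ha, hy, he, D.N_w, D.N_w_sub_one]; norm_num
  refine ⟨a, ha0, !![y / (a * e * (D.w * (D.w - 1))), -(y / (a * e * (D.w * (D.w - 1))) * (P * D.w));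
    0, 1], ⟨intM_of hk.le ?_ (by simp) (by simp), ?_⟩, ?_⟩
  · rw [D.N.map_neg]; exact D.mul_le hk.le (D.mul_le hP D.N_w.le)
  · rw [Matrix.det_fin_two_of]; simpa using hk
  · ext i j
    fin_cases i <;> fin_cases j <;>
      simp [V, T, descentMatrix, Matrix.mul_apply, Fin.sum_univ_two] <;> field_simp <;> ring

/-- Galois descent of integral forms along an unramified quadratic extension. -/
lemma defOver_of_descent {L : Subfield E} {Γ : Set (E →+* E)}
    (hfix : ∀ x, (∀ τ ∈ Γ, τ x = x) → x ∈ L) {u y P a : E} (hP0 : P ≠ 0) (hP : D.N P ≤ 1)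
    (hPΓ : ∀ τ ∈ Γ, τ P = P) (hu : D.N u = D.N D.s) (huΓ : ∀ τ ∈ Γ, τ u = u) (hy : D.N y = 1)
    (hyΓ : ∀ τ ∈ Γ, (τ D.r = D.r ∧ τ y = y) ∨ (τ D.r = -D.r ∧ y * τ y = -(3 * u ^ 2 / 2)))
    (ha : a = 1 ∨ a = D.w ∨ a = D.w ^ 2) : D.DefOver L (V P (u / D.s * a / y)) := by
  have hu0 : u ≠ 0 := D.ne_zero_of_N D.N_s_pos hu
  have hy0 := D.ne_zero_of_N one_pos hy
  have hw0 := D.w_ne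
  have hw1 : D.w - 1 ≠ 0 := D.ne_zero_of_N one_pos D.N_w_sub_one
  have haN : D.N a = 1 := by rcases ha with rfl | rfl | rfl <;> simp [D.N_w]
  have ha0 := D.ne_zero_of_N one_pos haN
  have he : D.N (u / D.s) = 1 := by rw [map_div₀, hu, div_self D.N_s_pos.ne']
  have hdet : (descentMatrix D P a y).det ≠ 0 := by
    rw [det_descentMatrix]
    exact div_ne_zero (mul_ne_zero (mul_ne_zero (mul_ne_zero hP0 (pow_ne_zero 3 ha0)) hw0) hw1) hy0
  have hunit : IsUnit (descentMatrix D P a y).det := isUnit_iff_ne_zero.mpr hdet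
  -- If `τ` fixes `√-3`, then `K = 1`. Otherwise `K = Q (y * τ y)`, which intertwines `A₁ u`, `B₁ u`
  -- with their twists because of the norm equation. Since `τ` inverts cube roots of unity, each row
  -- of the descent matrix is then multiplied by `y`.
  have hfixed : ∀ τ ∈ Γ, ∃ (K : Matrix (Fin 2) (Fin 2) E) (c : E), c ≠ 0 ∧
      τ.mapMatrix (descentMatrix D P a y) * K = c • descentMatrix D P a y ∧
      τ.mapMatrix (D.A₁ u) * K = K * D.A₁ u ∧ τ.mapMatrix (D.B₁ u) * K = K * D.B₁ u := by
    intro τ hτ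
    have hτP := hPΓ τ hτ
    have hτu := huΓ τ hτ
    have h2 : τ 2 = 2 := map_ofNat τ 2
    have h3 : τ 3 = 3 := map_ofNat τ 3
    rcases hyΓ τ hτ with ⟨hr, hy'⟩ | ⟨hr, hy'⟩
    · have hw : τ D.w = D.w := by rw [w, map_div₀, map_add, map_neg, map_one, hr, h2]
      have haτ : τ a = a := by rcases ha with rfl | rfl | rfl <;> simp [hw]
      refine ⟨1, 1, one_ne_zero, ?_, ?_, ?_⟩
      · rw [mul_one, one_smul]
        ext i j
        fin_cases i <;> fin_cases j <;> simp [descentMatrix, hτP, hw, haτ, hy']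
      · rw [mul_one, one_mul]
        ext i j
        fin_cases i <;> fin_cases j <;> simp [A₁, hτu, hr, h2, h3]
      · rw [mul_one, one_mul]
        ext i j
        fin_cases i <;> fin_cases j <;> simp [B₁, hτu, hr, hw, h2, h3]
    · have hw : τ D.w = D.w ^ 2 := by
        rw [D.w_sq, w, map_div₀, map_add, map_neg, map_one, hr, h2]; field_simp; ring
      have haτ : τ a = a ^ 2 := by rcases ha with rfl | rfl | rfl <;> simp [hw]
      have ha3 : a ^ 3 = 1 := by
        rcases ha with rfl | rfl | rfl
        · ring
        · exact D.w_cube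
        · rw [← pow_mul, mul_comm, pow_mul, D.w_cube, one_pow]
      have hτy : τ y ≠ 0 := (map_ne_zero τ).mpr hy0
      have h32 : 3 * u ^ 2 / 2 = -(y * τ y) := by rw [hy', neg_neg]
      refine ⟨Q (-(3 * u ^ 2 / 2)), y, hy0, ?_, ?_, ?_⟩
      · have e1 : ∀ z, z / τ y * (3 * u ^ 2 / 2) = -(z * y) := by
          intro z; rw [h32]; field_simp
        have hw3 := D.w_cube
        ext i j
        fin_cases i <;> fin_cases j <;>
          simp [descentMatrix, Q, Matrix.mul_apply, Fin.sum_univ_two, hτP, hw, haτ, e1]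
        · field_simp
        · linear_combination (P * a * D.w * y) * (ha3 * D.w ^ 3 + hw3)
        · field_simp
        · linear_combination a * y * ha3
      · ext i j
        fin_cases i <;> fin_cases j <;>
          simp [A₁, Q, Matrix.mul_apply, Fin.sum_univ_two, hτu, hr, h2, h3] <;> field_simp
      · ext i j
        fin_cases i <;> fin_cases j <;>
          simp [B₁, Q, Matrix.mul_apply, Fin.sum_univ_two, hτu, hr, hw, h2, h3] <;> field_simp
        linear_combination D.w_cube
  refine DefOver.of_eqv (descentMatrix_mul_T_eqv hP haN hy he) ⟨_, Eqv.refl _,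
    descentMatrix D P a y * D.A₁ u * (descentMatrix D P a y)⁻¹,
    descentMatrix D P a y * D.B₁ u * (descentMatrix D P a y)⁻¹, ?_, ?_, ?_, ?_⟩
  · intro i j
    refine hfix _ fun τ hτ => ?_
    obtain ⟨K, c, hc, hK, hKA, -⟩ := hfixed τ hτ
    have := mapMatrix_eq_of_intertwine hdet hc (Matrix.nonsing_inv_mul_cancel_right _ _ hunit)
      hKA hK
    exact congrFun (congrFun this i) j
  · intro i j
    refine hfix _ fun τ hτ => ?_
    obtain ⟨K, c, hc, hK, -, hKB⟩ := hfixed τ hτ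
    have := mapMatrix_eq_of_intertwine hdet hc (Matrix.nonsing_inv_mul_cancel_right _ _ hunit)
      hKB hK
    exact congrFun (congrFun this i) j
  · rw [← mul_assoc, Matrix.nonsing_inv_mul_cancel_right _ _ hunit, mul_assoc, A₁_mul_T hu0,
      mul_assoc]
  · rw [← mul_assoc, Matrix.nonsing_inv_mul_cancel_right _ _ hunit, mul_assoc, B₁_mul_T hu0,
      mul_assoc]

/-- Galois descent, with the parameters of the resulting forms reduced modulo `√2`. -/
lemma defOver_of_descent_of_close {L : Subfield E} {Γ : Set (E →+* E)}
    (hfix : ∀ x, (∀ τ ∈ Γ, τ x = x) → x ∈ L) {u y P c : E} (hP0 : P ≠ 0) (hP : D.N P ≤ 1)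
    (hPs : D.N D.s ≤ D.N P)
    (hPΓ : ∀ τ ∈ Γ, τ P = P) (hu : D.N u = D.N D.s) (huΓ : ∀ τ ∈ Γ, τ u = u)
    (hyΓ : ∀ τ ∈ Γ, (τ D.r = D.r ∧ τ y = y) ∨ (τ D.r = -D.r ∧ y * τ y = -(3 * u ^ 2 / 2)))
    {b : Fin 4} (hb : b ≠ 0) (hyb : D.N (y - D.rep b) ≤ D.N D.s)
    (hc : D.N (u / D.s - c) ≤ D.N D.s) {a : Fin 4} (ha : a ≠ 0) :
    D.DefOver L (V P (c * D.rep a)) := by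
  have hw3 := D.w_cube
  -- The descended parameter is `(u / s) * k / y`, with `u / s ≡ c` and `y` congruent to the digit
  -- `b`. Taking `k` to be the product of the digits `a` and `b` makes it congruent to `c` times
  -- `a`.
  obtain ⟨k, hk, hkb⟩ : ∃ k, (k = 1 ∨ k = D.w ∨ k = D.w ^ 2) ∧ k = D.rep a * D.rep b := by
    have h4 : D.w * D.w ^ 2 = 1 := by linear_combination hw3
    have h5 : D.w ^ 2 * D.w = 1 := by linear_combination hw3
    have h6 : D.w ^ 2 * D.w ^ 2 = D.w := by linear_combination D.w * hw3
    refine ⟨_, ?_, rfl⟩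
    fin_cases a <;> fin_cases b <;> simp [rep, h4, h5, h6, ← sq] at ha hb ⊢
  have hy : D.N y = 1 := by
    rw [← D.N_rep hb]
    exact D.eq_of_sub_lt (hyb.trans_lt (by rw [D.N_rep hb]; exact D.N_s_lt))
  have hy0 := D.ne_zero_of_N one_pos hy
  refine (defOver_of_descent hfix hP0 hP hPΓ hu huΓ hy hyΓ hk).of_eqv
    (eqv_V hP0 rfl (le_trans ?_ hPs))
  have he : D.N (u / D.s) = 1 := by rw [map_div₀, hu, div_self D.N_s_pos.ne']
  have : u / D.s * k / y - c * D.rep a = (u / D.s - c) * D.rep a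
      - (y - D.rep b) * (u / D.s * D.rep a / y) := by
    rw [hkb]; field_simp; ring
  rw [this]
  refine D.sub_le (D.mul_le' hc (D.N_rep_le a)) (D.mul_le' hyb ?_)
  rw [map_div₀, hy, div_one]; exact D.mul_le he.le (D.N_rep_le a)

end DyadicData

/-! ### Extensions by a square root. -/

section QuadraticExtension

variable {k E : Type*} [Field k] [Field E] [Algebra k E]

/-- The extension of `K` by a square root of an element of `K`. -/
def quadExt (K : IntermediateField k E) (v : E) (hv : v ^ 2 ∈ K) : IntermediateField k E where
  carrier := {x | ∃ x₀ ∈ K, ∃ x₁ ∈ K, x = x₀ + x₁ * v}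
  mul_mem' := by
    rintro _ _ ⟨x₀, h₀, x₁, h₁, rfl⟩ ⟨y₀, k₀, y₁, k₁, rfl⟩
    exact ⟨x₀ * y₀ + x₁ * y₁ * v ^ 2, K.add_mem (K.mul_mem h₀ k₀)
      (K.mul_mem (K.mul_mem h₁ k₁) hv), x₀ * y₁ + x₁ * y₀,
      K.add_mem (K.mul_mem h₀ k₁) (K.mul_mem h₁ k₀), by ring⟩
  add_mem' := by
    rintro _ _ ⟨x₀, h₀, x₁, h₁, rfl⟩ ⟨y₀, k₀, y₁, k₁, rfl⟩
    exact ⟨x₀ + y₀, K.add_mem h₀ k₀, x₁ + y₁, K.add_mem h₁ k₁, by ring⟩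
  algebraMap_mem' := fun r => ⟨_, K.algebraMap_mem r, 0, K.zero_mem, by ring⟩
  inv_mem' := by
    rintro _ ⟨x₀, h₀, x₁, h₁, rfl⟩
    -- As `v` may already lie in `K`, the norm can vanish at a nonzero element; that element is then
    -- in `K`.
    by_cases hn : x₀ ^ 2 - x₁ ^ 2 * v ^ 2 = 0
    · have hn' : (x₀ - x₁ * v) * (x₀ + x₁ * v) = 0 := by linear_combination hn
      rcases mul_eq_zero.mp hn' with h | h
      · have : x₀ + x₁ * v = x₀ + x₀ := by linear_combination -h
        rw [this]
        exact ⟨_, K.inv_mem (K.add_mem h₀ h₀), 0, K.zero_mem, by ring⟩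
      · rw [h]
        exact ⟨0, K.zero_mem, 0, K.zero_mem, by simp⟩
    · have hnK : x₀ ^ 2 - x₁ ^ 2 * v ^ 2 ∈ K :=
        K.sub_mem (pow_mem h₀ 2) (K.mul_mem (pow_mem h₁ 2) hv)
      refine ⟨_, K.div_mem h₀ hnK, _, K.div_mem (K.neg_mem h₁) hnK, ?_⟩
      have hx : x₀ + x₁ * v ≠ 0 := by
        intro h
        apply hn
        linear_combination (x₀ - x₁ * v) * h
      field_simp
      ring

lemma le_quadExt {K : IntermediateField k E} {v : E} {hv : v ^ 2 ∈ K} : K ≤ quadExt K v hv :=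
  fun x hx => ⟨x, hx, 0, K.zero_mem, by ring⟩

lemma self_mem_quadExt {K : IntermediateField k E} {v : E} {hv : v ^ 2 ∈ K} :
    v ∈ quadExt K v hv := ⟨0, K.zero_mem, 1, K.one_mem, by ring⟩

lemma quadExt_le {K K' : IntermediateField k E} {v : E} {hv : v ^ 2 ∈ K} (h : K ≤ K')
    (hv' : v ∈ K') : quadExt K v hv ≤ K' := by
  rintro _ ⟨x₀, h₀, x₁, h₁, rfl⟩
  exact K'.add_mem (h h₀) (K'.mul_mem (h h₁) hv')

/-- The linear parametrization of a quadratic extension. -/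
def quadExtMap (K : IntermediateField k E) (v : E) (hv : v ^ 2 ∈ K) :
    (K × K) →ₗ[k] quadExt K v hv where
  toFun x := ⟨x.1 + x.2 * v, _, x.1.2, _, x.2.2, rfl⟩
  map_add' x y := by ext; simp; ring
  map_smul' c x := by ext; simp [Algebra.smul_def]; ring

lemma quadExtMap_surjective (K : IntermediateField k E) (v : E) (hv : v ^ 2 ∈ K) :
    Function.Surjective (quadExtMap K v hv) := by
  rintro ⟨_, x₀, h₀, x₁, h₁, rfl⟩
  exact ⟨(⟨x₀, h₀⟩, ⟨x₁, h₁⟩), rfl⟩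

lemma quadExtMap_injective (K : IntermediateField k E) (v : E) (hv : v ^ 2 ∈ K) (h : v ∉ K) :
    Function.Injective (quadExtMap K v hv) := by
  rw [← LinearMap.ker_eq_bot, LinearMap.ker_eq_bot']
  rintro ⟨⟨x₀, h₀⟩, ⟨x₁, h₁⟩⟩ hx
  have hx' : x₀ + x₁ * v = 0 := congrArg Subtype.val hx
  have hx1 : x₁ = 0 := by
    by_contra hne
    apply h
    have : v = -x₀ / x₁ := by field_simp; linear_combination hx'
    rw [this]; exact K.div_mem (K.neg_mem h₀) h₁
  subst hx1
  have hx0 : x₀ = 0 := by simpa using hx'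
  subst hx0
  rfl

lemma finrank_quadExt_le [FiniteDimensional k E] (K : IntermediateField k E) (v : E)
    (hv : v ^ 2 ∈ K) : Module.finrank k (quadExt K v hv) ≤ 2 * Module.finrank k K := by
  have := LinearMap.finrank_le_finrank_of_surjective (quadExtMap_surjective K v hv)
  rwa [Module.finrank_prod, ← two_mul] at this

lemma finrank_quadExt [FiniteDimensional k E] (K : IntermediateField k E) (v : E)
    (hv : v ^ 2 ∈ K) (h : v ∉ K) :
    Module.finrank k (quadExt K v hv) = 2 * Module.finrank k K := by
  rw [← (LinearEquiv.ofBijective _ ⟨quadExtMap_injective K v hv h,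
    quadExtMap_surjective K v hv⟩).finrank_eq, Module.finrank_prod, two_mul]

end QuadraticExtension

/-! ### Subfields generated by square roots of integers. -/

section SquareRoots

variable {E : Type*} [Field E] [Algebra ℚ_[2] E]

/-- The subfield generated over `ℚ₂` by the square roots of the integers in `S`. -/
def sqrtAdjoin (E : Type*) [Field E] [Algebra ℚ_[2] E] (S : Set ℤ) : IntermediateField ℚ_[2] E :=
  IntermediateField.adjoin ℚ_[2] {x : E | ∃ a ∈ S, x ^ 2 = (a : E)}

lemma mem_sqrtAdjoin {S : Set ℤ} {a : ℤ} (ha : a ∈ S) {x : E} (hx : x ^ 2 = (a : E)) :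
    x ∈ sqrtAdjoin E S := IntermediateField.subset_adjoin _ _ ⟨a, ha, hx⟩

lemma sqrtAdjoin_empty : sqrtAdjoin E ∅ = ⊥ := by simp [sqrtAdjoin]

lemma sqrtAdjoin_le {S : Set ℤ} {K : IntermediateField ℚ_[2] E}
    (h : ∀ a ∈ S, ∃ x ∈ K, x ^ 2 = (a : E)) : sqrtAdjoin E S ≤ K := by
  apply IntermediateField.adjoin_le_iff.mpr
  rintro x ⟨a, ha, hx⟩
  obtain ⟨y, hy, hya⟩ := h a ha
  rw [← hya] at hx
  rcases sq_eq_sq_iff_eq_or_eq_neg.mp hx with rfl | rfl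
  · exact hy
  · exact K.neg_mem hy

lemma sqrtAdjoin_mono {S S' : Set ℤ} (h : S ⊆ S') : sqrtAdjoin E S ≤ sqrtAdjoin E S' :=
  IntermediateField.adjoin.mono _ _ _ fun _ ⟨a, ha, hx⟩ => ⟨a, h ha, hx⟩

lemma sq_mem_of_int {K : IntermediateField ℚ_[2] E} {v : E} {b : ℤ} (hv : v ^ 2 = (b : E)) :
    v ^ 2 ∈ K := by rw [hv]; exact intCast_mem K b

lemma sqrtAdjoin_insert {S : Set ℤ} {b : ℤ} {v : E} (hv : v ^ 2 = (b : E))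
    (hS : ∀ a ∈ S, ∃ x : E, x ^ 2 = (a : E)) :
    sqrtAdjoin E (insert b S) = quadExt (sqrtAdjoin E S) v (sq_mem_of_int hv) := by
  apply le_antisymm
  · apply sqrtAdjoin_le
    rintro a (rfl | ha)
    · exact ⟨v, self_mem_quadExt, hv⟩
    · obtain ⟨x, hx⟩ := hS a ha
      exact ⟨x, le_quadExt (mem_sqrtAdjoin ha hx), hx⟩
  · exact quadExt_le (sqrtAdjoin_mono (Set.subset_insert _ _))
      (mem_sqrtAdjoin (Set.mem_insert _ _) hv)

end SquareRoots

/-! ### Uniformizers and degrees of the subfields of `Ω`. -/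

/-- Dyadic data on an extension of `ℚ₂` generated by the three square roots. -/
structure DyadicField (E : Type*) [Field E] [Algebra ℚ_[2] E] extends DyadicData E where
  ext : ∀ x : ℚ_[2], N (algebraMap ℚ_[2] E x) = ‖x‖
  isom : ∀ (τ : E ≃ₐ[ℚ_[2]] E) (x : E), N (τ x) = N x
  gen : IntermediateField.adjoin ℚ_[2] {I, r, s} = ⊤

namespace DyadicField

variable {E : Type*} [Field E] [CharZero E] [Algebra ℚ_[2] E] (D : DyadicField E)

lemma bot_val (x : E) (hx : x ∈ (⊥ : IntermediateField ℚ_[2] E)) (h0 : x ≠ 0) :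
    ∃ n : ℤ, D.N x = D.N 2 ^ n := by
  obtain ⟨q, rfl⟩ := IntermediateField.mem_bot.mp hx
  have hq : q ≠ 0 := by rintro rfl; simp at h0
  refine ⟨q.valuation, ?_⟩
  rw [D.ext, Padic.norm_eq_zpow_neg_valuation hq, D.two]
  simp

lemma bot_res (x : E) (hx : x ∈ (⊥ : IntermediateField ℚ_[2] E)) (h1 : D.N x ≤ 1) :
    D.N x ≤ D.N 2 ∨ D.N (x - 1) ≤ D.N 2 := by
  obtain ⟨q, rfl⟩ := IntermediateField.mem_bot.mp hx
  rw [D.ext] at h1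
  have hsmall : ∀ y : ℤ_[2], y ∈ IsLocalRing.maximalIdeal ℤ_[2] → ‖(y : ℚ_[2])‖ ≤ 1 / 2 := by
    intro y hy
    rw [PadicInt.maximalIdeal_eq_span_p, ← pow_one ((2 : ℕ) : ℤ_[2]),
      ← PadicInt.norm_le_pow_iff_mem_span_pow] at hy
    simpa using hy
  obtain ⟨z, rfl⟩ : ∃ z : ℤ_[2], (z : ℚ_[2]) = q := ⟨⟨q, h1⟩, rfl⟩
  obtain ⟨n, hn, hq⟩ := PadicInt.exists_mem_range (p := 2) z
  have h := hsmall _ hq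
  rw [PadicInt.coe_sub, PadicInt.coe_natCast] at h
  rw [D.two]
  interval_cases n
  · left; rw [D.ext]; simpa using h
  · right
    have : algebraMap ℚ_[2] E z - 1 = algebraMap ℚ_[2] E ((z : ℚ_[2]) - 1) := by simp
    rw [this, D.ext]; simpa using h

lemma sqrt_neg_one : D.I ^ 2 = ((-1 : ℤ) : E) := by rw [D.hI]; simp
lemma sqrt_neg_three : D.r ^ 2 = ((-3 : ℤ) : E) := by rw [D.hr]; simp
lemma sqrt_two : D.s ^ 2 = ((2 : ℤ) : E) := by rw [D.hs]; simp
lemma sqrt_three : (D.I * D.r) ^ 2 = ((3 : ℤ) : E) := by rw [mul_pow, D.hI, D.hr]; simp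
lemma sqrt_neg_two : (D.I * D.s) ^ 2 = ((-2 : ℤ) : E) := by rw [mul_pow, D.hI, D.hs]; simp
lemma sqrt_six : (D.I * D.r * D.s) ^ 2 = ((6 : ℤ) : E) := by
  rw [mul_pow, mul_pow, D.hI, D.hr, D.hs]; norm_num
lemma sqrt_neg_six : (D.r * D.s) ^ 2 = ((-6 : ℤ) : E) := by
  rw [mul_pow, D.hr, D.hs]; norm_num

lemma eq_top {K : IntermediateField ℚ_[2] E} (hI : D.I ∈ K) (hr : D.r ∈ K) (hs : D.s ∈ K) :
    K = ⊤ := by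
  rw [eq_top_iff, ← D.gen]
  apply IntermediateField.adjoin_le_iff.mpr
  rintro x (rfl | rfl | rfl) <;> assumption

lemma exists_neg_three {x : E} (hx : x ∈ sqrtAdjoin E {-3}) :
    ∃ x₀ ∈ (⊥ : IntermediateField ℚ_[2] E), ∃ x₁ ∈ (⊥ : IntermediateField ℚ_[2] E),
      x = x₀ + x₁ * D.r := by
  have h : ({-3} : Set ℤ) = insert (-3) ∅ := by simp
  rw [h, sqrtAdjoin_insert D.sqrt_neg_three (by simp), sqrtAdjoin_empty] at hx
  exact hx

lemma unif_neg_three : D.Unif (sqrtAdjoin E {-3}).toSubfield 2 := by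
  apply DyadicData.unif_two (F := (⊥ : IntermediateField ℚ_[2] E).toSubfield)
  · exact D.bot_val
  · exact D.bot_res
  · intro x hx
    obtain ⟨x₀, h₀, x₁, h₁, rfl⟩ := D.exists_neg_three hx
    refine ⟨x₀ + x₁, add_mem h₀ h₁, 2 * x₁, mul_mem (ofNat_mem _ 2) h₁, ?_⟩
    rw [D.r_eq]; ring

lemma exists_insert_neg_three (D : DyadicField E) {b : ℤ} {v : E} (hv : v ^ 2 = (b : E)) {x : E}
    (hx : x ∈ sqrtAdjoin E {-3, b}) :
    ∃ x₀ ∈ sqrtAdjoin E {-3}, ∃ x₁ ∈ sqrtAdjoin E {-3}, x = x₀ + x₁ * v := by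
  rw [Set.pair_comm, sqrtAdjoin_insert hv] at hx
  · exact hx
  · rintro a rfl; exact ⟨_, D.sqrt_neg_three⟩

lemma unif_neg_three_two : D.Unif (sqrtAdjoin E {-3, 2}).toSubfield D.s :=
  D.unif_neg_three.quadratic (mem_sqrtAdjoin (by simp) D.sqrt_two)
    (fun _ hx => D.exists_insert_neg_three D.sqrt_two hx) D.N_two_eq.symm

lemma N_I_mul_s : D.N (D.I * D.s) = D.N D.s := by rw [map_mul, D.N_I, one_mul]

lemma unif_neg_three_neg_two : D.Unif (sqrtAdjoin E {-3, -2}).toSubfield (D.I * D.s) :=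
  D.unif_neg_three.quadratic (mem_sqrtAdjoin (by simp) D.sqrt_neg_two)
    (fun _ hx => D.exists_insert_neg_three D.sqrt_neg_two hx)
    (by rw [D.N_I_mul_s, D.N_two_eq])

lemma N_one_add_I : D.N (1 + D.I) = D.N D.s := by
  rw [← D.z_s, map_mul, D.N_z, one_mul]

lemma sqrtAdjoin_neg_one_three (D : DyadicField E) : sqrtAdjoin E {-1, 3} = sqrtAdjoin E {-3, -1} := by
  have hI := D.I_ne
  apply le_antisymm
  · apply sqrtAdjoin_le
    have h1 : D.I ∈ sqrtAdjoin E {-3, -1} := mem_sqrtAdjoin (by simp) D.sqrt_neg_one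
    have h2 : D.r ∈ sqrtAdjoin E {-3, -1} := mem_sqrtAdjoin (by simp) D.sqrt_neg_three
    rintro a (rfl | rfl)
    · exact ⟨_, h1, D.sqrt_neg_one⟩
    · exact ⟨_, mul_mem h1 h2, D.sqrt_three⟩
  · apply sqrtAdjoin_le
    have h1 : D.I ∈ sqrtAdjoin E {-1, 3} := mem_sqrtAdjoin (by simp) D.sqrt_neg_one
    have h2 : D.I * D.r ∈ sqrtAdjoin E {-1, 3} := mem_sqrtAdjoin (by simp) D.sqrt_three
    rintro a (rfl | rfl)
    · refine ⟨_, ?_, D.sqrt_neg_three⟩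
      have := div_mem h2 h1
      rwa [mul_div_cancel_left₀ _ hI] at this
    · exact ⟨_, h1, D.sqrt_neg_one⟩

lemma unif_neg_one_three : D.Unif (sqrtAdjoin E {-1, 3}).toSubfield (1 + D.I) := by
  refine D.unif_neg_three.quadratic (add_mem (one_mem _) (mem_sqrtAdjoin (by simp) D.sqrt_neg_one))
    ?_ (by rw [D.N_one_add_I, D.N_two_eq])
  intro x hx
  have hx : x ∈ sqrtAdjoin E {-1, 3} := hx
  rw [D.sqrtAdjoin_neg_one_three] at hx
  obtain ⟨x₀, h₀, x₁, h₁, rfl⟩ := D.exists_insert_neg_three D.sqrt_neg_one hx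
  exact ⟨x₀ - x₁, sub_mem h₀ h₁, x₁, h₁, by ring⟩

lemma top_eq : quadExt (sqrtAdjoin E {-3, 2}) D.I (sq_mem_of_int D.sqrt_neg_one) = ⊤ :=
  D.eq_top self_mem_quadExt (le_quadExt (mem_sqrtAdjoin (by simp) D.sqrt_neg_three))
    (le_quadExt (mem_sqrtAdjoin (by simp) D.sqrt_two))

lemma unif_top : D.Unif ⊤ D.p := by
  refine D.unif_neg_three_two.quadratic trivial ?_ D.N_p_sq
  intro x _
  have hx : x ∈ (⊤ : IntermediateField ℚ_[2] E) := trivial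
  rw [← D.top_eq] at hx
  obtain ⟨x₀, h₀, x₁, h₁, rfl⟩ := hx
  have hs : D.s ∈ sqrtAdjoin E {-3, 2} := mem_sqrtAdjoin (by simp) D.sqrt_two
  -- From `z * s = 1 + I` and `z = 1 + p` one gets `I = (s - 1) + s * p`.
  refine ⟨x₀ + x₁ * (D.s - 1), add_mem h₀ (mul_mem h₁ (sub_mem hs (one_mem _))), x₁ * D.s,
    mul_mem h₁ hs, ?_⟩
  rw [DyadicData.p]
  linear_combination -x₁ * D.z_s

/-- Otherwise `w` would be a dyadic integer that is congruent to neither 0 nor 1. -/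
lemma r_notMem_bot : D.r ∉ (⊥ : IntermediateField ℚ_[2] E) := by
  intro h
  have hw : D.w ∈ (⊥ : IntermediateField ℚ_[2] E) :=
    div_mem (add_mem (neg_mem (one_mem _)) h) (ofNat_mem _ 2)
  have h2 : D.N 2 < 1 := D.N_two_lt_s.trans D.N_s_lt
  rcases D.bot_res _ hw D.N_w.le with h | h
  · rw [D.N_w] at h; linarith
  · rw [D.N_w_sub_one] at h; linarith

lemma s_notMem : D.s ∉ sqrtAdjoin E {-3} := by
  intro h
  obtain ⟨n, hn⟩ := D.unif_neg_three.val _ h D.s_ne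
  rw [D.N_two_eq, ← zpow_natCast, ← zpow_mul] at hn
  have := zpow_right_injective₀ D.N_s_pos D.N_s_lt.ne (a₁ := 1) (a₂ := (2 : ℕ) * n) (by simpa using hn)
  omega

/-- Otherwise `p` would lie in a field whose valuations are integral multiples of that of `s`,
although `p` has half that valuation. -/
lemma I_notMem : D.I ∉ sqrtAdjoin E {-3, 2} := by
  intro h
  have hs : D.s ∈ sqrtAdjoin E {-3, 2} := mem_sqrtAdjoin (by simp) D.sqrt_two
  have hp : D.p ∈ sqrtAdjoin E {-3, 2} :=
    sub_mem (div_mem (add_mem (one_mem _) h) hs) (one_mem _)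
  obtain ⟨n, hn⟩ := D.unif_neg_three_two.val _ hp D.p_ne
  rw [← D.N_p_sq, ← zpow_natCast, ← zpow_mul] at hn
  have := zpow_right_injective₀ D.N_p_pos D.N_p_lt.ne (a₁ := 1) (a₂ := (2 : ℕ) * n) (by simpa using hn)
  omega

lemma finrank_eq_eight (D : DyadicField E) [FiniteDimensional ℚ_[2] E] : Module.finrank ℚ_[2] E = 8 := by
  have h : ({-3} : Set ℤ) = insert (-3) ∅ := by simp
  have h1 : Module.finrank ℚ_[2] (sqrtAdjoin E {-3}) = 2 := by
    rw [h, sqrtAdjoin_insert D.sqrt_neg_three (by simp), finrank_quadExt, sqrtAdjoin_empty]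
    · simp
    · rw [sqrtAdjoin_empty]; exact D.r_notMem_bot
  have h2 : Module.finrank ℚ_[2] (sqrtAdjoin E {-3, 2}) = 4 := by
    rw [Set.pair_comm, sqrtAdjoin_insert D.sqrt_two, finrank_quadExt _ _ _ D.s_notMem, h1]
    rintro a rfl; exact ⟨_, D.sqrt_neg_three⟩
  have h3 := finrank_quadExt _ _ (sq_mem_of_int D.sqrt_neg_one) D.I_notMem
  rw [D.top_eq, h2, IntermediateField.finrank_top'] at h3
  exact h3

end DyadicField

/-! ### The five label sets and solutions of the norm equation. -/

open DyadicData in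
/-- The labels of the forms defined over `ℚ₂(√-3)`. -/
def starIdx : Finset Idx := {fin₂ 0 0, inf₂ 0}
/-- The labels of the forms defined over `ℚ₂(√±2)` and `ℚ₂(√±6)`, except the central one. -/
def circIdx : Finset DyadicData.Idx :=
  {DyadicData.fin₂ 1 0, DyadicData.fin₂ 2 0, DyadicData.fin₂ 3 0}
/-- The labels of the forms defined over `ℚ₂(√-1)` and `ℚ₂(√3)`, except the central one. -/
def diamIdx : Finset DyadicData.Idx :=
  {DyadicData.fin₂ 1 1, DyadicData.fin₂ 2 2, DyadicData.fin₂ 3 3}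
/-- The labels of the forms first appearing over a quartic field not containing `√-3`. -/
def clubIdx : Finset DyadicData.Idx := {DyadicData.fin₁ 1, DyadicData.fin₁ 2, DyadicData.fin₁ 3}
/-- The label of the central form. -/
def spadeIdx : Finset DyadicData.Idx := {DyadicData.central}

/-- The norm of `1 + κ * w` from the unramified quadratic extension is `1 - κ + κ ^ 2`, which equals
`-1` for this root. It exists by Hensel's lemma at 0, where the derivative is `-1`. -/
lemma exists_padic_root : ∃ κ : ℤ_[2], κ ^ 2 - κ + 2 = 0 ∧ ‖κ‖ ≤ 1 / 2 := by
  have h2 : ‖(2 : ℤ_[2])‖ = 1 / 2 := by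
    have := PadicInt.norm_p (p := 2); simpa using this
  obtain ⟨z, hz, hz', -⟩ := hensels_lemma (p := 2) (R := ℤ_[2])
    (F := (Polynomial.X ^ 2 - Polynomial.X + 2 : Polynomial ℤ_[2])) (a := 0) (by
      simp [Polynomial.derivative_pow, h2]; norm_num)
  refine ⟨z, by simpa using hz, ?_⟩
  have e : z = z * z + 2 := by
    have : z ^ 2 - z + 2 = 0 := by simpa using hz
    linear_combination -this
  have hlt : ‖z‖ < 1 := by simpa [Polynomial.derivative_pow] using hz'
  -- Norms are powers of 2, so being less than 1 means being at most `2⁻¹`.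
  have := (PadicInt.norm_le_pow_iff_norm_lt_pow_add_one z (-1)).mpr (by simpa using hlt)
  simpa using this

namespace DyadicField

variable {E : Type*} [Field E] [CharZero E] [Algebra ℚ_[2] E] (D : DyadicField E)

open DyadicData

/-- The data needed for the descent of integral forms to `L`. -/
def HasDescent (L : IntermediateField ℚ_[2] E) (c : E) : Prop :=
  ∃ u ∈ L, D.N u = D.N D.s ∧ D.N (u / D.s - c) ≤ D.N D.s ∧ ∃ y : E, ∃ b : Fin 4, b ≠ 0 ∧
    D.N (y - D.rep b) ≤ D.N D.s ∧ ∀ τ : E ≃ₐ[ℚ_[2]] E, (∀ x ∈ L, τ x = x) →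
      (τ D.r = D.r ∧ τ y = y) ∨ (τ D.r = -D.r ∧ y * τ y = -(3 * u ^ 2 / 2))

lemma mem_of_fixed [FiniteDimensional ℚ_[2] E] [IsGalois ℚ_[2] E]
    {L : IntermediateField ℚ_[2] E} {x : E}
    (h : ∀ τ : E ≃ₐ[ℚ_[2]] E, (∀ x ∈ L, τ x = x) → τ x = x) : x ∈ L := by
  rw [← IsGalois.fixedField_fixingSubgroup L, IntermediateField.mem_fixedField_iff]
  intro τ hτ
  exact h τ ((IntermediateField.mem_fixingSubgroup_iff L τ).mp hτ)

variable {D} in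
lemma HasDescent.defOver [FiniteDimensional ℚ_[2] E] [IsGalois ℚ_[2] E]
    {L : IntermediateField ℚ_[2] E} {c : E} (hL : D.HasDescent L c) {P : E} (hP : P ∈ L)
    (hP0 : P ≠ 0) (hP1 : D.N P ≤ 1) (hPs : D.N D.s ≤ D.N P) {a : Fin 4} (ha : a ≠ 0) :
    D.DefOver L.toSubfield (V P (c * D.rep a)) := by
  obtain ⟨u, hu, h1, h2, y, b, hb, h3, h4⟩ := hL
  refine defOver_of_descent_of_close
    (Γ := {σ | ∃ τ : E ≃ₐ[ℚ_[2]] E, (∀ x ∈ L, τ x = x) ∧ σ = (τ : E →+* E)}) ?_ hP0 hP1 hPs ?_ h1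
    ?_ ?_ hb h3 h2 ha
  · intro x hx
    exact mem_of_fixed fun τ hτ => hx _ ⟨τ, hτ, rfl⟩
  · rintro _ ⟨τ, hτ, rfl⟩
    exact hτ P hP
  · rintro _ ⟨τ, hτ, rfl⟩
    exact hτ u hu
  · rintro _ ⟨τ, hτ, rfl⟩
    exact h4 τ hτ

variable {D} in
-- With `P = 1` the off-diagonal parameter is irrelevant as long as it is integral.
lemma HasDescent.central [FiniteDimensional ℚ_[2] E] [IsGalois ℚ_[2] E]
    {L : IntermediateField ℚ_[2] E} {c : E} (hL : D.HasDescent L c) (hc : D.N c ≤ 1) :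
    D.DefOver L.toSubfield (D.M DyadicData.central) := by
  refine (hL.defOver (one_mem _) one_ne_zero (by simp) (by simpa using D.N_s_lt.le)
    (one_ne_zero)).of_eqv (eqv_V one_ne_zero rfl ?_)
  simpa [rep] using hc

variable {D} in
-- Here `P = u`, of the norm of `p ^ 2`. For `c = 1` the second digit is 0; for `c = z = 1 + p` it
-- equals the first.
lemma HasDescent.fin₂ [FiniteDimensional ℚ_[2] E] [IsGalois ℚ_[2] E]
    {L : IntermediateField ℚ_[2] E} {c : E} (hL : D.HasDescent L c) {a b : Fin 4} (ha : a ≠ 0)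
    (hab : D.rep a + D.p * D.rep b = c * D.rep a) :
    D.DefOver L.toSubfield (D.M (DyadicData.fin₂ a b)) := by
  obtain ⟨u, hu, h1, -⟩ := id hL
  have hu0 : u ≠ 0 := D.ne_zero_of_N D.N_s_pos h1
  refine (hL.defOver hu hu0 (by rw [h1]; exact D.N_s_lt.le) h1.ge ha).of_eqv ?_
  exact eqv_V hu0 (by rw [h1, N_p_sq']) (by rw [hab]; simp [D.N.nonneg])

variable {D} in
-- Distance one requires an element of `L` with the valuation of `p`, so these forms enter only over
-- totally ramified quartic fields.
lemma HasDescent.fin₁ [FiniteDimensional ℚ_[2] E] [IsGalois ℚ_[2] E]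
    {L : IntermediateField ℚ_[2] E} (hL : D.HasDescent L 1) {P : E} (hP : P ∈ L)
    (hPN : D.N P = D.N D.p) {a : Fin 4} (ha : a ≠ 0) :
    D.DefOver L.toSubfield (D.M (DyadicData.fin₁ a)) := by
  have hP0 : P ≠ 0 := D.ne_zero_of_N D.N_p_pos hPN
  refine (hL.defOver hP hP0 (hPN.trans_le D.N_p_le) (by rw [hPN]; exact D.N_s_lt_p.le) ha).of_eqv ?_
  exact eqv_V hP0 hPN (by simp [D.N.nonneg])

lemma N_r_sub_one : D.N (D.r - 1) ≤ D.N 2 := by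
  rw [D.r_eq, add_sub_cancel_right]; exact D.mul_le' le_rfl D.N_w.le

lemma map_w_of_r {τ : E ≃ₐ[ℚ_[2]] E} (h : τ D.r = D.r) : τ D.w = D.w := by
  rw [DyadicData.w, map_div₀, map_add, map_neg, map_one, h, map_ofNat]

lemma map_w_of_neg_r {τ : E ≃ₐ[ℚ_[2]] E} (h : τ D.r = -D.r) : τ D.w = D.w ^ 2 :=
  (Conj.mk (τ := (τ : E →+* E)) (D.isom τ) h).map_w

lemma map_r_cases (τ : E ≃ₐ[ℚ_[2]] E) : τ D.r = D.r ∨ τ D.r = -D.r :=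
  sq_root_map (τ : E →+* E) D.sqrt_neg_three

/-- A unit of norm `-1` from the unramified quadratic extension, close to one. -/
lemma exists_norm_neg_one : ∃ ν : E, D.N (ν - 1) ≤ D.N 2 ∧ ∀ τ : E ≃ₐ[ℚ_[2]] E,
    (τ D.r = D.r → τ ν = ν) ∧ (τ D.r = -D.r → ν * τ ν = -1) := by
  obtain ⟨κ, hκ, hκ2⟩ := exists_padic_root
  have hk : (algebraMap ℚ_[2] E κ) ^ 2 - algebraMap ℚ_[2] E κ + 2 = 0 := by
    have h : (κ : ℚ_[2]) ^ 2 - κ + 2 = 0 := by exact_mod_cast congrArg ((↑) : ℤ_[2] → ℚ_[2]) hκ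
    simpa only [map_add, map_sub, map_pow, map_ofNat, map_zero] using
      congrArg (algebraMap ℚ_[2] E) h
  refine ⟨1 + algebraMap ℚ_[2] E κ * D.w, ?_, fun τ => ⟨fun h => ?_, fun h => ?_⟩⟩
  · rw [add_sub_cancel_left]
    refine D.mul_le' ?_ D.N_w.le
    rw [D.ext, D.two]; exact hκ2
  · simp [D.map_w_of_r h]
  · simp only [map_add, map_one, map_mul, AlgEquiv.commutes, D.map_w_of_neg_r h]
    linear_combination hk + algebraMap ℚ_[2] E κ * D.w_sq + (algebraMap ℚ_[2] E κ) ^ 2 * D.w_cube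

lemma N_two_le_s : D.N 2 ≤ D.N D.s := D.N_two_lt_s.le

lemma N_mul_sub_one {x y : E} {c : ℝ} (hc : c < 1) (hx : D.N (x - 1) ≤ c) (hy : D.N (y - 1) ≤ c) :
    D.N (x * y - 1) ≤ c := by
  have hx1 : D.N x ≤ 1 := by
    have := D.add_le (hx.trans hc.le) (y := 1) (by simp)
    simpa using this
  have : x * y - 1 = x * (y - 1) + (x - 1) := by ring
  rw [this]; exact D.add_le (D.mul_le hx1 hy) hx

lemma N_two_lt_one : D.N 2 < 1 := D.N_two_lt_s.trans D.N_s_lt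

lemma N_three_sub_one : D.N (3 - 1) ≤ D.N 2 := by norm_num

/-- With `u² = 2` the required norm is `-3`, which is the norm 3 of `r` times the norm `-1` of `ν`.
-/
lemma hasDescent_two {L : IntermediateField ℚ_[2] E} (h : D.s ∈ L) : D.HasDescent L 1 := by
  have hs := D.s_ne
  obtain ⟨ν, hν, hντ⟩ := D.exists_norm_neg_one
  refine ⟨D.s, h, rfl, by rw [div_self hs]; simp [D.N_s_pos.le], D.r * ν, 1, by simp, ?_, ?_⟩
  · exact (D.N_mul_sub_one D.N_two_lt_one D.N_r_sub_one hν).trans D.N_two_le_s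
  · intro τ hτ
    refine (D.map_r_cases τ).imp (fun h => ⟨h, ?_⟩) (fun h => ⟨h, ?_⟩)
    · rw [map_mul, h, (hντ τ).1 h]
    · rw [map_mul, h, D.hs]
      linear_combination -D.r ^ 2 * (hντ τ).2 h + D.hr

/-- With `u² = -2` the required norm is 3, the norm of `r`. -/
lemma hasDescent_neg_two {L : IntermediateField ℚ_[2] E} (h : D.I * D.s ∈ L) :
    D.HasDescent L 1 := by
  have hs := D.s_ne
  refine ⟨D.I * D.s, h, D.N_I_mul_s, by rw [mul_div_cancel_right₀ _ hs]; exact D.N_I_sub_one.le,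
    D.r, 1, by simp, D.N_r_sub_one.trans D.N_two_le_s, ?_⟩
  intro τ hτ
  refine (D.map_r_cases τ).imp (fun h => ⟨h, h⟩) (fun h => ⟨h, ?_⟩)
  rw [h, D.sqrt_neg_two]; push_cast; linear_combination -D.hr

/-- With `u² = -6` the required norm is 9, the norm of 3. -/
lemma hasDescent_neg_six {L : IntermediateField ℚ_[2] E} (h : D.r * D.s ∈ L) :
    D.HasDescent L 1 := by
  have hs := D.s_ne
  refine ⟨D.r * D.s, h, by rw [map_mul, D.N_r, one_mul],
    by rw [mul_div_cancel_right₀ _ hs]; exact D.N_r_sub_one.trans D.N_two_le_s,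
    3, 1, by simp, D.N_three_sub_one.trans D.N_two_le_s, ?_⟩
  intro τ hτ
  have h3 : τ 3 = 3 := map_ofNat τ 3
  refine (D.map_r_cases τ).imp (fun h => ⟨h, h3⟩) (fun h => ⟨h, ?_⟩)
  rw [h3, D.sqrt_neg_six]; push_cast; norm_num

lemma N_I_mul_r_sub_one : D.N (D.I * D.r - 1) ≤ D.N D.s :=
  D.N_mul_sub_one D.N_s_lt D.N_I_sub_one.le (D.N_r_sub_one.trans D.N_two_le_s)

lemma N_I_mul_r : D.N (D.I * D.r) = 1 := by rw [map_mul, D.N_I, D.N_r, one_mul]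

/-- With `u² = 6` the required norm is `-9`, the norm of `3 * ν`. -/
lemma hasDescent_six {L : IntermediateField ℚ_[2] E} (h : D.I * D.r * D.s ∈ L) :
    D.HasDescent L 1 := by
  have hs := D.s_ne
  obtain ⟨ν, hν, hντ⟩ := D.exists_norm_neg_one
  refine ⟨D.I * D.r * D.s, h, by rw [map_mul, D.N_I_mul_r, one_mul],
    by rw [mul_div_cancel_right₀ _ hs]; exact D.N_I_mul_r_sub_one, 3 * ν, 1, by simp, ?_, ?_⟩
  · exact (D.N_mul_sub_one D.N_two_lt_one D.N_three_sub_one hν).trans D.N_two_le_s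
  · intro τ hτ
    have h3 : τ 3 = 3 := map_ofNat τ 3
    refine (D.map_r_cases τ).imp (fun h => ⟨h, ?_⟩) (fun h => ⟨h, ?_⟩)
    · rw [map_mul, h3, (hντ τ).1 h]
    · rw [map_mul, h3, D.sqrt_six]; push_cast
      linear_combination 9 * (hντ τ).2 h

/-- With `u = 1 + I` the required norm is `-3 * I`. The factors `r`, `I` and `I - w` of `y` have
norms `3`, `I² = -1` and `I² + I + 1 = I`. -/
lemma hasDescent_neg_one {L : IntermediateField ℚ_[2] E} (h : D.I ∈ L) : D.HasDescent L D.z := by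
  have hs := D.s_ne
  refine ⟨1 + D.I, add_mem (one_mem _) h, D.N_one_add_I, by rw [DyadicData.z]; simp [D.N_s_pos.le],
    D.r * D.I * (D.I - D.w), 3, by simp, ?_, ?_⟩
  · have h2 := D.N_two_le_s
    have e : D.r * D.I * (D.I - D.w) - D.rep 3 =
        2 * (-D.w * (1 + D.w * D.I)) - D.w * (D.I - 1) := by
      simp only [rep, D.r_eq]; simp
      linear_combination (2 * D.w + 1) * D.hI + (- D.w ^ 0) * D.w_sq
    rw [e]
    refine D.sub_le (D.mul_le' h2 ?_) (D.mul_le D.N_w.le D.N_I_sub_one.le)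
    exact D.mul_le (by rw [D.N.map_neg]; exact D.N_w.le)
      (D.add_le (by simp) (D.mul_le D.N_w.le D.N_I.le))
  · intro τ hτ
    have hI : τ D.I = D.I := hτ _ h
    refine (D.map_r_cases τ).imp (fun h => ⟨h, ?_⟩) (fun h => ⟨h, ?_⟩)
    · rw [map_mul, map_mul, map_sub, h, hI, D.map_w_of_r h]
    · rw [map_mul, map_mul, map_sub, h, hI, D.map_w_of_neg_r h]
      linear_combination (-D.I ^ 2 * (D.I - D.w) * (D.I - D.w ^ 2)) * D.hr
        + 3 * (D.I - D.w) * (D.I - D.w ^ 2) * D.hI + 3 * D.I * D.w_sq - 3 / 2 * D.hI - 3 * D.w_cube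

/-- Write `q = I * r`, a square root of 3. With `u = 1 + q` the required norm is `-3 * (2 + q)`; the
last factor of `y` has norm `2 + q` because `(1 - w) * (1 - w²) = 3`, and `r * ν` has norm `-3`. -/
lemma hasDescent_three {L : IntermediateField ℚ_[2] E} (h : D.I * D.r ∈ L) :
    D.HasDescent L D.z := by
  have hs := D.s_ne
  have h3 : D.N ((3 : E)⁻¹) = 1 := by rw [map_inv₀, D.N_three, inv_one]
  obtain ⟨ν, hν, hντ⟩ := D.exists_norm_neg_one
  have hc : D.N ((1 - D.w) * (3 + D.I * D.r) * 3⁻¹) ≤ D.N D.s := by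
    refine D.mul_le' ?_ h3.le
    refine D.mul_le ?_ ?_
    · rw [D.N.map_sub]; exact D.N_w_sub_one.le
    · have : 3 + D.I * D.r = 2 * 2 + (D.I * D.r - 1) := by ring
      rw [this]
      exact D.add_le (D.mul_le D.N_two_lt_one.le D.N_two_le_s) D.N_I_mul_r_sub_one
  refine ⟨1 + D.I * D.r, add_mem (one_mem _) h, ?_, ?_,
    D.r * ν * (1 + (1 - D.w) * (D.I * D.r) * 3⁻¹), 2, by simp, ?_, ?_⟩
  · have e : 1 + D.I * D.r = D.z * D.s + 2 * (D.I * D.w) := by rw [D.z_s, D.r_eq]; ring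
    have hz : D.N (D.z * D.s) = D.N D.s := by rw [map_mul, D.N_z, one_mul]
    rw [e, D.add_eq_left, hz]
    rw [hz]; simp only [map_mul, D.N_I, D.N_w, mul_one]; exact D.N_two_lt_s
  · have e : (1 + D.I * D.r) / D.s - D.z = D.s * (D.I * D.w) := by
      rw [DyadicData.z, ← sub_div, div_eq_iff hs, D.r_eq]; linear_combination -(D.I * D.w) * D.hs
    rw [e]; simp [D.N_I, D.N_w]
  · have e : D.r * ν * (1 + (1 - D.w) * (D.I * D.r) * 3⁻¹) - D.rep 2 =
        (D.r * ν - 1) * ((1 - D.w) * (3 + D.I * D.r) * 3⁻¹ + D.w) +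
          (1 - D.w) * (3 + D.I * D.r) * 3⁻¹ := by
      simp only [rep]; simp
      have : (3 : E) ≠ 0 := D.three_ne
      field_simp; ring
    rw [e]
    refine D.add_le (D.mul_le' ?_ ?_) hc
    · exact (D.N_mul_sub_one D.N_two_lt_one D.N_r_sub_one hν).trans D.N_two_le_s
    · exact D.add_le (hc.trans D.N_s_lt.le) D.N_w.le
  · intro τ hτ
    have hI : τ D.I * τ D.r = D.I * D.r := by rw [← map_mul]; exact hτ _ h
    have h3' : τ 3 = 3 := map_ofNat τ 3
    refine (D.map_r_cases τ).imp (fun h => ⟨h, ?_⟩) (fun h => ⟨h, ?_⟩)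
    · simp only [map_mul, map_add, map_sub, map_inv₀, map_one, h3', D.map_w_of_r h, (hντ τ).1 h]
      rw [hI, h]
    · simp only [map_mul, map_add, map_sub, map_inv₀, map_one, h3', D.map_w_of_neg_r h]
      rw [hI, h]
      have hq : (D.I * D.r) ^ 2 = 3 := by rw [D.sqrt_three]; simp
      have hn := (hντ τ).2 h
      have hw := D.w_sq
      have hr := D.hr
      have hw3 := D.w_cube
      generalize D.I * D.r = q at *
      calc D.r * ν * (1 + (1 - D.w) * q * 3⁻¹) * (-D.r * τ ν * (1 + (1 - D.w ^ 2) * q * 3⁻¹))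
          = -(D.r ^ 2) * (ν * τ ν) * (1 + (2 - D.w - D.w ^ 2) * q * 3⁻¹ +
            (1 - D.w - D.w ^ 2 + D.w ^ 3) * q ^ 2 * 3⁻¹ * 3⁻¹) := by ring
        _ = -(3 * (1 + q) ^ 2 / 2) := by
          rw [hr, hn, hw3, hw]
          linear_combination (3 / 2 - 1) * hq

end DyadicField

/-! ### The table of fields of definition. -/

namespace DyadicField

variable {E : Type*} [Field E] [CharZero E] [Algebra ℚ_[2] E] (D : DyadicField E)

open DyadicData

lemma finrank_sqrtAdjoin_pair_le [FiniteDimensional ℚ_[2] E] {a b : ℤ} {x y : E}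
    (hx : x ^ 2 = (a : E)) (hy : y ^ 2 = (b : E)) :
    Module.finrank ℚ_[2] (sqrtAdjoin E {a, b}) ≤ 4 := by
  have hb : ∀ c ∈ ({b} : Set ℤ), ∃ v : E, v ^ 2 = (c : E) := by rintro c rfl; exact ⟨y, hy⟩
  have h1 := finrank_quadExt_le (sqrtAdjoin E {b}) x (sq_mem_of_int hx)
  rw [← sqrtAdjoin_insert hx hb] at h1
  have h2 := finrank_quadExt_le (sqrtAdjoin E ∅) y (sq_mem_of_int hy)
  rw [← sqrtAdjoin_insert hy (by simp), sqrtAdjoin_empty, insert_empty_eq,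
    IntermediateField.finrank_bot] at h2
  omega

lemma r_notMem_of_finrank [FiniteDimensional ℚ_[2] E] {L : IntermediateField ℚ_[2] E}
    (hL : Module.finrank ℚ_[2] L ≤ 4) (h : D.r ∈ L → D.I ∈ L ∧ D.s ∈ L) : D.r ∉ L := by
  intro hr
  have htop := D.eq_top (h hr).1 hr (h hr).2
  rw [htop, IntermediateField.finrank_top', D.finrank_eq_eight] at hL
  omega

lemma I_mem_of {L : IntermediateField ℚ_[2] E} (hr : D.r ∈ L) (h : D.I * D.r ∈ L) : D.I ∈ L := by
  have := div_mem h hr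
  rwa [mul_div_cancel_right₀ _ D.r_ne] at this

lemma s_mem_of {L : IntermediateField ℚ_[2] E} (hI : D.I ∈ L) (h : D.I * D.s ∈ L) : D.s ∈ L := by
  have := div_mem h hI
  rwa [mul_div_cancel_left₀ _ D.I_ne] at this

section Degrees

variable [FiniteDimensional ℚ_[2] E]

lemma r_notMem_neg_one_two : D.r ∉ sqrtAdjoin E {-1, 2} :=
  D.r_notMem_of_finrank (finrank_sqrtAdjoin_pair_le D.sqrt_neg_one D.sqrt_two) fun _ =>
    ⟨mem_sqrtAdjoin (by simp) D.sqrt_neg_one, mem_sqrtAdjoin (by simp) D.sqrt_two⟩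

lemma r_notMem_neg_one_six : D.r ∉ sqrtAdjoin E {-1, 6} := by
  refine D.r_notMem_of_finrank (finrank_sqrtAdjoin_pair_le D.sqrt_neg_one D.sqrt_six) fun hr => ?_
  have hI : D.I ∈ sqrtAdjoin E {-1, 6} := mem_sqrtAdjoin (by simp) D.sqrt_neg_one
  have h6 : D.I * D.r * D.s ∈ sqrtAdjoin E {-1, 6} := mem_sqrtAdjoin (by simp) D.sqrt_six
  rw [mul_assoc, mul_left_comm] at h6
  exact ⟨hI, D.s_mem_of hI <| by
    have := div_mem h6 hr
    rwa [mul_div_cancel_left₀ _ D.r_ne] at this⟩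

lemma r_notMem_three_two : D.r ∉ sqrtAdjoin E {3, 2} :=
  D.r_notMem_of_finrank (finrank_sqrtAdjoin_pair_le D.sqrt_three D.sqrt_two) fun hr =>
    ⟨D.I_mem_of hr (mem_sqrtAdjoin (by simp) D.sqrt_three), mem_sqrtAdjoin (by simp) D.sqrt_two⟩

lemma r_notMem_three_neg_two : D.r ∉ sqrtAdjoin E {3, -2} := by
  refine D.r_notMem_of_finrank (finrank_sqrtAdjoin_pair_le D.sqrt_three D.sqrt_neg_two) fun hr => ?_
  have hI := D.I_mem_of hr (mem_sqrtAdjoin (by simp) D.sqrt_three)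
  exact ⟨hI, D.s_mem_of hI (mem_sqrtAdjoin (by simp) D.sqrt_neg_two)⟩

end Degrees

variable [FiniteDimensional ℚ_[2] E] [IsGalois ℚ_[2] E]

lemma exists_conj_of_r_notMem {L : IntermediateField ℚ_[2] E} (h : D.r ∉ L) :
    ∃ τ : E ≃ₐ[ℚ_[2]] E, (∀ x ∈ L, τ x = x) ∧ τ D.r = -D.r := by
  by_contra! h'
  exact h (mem_of_fixed fun τ hτ => (D.map_r_cases τ).resolve_right (h' τ hτ))

lemma mem_of_r_notMem {L : IntermediateField ℚ_[2] E} (h : D.r ∉ L) {i : Idx}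
    (hi : D.DefOver L.toSubfield (D.M i)) :
    i ∈ circIdx ∪ diamIdx ∪ clubIdx ∪ spadeIdx := by
  obtain ⟨τ, hτ, hr⟩ := D.exists_conj_of_r_notMem h
  rcases hi.M_cases_of_conj (τ := (τ : E →+* E)) ⟨D.isom τ, hr⟩ hτ with
    rfl | ⟨a, ha, rfl⟩ | ⟨a, ha, rfl | rfl⟩
  · decide
  all_goals clear hi; revert ha; revert a; decide

lemma defOver_neg_three_iff (i : Idx) :
    D.DefOver (sqrtAdjoin E {-3}).toSubfield (D.M i) ↔ i ∈ starIdx := by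
  rw [defOver_M_iff_of_unif_two D.unif_neg_three (mem_sqrtAdjoin (by simp) D.sqrt_neg_three)]
  simp [starIdx]

lemma mem_of_neg_three_two (i : Idx) : (i = central ∨ i = inf₂ 0 ∨ ∃ a, i = fin₂ a 0) ↔
    i ∈ starIdx ∪ circIdx ∪ spadeIdx := by
  simp only [Fin.exists_fin_succ, starIdx, circIdx, spadeIdx, Finset.mem_union, Finset.mem_insert,
    Finset.mem_singleton]
  simp
  tauto

lemma mem_of_neg_one_three (i : Idx) : (i = central ∨ i = inf₂ 0 ∨ ∃ a, i = fin₂ a a) ↔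
    i ∈ starIdx ∪ diamIdx ∪ spadeIdx := by
  simp only [Fin.exists_fin_succ, starIdx, diamIdx, spadeIdx, Finset.mem_union, Finset.mem_insert,
    Finset.mem_singleton]
  simp
  tauto

lemma defOver_neg_three_two_iff (i : Idx) :
    D.DefOver (sqrtAdjoin E {-3, 2}).toSubfield (D.M i) ↔ i ∈ starIdx ∪ circIdx ∪ spadeIdx := by
  rw [← mem_of_neg_three_two]
  refine defOver_M_iff (c := 1) D.unif_neg_three_two rfl
    (mem_sqrtAdjoin (by simp) D.sqrt_neg_three) ?_ (f := fun a => fin₂ a 0) ?_ i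
  · rw [div_self D.s_ne]; simp [D.N_s_pos.le]
  · intro a; simp [M, rep]

lemma defOver_neg_three_neg_two_iff (i : Idx) :
    D.DefOver (sqrtAdjoin E {-3, -2}).toSubfield (D.M i) ↔ i ∈ starIdx ∪ circIdx ∪ spadeIdx := by
  rw [← mem_of_neg_three_two]
  refine defOver_M_iff (c := 1) D.unif_neg_three_neg_two D.N_I_mul_s
    (mem_sqrtAdjoin (by simp) D.sqrt_neg_three) ?_ (f := fun a => fin₂ a 0) ?_ i
  · rw [mul_div_cancel_right₀ _ D.s_ne]; exact D.N_I_sub_one.le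
  · intro a; simp [M, rep]

lemma r_mem_neg_one_three : D.r ∈ sqrtAdjoin E {-1, 3} := by
  rw [D.sqrtAdjoin_neg_one_three]
  exact mem_sqrtAdjoin (by simp) D.sqrt_neg_three

lemma defOver_neg_one_three_iff (i : Idx) :
    D.DefOver (sqrtAdjoin E {-1, 3}).toSubfield (D.M i) ↔ i ∈ starIdx ∪ diamIdx ∪ spadeIdx := by
  rw [← mem_of_neg_one_three]
  refine defOver_M_iff (c := D.z) D.unif_neg_one_three D.N_one_add_I D.r_mem_neg_one_three ?_
    (f := fun a => fin₂ a a) ?_ i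
  · rw [DyadicData.z]; simp [D.N_s_pos.le]
  · intro a
    have : D.z = 1 + D.p := by rw [DyadicData.p]; ring
    simp [M, this, add_mul]

section Descent

variable {D} {L : IntermediateField ℚ_[2] E}

lemma HasDescent.spade {c : E} (hL : D.HasDescent L c) (hc : D.N c ≤ 1) {i : Idx}
    (hi : i ∈ spadeIdx) : D.DefOver L.toSubfield (D.M i) := by
  obtain rfl : i = DyadicData.central := by simpa [spadeIdx] using hi
  exact hL.central hc

lemma HasDescent.circ (hL : D.HasDescent L 1) {i : Idx} (hi : i ∈ circIdx) :
    D.DefOver L.toSubfield (D.M i) := by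
  simp only [circIdx, Finset.mem_insert, Finset.mem_singleton] at hi
  rcases hi with rfl | rfl | rfl <;> exact hL.fin₂ (by decide) (by simp [rep])

lemma HasDescent.diam (hL : D.HasDescent L D.z) {i : Idx} (hi : i ∈ diamIdx) :
    D.DefOver L.toSubfield (D.M i) := by
  simp only [diamIdx, Finset.mem_insert, Finset.mem_singleton] at hi
  rcases hi with rfl | rfl | rfl <;>
    exact hL.fin₂ (by decide) (by rw [DyadicData.p]; ring)

lemma HasDescent.club (hL : D.HasDescent L 1) {P : E} (hP : P ∈ L) (hPN : D.N P = D.N D.p) {i : Idx}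
    (hi : i ∈ clubIdx) : D.DefOver L.toSubfield (D.M i) := by
  simp only [clubIdx, Finset.mem_insert, Finset.mem_singleton] at hi
  rcases hi with rfl | rfl | rfl <;> exact hL.fin₁ hP hPN (by decide)

/-- The bound for fields without `√-3` and the list for the larger field `L'` meet in exactly the
forms supplied by descent. -/
lemma defOver_iff_of_diam {L L' : IntermediateField ℚ_[2] E} (hr : D.r ∉ L) (hLL : L ≤ L')
    (hd : D.HasDescent L D.z)
    (hL' : ∀ i, D.DefOver L'.toSubfield (D.M i) ↔ i ∈ starIdx ∪ diamIdx ∪ spadeIdx) (i : Idx) :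
    D.DefOver L.toSubfield (D.M i) ↔ i ∈ diamIdx ∪ spadeIdx := by
  constructor
  · intro h
    have h1 := D.mem_of_r_notMem hr h
    have h2 := (hL' i).mp (h.mono hLL)
    clear h
    revert i; decide
  · intro h
    rcases Finset.mem_union.mp h with h | h
    · exact hd.diam h
    · exact hd.spade D.N_z.le h

lemma defOver_iff_of_circ {L L' : IntermediateField ℚ_[2] E} (hr : D.r ∉ L) (hLL : L ≤ L')
    (hd : D.HasDescent L 1)
    (hL' : ∀ i, D.DefOver L'.toSubfield (D.M i) ↔ i ∈ starIdx ∪ circIdx ∪ spadeIdx) (i : Idx) :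
    D.DefOver L.toSubfield (D.M i) ↔ i ∈ circIdx ∪ spadeIdx := by
  constructor
  · intro h
    have h1 := D.mem_of_r_notMem hr h
    have h2 := (hL' i).mp (h.mono hLL)
    clear h
    revert i; decide
  · intro h
    rcases Finset.mem_union.mp h with h | h
    · exact hd.circ h
    · exact hd.spade (by simp) h

/-- The four fields of this kind contain square roots of both types, so descent with `c = 1` and
with `c = z` attains the whole upper bound. -/
lemma defOver_iff_of_club {L : IntermediateField ℚ_[2] E} (hr : D.r ∉ L)
    (hz : D.HasDescent L D.z) (h1 : D.HasDescent L 1) {P : E} (hP : P ∈ L)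
    (hPN : D.N P = D.N D.p) (i : Idx) :
    D.DefOver L.toSubfield (D.M i) ↔ i ∈ circIdx ∪ diamIdx ∪ clubIdx ∪ spadeIdx := by
  refine ⟨D.mem_of_r_notMem hr, fun h => ?_⟩
  simp only [Finset.mem_union] at h
  rcases h with ((h | h) | h) | h
  · exact h1.circ h
  · exact hz.diam h
  · exact h1.club hP hPN h
  · exact h1.spade (by simp) h

end Descent

lemma defOver_neg_one_iff (i : Idx) :
    D.DefOver (sqrtAdjoin E {-1}).toSubfield (D.M i) ↔ i ∈ diamIdx ∪ spadeIdx :=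
  defOver_iff_of_diam (fun h => D.r_notMem_neg_one_two (sqrtAdjoin_mono (by simp) h))
    (sqrtAdjoin_mono (by simp)) (D.hasDescent_neg_one (mem_sqrtAdjoin (by simp) D.sqrt_neg_one))
    D.defOver_neg_one_three_iff i

lemma defOver_three_iff (i : Idx) :
    D.DefOver (sqrtAdjoin E {3}).toSubfield (D.M i) ↔ i ∈ diamIdx ∪ spadeIdx :=
  defOver_iff_of_diam (fun h => D.r_notMem_three_two (sqrtAdjoin_mono (by simp) h))
    (sqrtAdjoin_mono (by simp)) (D.hasDescent_three (mem_sqrtAdjoin (by simp) D.sqrt_three))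
    D.defOver_neg_one_three_iff i

lemma defOver_two_iff (i : Idx) :
    D.DefOver (sqrtAdjoin E {2}).toSubfield (D.M i) ↔ i ∈ circIdx ∪ spadeIdx :=
  defOver_iff_of_circ (fun h => D.r_notMem_neg_one_two (sqrtAdjoin_mono (by simp) h))
    (sqrtAdjoin_mono (by simp)) (D.hasDescent_two (mem_sqrtAdjoin (by simp) D.sqrt_two))
    D.defOver_neg_three_two_iff i

lemma defOver_neg_two_iff (i : Idx) :
    D.DefOver (sqrtAdjoin E {-2}).toSubfield (D.M i) ↔ i ∈ circIdx ∪ spadeIdx :=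
  defOver_iff_of_circ (fun h => D.r_notMem_three_neg_two (sqrtAdjoin_mono (by simp) h))
    (sqrtAdjoin_mono (by simp)) (D.hasDescent_neg_two (mem_sqrtAdjoin (by simp) D.sqrt_neg_two))
    D.defOver_neg_three_neg_two_iff i

lemma sqrtAdjoin_singleton_le {a : ℤ} {x : E} (hx : x ^ 2 = (a : E))
    {L : IntermediateField ℚ_[2] E} (h : x ∈ L) : sqrtAdjoin E {a} ≤ L :=
  sqrtAdjoin_le (by rintro b rfl; exact ⟨x, h, hx⟩)

lemma defOver_six_iff (i : Idx) :
    D.DefOver (sqrtAdjoin E {6}).toSubfield (D.M i) ↔ i ∈ circIdx ∪ spadeIdx := by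
  refine defOver_iff_of_circ (fun h => D.r_notMem_neg_one_six (sqrtAdjoin_mono (by simp) h))
    (sqrtAdjoin_singleton_le D.sqrt_six ?_)
    (D.hasDescent_six (mem_sqrtAdjoin (by simp) D.sqrt_six)) D.defOver_neg_three_neg_two_iff i
  rw [mul_right_comm]
  exact mul_mem (mem_sqrtAdjoin (by simp) D.sqrt_neg_two)
    (mem_sqrtAdjoin (by simp) D.sqrt_neg_three)

lemma defOver_neg_six_iff (i : Idx) :
    D.DefOver (sqrtAdjoin E {-6}).toSubfield (D.M i) ↔ i ∈ circIdx ∪ spadeIdx := by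
  refine defOver_iff_of_circ (fun h => D.r_notMem_three_neg_two
      (sqrtAdjoin_singleton_le D.sqrt_neg_six ?_ h))
    (sqrtAdjoin_singleton_le D.sqrt_neg_six ?_)
    (D.hasDescent_neg_six (mem_sqrtAdjoin (by simp) D.sqrt_neg_six)) D.defOver_neg_three_two_iff i
  · have h1 : D.I * D.r ∈ sqrtAdjoin E {3, -2} := mem_sqrtAdjoin (by simp) D.sqrt_three
    have h2 : D.I * D.s ∈ sqrtAdjoin E {3, -2} := mem_sqrtAdjoin (by simp) D.sqrt_neg_two
    have : D.r * D.s = -(D.I * D.r * (D.I * D.s)) := by linear_combination D.r * D.s * D.hI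
    rw [this]; exact neg_mem (mul_mem h1 h2)
  · exact mul_mem (mem_sqrtAdjoin (by simp) D.sqrt_neg_three)
      (mem_sqrtAdjoin (by simp) D.sqrt_two)

/-- Used to recognise uniformizers of the totally ramified quartic fields, obtained by replacing the
square roots in `p = (1 + I) / s - 1` by congruent ones. -/
lemma N_eq_p_of_sub_lt {P : E} (h : D.N (P - D.p) ≤ D.N D.s) : D.N P = D.N D.p :=
  D.eq_of_sub_lt (h.trans_lt D.N_s_lt_p)

lemma defOver_neg_one_two_iff (i : Idx) : D.DefOver (sqrtAdjoin E {-1, 2}).toSubfield (D.M i) ↔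
    i ∈ circIdx ∪ diamIdx ∪ clubIdx ∪ spadeIdx := by
  have hI : D.I ∈ sqrtAdjoin E {-1, 2} := mem_sqrtAdjoin (by simp) D.sqrt_neg_one
  have hs : D.s ∈ sqrtAdjoin E {-1, 2} := mem_sqrtAdjoin (by simp) D.sqrt_two
  exact defOver_iff_of_club D.r_notMem_neg_one_two (D.hasDescent_neg_one hI) (D.hasDescent_two hs)
    (P := D.p) (sub_mem (div_mem (add_mem (one_mem _) hI) hs) (one_mem _)) rfl i

lemma defOver_neg_one_six_iff (i : Idx) : D.DefOver (sqrtAdjoin E {-1, 6}).toSubfield (D.M i) ↔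
    i ∈ circIdx ∪ diamIdx ∪ clubIdx ∪ spadeIdx := by
  have hI : D.I ∈ sqrtAdjoin E {-1, 6} := mem_sqrtAdjoin (by simp) D.sqrt_neg_one
  have h6 : D.I * D.r * D.s ∈ sqrtAdjoin E {-1, 6} := mem_sqrtAdjoin (by simp) D.sqrt_six
  refine defOver_iff_of_club D.r_notMem_neg_one_six (D.hasDescent_neg_one hI) (D.hasDescent_six h6)
    (P := (1 + D.I) / (D.I * D.r * D.s) - 1)
    (sub_mem (div_mem (add_mem (one_mem _) hI) h6) (one_mem _)) (D.N_eq_p_of_sub_lt ?_) i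
  have e : (1 + D.I) / (D.I * D.r * D.s) - 1 - D.p = -(D.z * (D.I * D.r - 1)) / (D.I * D.r) := by
    have := D.s_ne; have := D.I_ne; have := D.r_ne
    rw [DyadicData.p, DyadicData.z]; field_simp; ring
  rw [e, map_div₀, D.N_I_mul_r, div_one, D.N.map_neg]
  exact D.mul_le D.N_z.le D.N_I_mul_r_sub_one

lemma defOver_three_two_iff (i : Idx) : D.DefOver (sqrtAdjoin E {3, 2}).toSubfield (D.M i) ↔
    i ∈ circIdx ∪ diamIdx ∪ clubIdx ∪ spadeIdx := by
  have h3 : D.I * D.r ∈ sqrtAdjoin E {3, 2} := mem_sqrtAdjoin (by simp) D.sqrt_three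
  have hs : D.s ∈ sqrtAdjoin E {3, 2} := mem_sqrtAdjoin (by simp) D.sqrt_two
  refine defOver_iff_of_club D.r_notMem_three_two (D.hasDescent_three h3) (D.hasDescent_two hs)
    (P := (1 + D.I * D.r) / D.s - 1)
    (sub_mem (div_mem (add_mem (one_mem _) h3) hs) (one_mem _)) (D.N_eq_p_of_sub_lt ?_) i
  have e : (1 + D.I * D.r) / D.s - 1 - D.p = D.I * D.w * D.s := by
    have := D.s_ne
    rw [DyadicData.p, DyadicData.z, D.r_eq]; field_simp; linear_combination -D.I * D.w * D.hs
  rw [e, map_mul, map_mul, D.N_I, D.N_w]; simp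

lemma defOver_three_neg_two_iff (i : Idx) : D.DefOver (sqrtAdjoin E {3, -2}).toSubfield (D.M i) ↔
    i ∈ circIdx ∪ diamIdx ∪ clubIdx ∪ spadeIdx := by
  have h3 : D.I * D.r ∈ sqrtAdjoin E {3, -2} := mem_sqrtAdjoin (by simp) D.sqrt_three
  have hs : D.I * D.s ∈ sqrtAdjoin E {3, -2} := mem_sqrtAdjoin (by simp) D.sqrt_neg_two
  refine defOver_iff_of_club D.r_notMem_three_neg_two (D.hasDescent_three h3)
    (D.hasDescent_neg_two hs) (P := (1 + D.I * D.r) / (D.I * D.s) - 1)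
    (sub_mem (div_mem (add_mem (one_mem _) h3) hs) (one_mem _)) (D.N_eq_p_of_sub_lt ?_) i
  have e : (1 + D.I * D.r) / (D.I * D.s) - 1 - D.p = D.w * D.s - D.z * (D.I - 1) / D.I := by
    have := D.s_ne; have := D.I_ne
    rw [DyadicData.p, DyadicData.z, D.r_eq]; field_simp
    linear_combination -D.I * D.w * D.hs
  rw [e]
  refine D.sub_le (D.mul_le D.N_w.le le_rfl) ?_
  rw [map_div₀, D.N_I, div_one]
  exact D.mul_le D.N_z.le D.N_I_sub_one.le

end DyadicField

/-! ### The field `Ω` with its spectral norm. -/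

open Polynomial in
/-- Integrality over `ℤ₂` is detected by the spectral norm. -/
lemma isIntegral_iff_spectralNorm_le_one {K : Type*} [Field K] [Algebra ℚ_[2] K] [Algebra ℤ_[2] K]
    [IsScalarTower ℤ_[2] ℚ_[2] K] [Algebra.IsAlgebraic ℚ_[2] K] (x : K) :
    IsIntegral ℤ_[2] x ↔ spectralNorm ℚ_[2] K x ≤ 1 := by
  have hx : IsIntegral ℚ_[2] x := Algebra.IsIntegral.isIntegral x
  rw [spectralNorm, spectralValue_le_one_iff (minpoly.monic hx)]
  constructor
  · intro h n
    -- Because `ℤ₂` is integrally closed, the minimal polynomial of an integral element has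
    -- coefficients in `ℤ₂`.
    rw [minpoly.isIntegrallyClosed_eq_field_fractions' ℚ_[2] h, coeff_map]
    exact PadicInt.norm_le_one _
  · intro h
    have hl : minpoly ℚ_[2] x ∈ lifts (algebraMap ℤ_[2] ℚ_[2]) := by
      rw [lifts_iff_coeff_lifts]
      intro n
      exact ⟨⟨_, h n⟩, rfl⟩
    obtain ⟨q, hq, -, hqm⟩ := lifts_and_natDegree_eq_and_monic hl (minpoly.monic hx)
    refine ⟨q, hqm, ?_⟩
    have := minpoly.aeval ℚ_[2] x
    rwa [← hq, aeval_map_algebraMap] at this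

namespace Omega

lemma finite_generators :
    {x : AlgebraicClosure ℚ_[2] | x ^ 2 = -1 ∨ x ^ 2 = -3 ∨ x ^ 2 = 2}.Finite := by
  have h : ∀ a : AlgebraicClosure ℚ_[2], {x : AlgebraicClosure ℚ_[2] | x ^ 2 = a}.Finite := by
    intro a
    obtain ⟨y, hy⟩ := IsAlgClosed.exists_pow_nat_eq a two_pos
    refine (Set.toFinite {y, -y}).subset ?_
    rintro x hx
    exact sq_eq_sq_iff_eq_or_eq_neg.mp (hx.trans hy.symm)
  exact (h _).union ((h _).union (h _))

instance : FiniteDimensional ℚ_[2] Omega :=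
  have := finite_generators.to_subtype
  IntermediateField.finiteDimensional_adjoin fun x _ => Algebra.IsIntegral.isIntegral x

instance : Normal ℚ_[2] Omega := by
  rw [IntermediateField.normal_iff_forall_map_le]
  intro σ
  rw [IntermediateField.adjoin_map]
  apply IntermediateField.adjoin.mono
  rintro _ ⟨x, hx, rfl⟩
  refine hx.imp (fun h => ?_) (Or.imp (fun h => ?_) (fun h => ?_)) <;>
    exact (map_pow σ x 2).symm.trans (by rw [h]; simp only [map_neg, map_one, map_ofNat])

instance : IsGalois ℚ_[2] Omega where

lemma exists_root {a : AlgebraicClosure ℚ_[2]} (ha : a = -1 ∨ a = -3 ∨ a = 2) :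
    ∃ x : Omega, (x : AlgebraicClosure ℚ_[2]) ^ 2 = a := by
  obtain ⟨y, hy⟩ := IsAlgClosed.exists_pow_nat_eq a two_pos
  exact ⟨⟨y, IntermediateField.subset_adjoin _ _ (by rw [← hy] at ha; exact ha)⟩, hy⟩

/-- The spectral norm extends the dyadic absolute value and is Galois invariant. Its identification
is recorded because its unit ball is the ring of integers. -/
lemma exists_dyadicField : ∃ D : DyadicField Omega, ∀ x, D.N x = spectralNorm ℚ_[2] Omega x := by
  obtain ⟨I, hI⟩ := exists_root (a := -1) (by simp)
  obtain ⟨r, hr⟩ := exists_root (a := -3) (by simp)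
  obtain ⟨s, hs⟩ := exists_root (a := 2) (by simp)
  let v := algebraMap Omega (AlgebraicClosure ℚ_[2])
  have hv : ∀ {x : Omega} {n : ℤ}, (x : AlgebraicClosure ℚ_[2]) ^ 2 = n → x ^ 2 = n := by
    intro x n h
    apply v.injective
    rw [map_pow, map_intCast]
    exact h
  have hI' : I ^ 2 = -1 := by simpa using hv (n := -1) (by rw [hI]; simp)
  have hr' : r ^ 2 = -3 := by simpa using hv (n := -3) (by rw [hr]; simp)
  have hs' : s ^ 2 = 2 := by simpa using hv (n := 2) (by rw [hs]; simp)
  have h2 : spectralNorm ℚ_[2] Omega 2 = 1 / 2 := by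
    have h := spectralNorm_extends (K := ℚ_[2]) (L := Omega) 2
    rw [map_ofNat] at h
    have h' := Padic.norm_p (p := 2)
    rw [h]; simpa using h'
  have hgen : IntermediateField.adjoin ℚ_[2] {I, r, s} = ⊤ := by
    apply IntermediateField.lift_injective
    rw [IntermediateField.lift_adjoin, IntermediateField.lift_top]
    apply le_antisymm
    · apply IntermediateField.adjoin_le_iff.mpr
      rintro _ ⟨x, -, rfl⟩
      exact x.2
    · apply IntermediateField.adjoin_le_iff.mpr
      have hmem : ∀ {x : AlgebraicClosure ℚ_[2]} {y : Omega}, y ∈ ({I, r, s} : Set Omega) →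
          x ^ 2 = (y : AlgebraicClosure ℚ_[2]) ^ 2 →
          x ∈ IntermediateField.adjoin ℚ_[2] (Subtype.val '' ({I, r, s} : Set Omega)) := by
        intro x y hy h
        have := IntermediateField.subset_adjoin ℚ_[2] _ (Set.mem_image_of_mem Subtype.val hy)
        rcases sq_eq_sq_iff_eq_or_eq_neg.mp h with rfl | rfl
        · exact this
        · exact neg_mem this
      rintro x (h | h | h)
      · exact hmem (y := I) (by simp) (h.trans hI.symm)
      · exact hmem (y := r) (by simp) (h.trans hr.symm)
      · exact hmem (y := s) (by simp) (h.trans hs.symm)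
  exact ⟨{
    N := MulRingNorm.mulRingNormEquivAbsoluteValue
      (spectralMulAlgNorm ℚ_[2] Omega).toMulRingNorm
    nonarch := isNonarchimedean_spectralNorm
    I := I
    r := r
    s := s
    hI := hI'
    hr := hr'
    hs := hs'
    two := h2
    ext := fun x => spectralNorm_extends x
    isom := fun τ x => (spectralNorm_eq_of_equiv τ x).symm
    gen := hgen }, fun x => rfl⟩

end Omega

/-! ### Representations of `Q₈` and quaternion pairs. -/

namespace QuaternionGroup

section CommRing

variable {R : Type*} [CommRing R]

lemma closure_induction_two {p : QuaternionGroup 2 → Prop} (one : p 1)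
    (mul : ∀ x y, p x → p y → p (x * y)) (ha : p (a 1)) (hx : p (xa 0)) (x : QuaternionGroup 2) :
    p x := by
  have hpow : ∀ n : ℕ, p (a 1 ^ n) := by
    intro n
    induction n with
    | zero => simpa using one
    | succ n ih => rw [pow_succ]; exact mul _ _ ih ha
  have hai : ∀ i, p (a i) := by
    intro i
    have := hpow i.val
    rwa [a_one_pow, ZMod.natCast_zmod_val] at this
  rcases x with i | i
  · exact hai i
  · have := mul _ _ hx (hai i)
    rwa [xa_mul_a, zero_add] at this

lemma intertwine_of_generators {σ τ : QuaternionGroup 2 →* GL (Fin 2) R}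
    {g : Matrix (Fin 2) (Fin 2) R}
    (ha : (σ (a 1) : Matrix (Fin 2) (Fin 2) R) * g = g * τ (a 1))
    (hx : (σ (xa 0) : Matrix (Fin 2) (Fin 2) R) * g = g * τ (xa 0)) (x : QuaternionGroup 2) :
    (σ x : Matrix (Fin 2) (Fin 2) R) * g = g * τ x := by
  refine closure_induction_two (p := fun x => (σ x : Matrix (Fin 2) (Fin 2) R) * g = g * τ x)
    (by simp) (fun x y h h' => ?_) ha hx x
  simp only [map_mul, Units.val_mul]
  rw [mul_assoc, h', ← mul_assoc, h, mul_assoc]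

/-- The homomorphism from `Q₈` determined by a quaternion pair. -/
lemma exists_hom {A B : Matrix (Fin 2) (Fin 2) R} (h : QuatPair A B) :
    ∃ σ : QuaternionGroup 2 →* GL (Fin 2) R, (σ (a 1) : Matrix (Fin 2) (Fin 2) R) = A ∧
      (σ (xa 0) : Matrix (Fin 2) (Fin 2) R) = B := by
  let u : GL (Fin 2) R := ⟨A, -A, by rw [mul_neg, h.sq_left, neg_neg],
    by rw [neg_mul, h.sq_left, neg_neg]⟩
  let v : GL (Fin 2) R := ⟨B, -B, by rw [mul_neg, h.sq_right, neg_neg],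
    by rw [neg_mul, h.sq_right, neg_neg]⟩
  have hu4 : u ^ 4 = 1 := by
    ext1
    change A ^ 4 = 1
    rw [show A ^ 4 = (A * A) * (A * A) by simp [pow_succ, mul_assoc], h.sq_left]; simp
  have hv2 : v * v = u ^ 2 := by
    ext1
    change B * B = A ^ 2
    rw [sq, h.sq_left, h.sq_right]
  have huv : u * v = v * u⁻¹ := by
    ext1
    change A * B = B * -A
    rw [mul_neg, h.anti, neg_neg]
  let φ : ZMod (2 * 2) → GL (Fin 2) R := fun i => u ^ i.val
  have hφ : ∀ i j, φ (i + j) = φ i * φ j := by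
    intro i j
    simp only [φ]
    rw [ZMod.val_add, ← pow_add, ← pow_eq_pow_mod _ hu4]
  have hφ0 : φ 0 = 1 := by simp [φ]
  have hφn : ∀ i, φ (-i) = (φ i)⁻¹ := by
    intro i
    rw [eq_inv_iff_mul_eq_one, ← hφ, neg_add_cancel, hφ0]
  have hφv : ∀ i, φ i * v = v * φ (-i) := by
    intro i
    rw [hφn]
    have : v⁻¹ * u * v⁻¹⁻¹ = u⁻¹ := by rw [inv_inv, mul_assoc, huv, inv_mul_cancel_left]
    have h2 : (v⁻¹ * u * v⁻¹⁻¹) ^ i.val = u⁻¹ ^ i.val := by rw [this]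
    rw [conj_pow, inv_inv] at h2
    change u ^ i.val * v = v * (u ^ i.val)⁻¹
    rw [← inv_pow, ← h2]; group
  have hφ2 : φ 2 = u ^ 2 := rfl
  refine ⟨{ toFun := fun x => match x with
              | a i => φ i
              | xa i => v * φ i
            map_one' := hφ0
            map_mul' := ?_ }, ?_, ?_⟩
  · rintro (i | i) (j | j)
    · exact hφ i j
    · change v * φ (j - i) = φ i * (v * φ j)
      rw [← mul_assoc, hφv, mul_assoc, ← hφ, sub_eq_neg_add]
    · change v * φ (i + j) = v * φ i * φ j
      rw [hφ, mul_assoc]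
    · change φ (2 + j - i) = v * φ i * (v * φ j)
      rw [mul_assoc, ← mul_assoc (φ i), hφv, mul_assoc, ← hφ, ← mul_assoc, hv2, ← hφ2, ← hφ]
      congr 1; ring
  · change ((u ^ (1 : ZMod (2 * 2)).val : GL (Fin 2) R) : Matrix (Fin 2) (Fin 2) R) = A
    rw [show (1 : ZMod (2 * 2)).val = 1 from rfl, pow_one]
  · change ((v * φ 0 : GL (Fin 2) R) : Matrix (Fin 2) (Fin 2) R) = B
    rw [hφ0, mul_one]

end CommRing

variable {K : Type*} [Field K] [CharZero K]

/-- A trace-zero involution of size two has determinant `-1`. So the trace is nonzero here, and `Z *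
Z = 1` then makes `Z` scalar. -/
lemma eq_neg_one_of_sq_eq_one {Z : Matrix (Fin 2) (Fin 2) K} (h1 : Z ≠ 1) (h2 : Z * Z = 1)
    (h3 : Z.det = 1) : Z = -1 := by
  have e00 := congrFun (congrFun h2 0) 0
  have e01 := congrFun (congrFun h2 0) 1
  have e10 := congrFun (congrFun h2 1) 0
  have e11 := congrFun (congrFun h2 1) 1
  simp [Matrix.mul_apply, Fin.sum_univ_two] at e00 e01 e10 e11
  rw [Matrix.det_fin_two] at h3
  have ht : Z 0 0 + Z 1 1 ≠ 0 := by
    intro ht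
    have : (2 : K) = 0 := by linear_combination Z 0 0 * ht - e00 - h3
    exact two_ne_zero this
  have f01 : Z 0 1 = 0 := mul_right_cancel₀ ht (by linear_combination e01)
  have f10 : Z 1 0 = 0 := mul_right_cancel₀ ht (by linear_combination e10)
  have f : Z 0 0 = Z 1 1 :=
    mul_right_cancel₀ ht (by linear_combination e00 - e11)
  rw [f01, f, f10, mul_zero, add_zero] at e00
  rcases mul_self_eq_one_iff.mp e00 with h | h
  · exact absurd (by ext i j; fin_cases i <;> fin_cases j <;> simp [f01, f10, f, h]) h1
  · ext i j; fin_cases i <;> fin_cases j <;> simp [f01, f10, f, h]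

/-- A faithful two-dimensional representation of `Q₈` maps the generators to a quaternion pair. -/
lemma quatPair_of_injective {ρ : QuaternionGroup 2 →* GL (Fin 2) K} (hρ : Function.Injective ρ) :
    QuatPair (ρ (a 1) : Matrix (Fin 2) (Fin 2) K) (ρ (xa 0)) := by
  have hm : ∀ x y, (ρ (x * y) : Matrix (Fin 2) (Fin 2) K) = ρ x * ρ y := fun x y => by
    rw [map_mul, Units.val_mul]
  have h1 : (ρ (a 2) : Matrix (Fin 2) (Fin 2) K) ≠ 1 := by
    intro h
    have := hρ (Units.ext (h.trans (by simp : (1 : Matrix (Fin 2) (Fin 2) K) = ρ 1)))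
    revert this; decide
  have h2 : (ρ (a 2) : Matrix (Fin 2) (Fin 2) K) * ρ (a 2) = 1 := by
    rw [← hm, show (a 2 * a 2 : QuaternionGroup 2) = 1 by decide]; simp
  -- The central element `a 2` is a commutator, so its image has determinant 1.
  have hz : (ρ (a 1) : Matrix (Fin 2) (Fin 2) K) * ρ (xa 0) =
      ρ (a 2) * (ρ (xa 0) * ρ (a 1)) := by
    rw [← hm, ← hm, ← hm, show (a 1 * xa 0 : QuaternionGroup 2) = a 2 * (xa 0 * a 1) by decide]
  have h3 : (ρ (a 2) : Matrix (Fin 2) (Fin 2) K).det = 1 := by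
    have hd := congrArg Matrix.det hz
    have n1 := (Matrix.isUnit_iff_isUnit_det _).mp (ρ (a 1)).isUnit |>.ne_zero
    have n2 := (Matrix.isUnit_iff_isUnit_det _).mp (ρ (xa 0)).isUnit |>.ne_zero
    simp only [Matrix.det_mul] at hd
    exact mul_right_cancel₀ (mul_ne_zero n1 n2) (by linear_combination -hd)
  have hneg := eq_neg_one_of_sq_eq_one h1 h2 h3
  refine ⟨?_, ?_, ?_⟩
  · rw [← hneg, ← hm, show (a 1 * a 1 : QuaternionGroup 2) = a 2 by decide]
  · rw [← hneg, ← hm, show (xa 0 * xa 0 : QuaternionGroup 2) = a 2 by decide]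
  · rw [hz, hneg, neg_mul, one_mul, neg_neg]

/-- Every nontrivial element of `Q₈` is `a 2` or squares to it, so a nontrivial kernel would contain
`a 2`, which acts as `-1`. -/
lemma injective_of_quatPair {ρ : QuaternionGroup 2 →* GL (Fin 2) K}
    (h : QuatPair (ρ (a 1) : Matrix (Fin 2) (Fin 2) K) (ρ (xa 0))) : Function.Injective ρ := by
  have h2 : ρ (a 2) ≠ 1 := by
    intro h'
    have e : (ρ (a 1) * ρ (a 1) : GL (Fin 2) K) = 1 := by
      rw [← map_mul, show (a 1 * a 1 : QuaternionGroup 2) = a 2 by decide, h']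
    have e' := congrArg Units.val e
    rw [Units.val_mul, h.sq_left] at e'
    have := congrFun (congrFun e' 0) 0
    simp at this
    exact two_ne_zero (show (2 : K) = 0 by linear_combination -this)
  rw [injective_iff_map_eq_one]
  intro x hx
  have hsq : ∀ y : QuaternionGroup 2, y * y = 1 ∨ y * y = a 2 := by decide
  have hone : ∀ y : QuaternionGroup 2, y * y = 1 → y = 1 ∨ y = a 2 := by decide
  rcases hsq x with h | h
  · rcases hone x h with h | rfl
    · exact h
    · exact absurd hx h2
  · exact absurd (by rw [← h, map_mul, hx, one_mul]) h2

end QuaternionGroup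

lemma RingHom.mapMatrix_injective {R S : Type*} [CommRing R] [CommRing S] {φ : R →+* S}
    (hφ : Function.Injective φ) :
    Function.Injective (φ.mapMatrix : Matrix (Fin 2) (Fin 2) R →+* Matrix (Fin 2) (Fin 2) S) :=
  Matrix.map_injective hφ

lemma Matrix.GeneralLinearGroup.map_injective {R S : Type*} [CommRing R] [CommRing S]
    {φ : R →+* S} (hφ : Function.Injective φ) :
    Function.Injective (Matrix.GeneralLinearGroup.map (n := Fin 2) φ) := fun _ _ h =>
  Units.ext (RingHom.mapMatrix_injective hφ (congrArg Units.val h))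

lemma QuatPair.of_map {R S : Type*} [CommRing R] [CommRing S] {φ : R →+* S}
    (hφ : Function.Injective φ) {A B : Matrix (Fin 2) (Fin 2) R}
    (h : QuatPair (φ.mapMatrix A) (φ.mapMatrix B)) : QuatPair A B := by
  refine ⟨RingHom.mapMatrix_injective hφ ?_, RingHom.mapMatrix_injective hφ ?_,
    RingHom.mapMatrix_injective hφ ?_⟩
  · rw [map_mul, h.sq_left, map_neg, map_one]
  · rw [map_mul, h.sq_right, map_neg, map_one]
  · rw [map_mul, h.anti, map_neg, map_mul]

lemma Matrix.GeneralLinearGroup.eq_conj_iff {R : Type*} [CommRing R] (g x y : GL (Fin 2) R) :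
    y = g * x * g⁻¹ ↔ (y : Matrix (Fin 2) (Fin 2) R) * g = g * x := by
  rw [eq_mul_inv_iff_mul_eq, Units.ext_iff, Units.val_mul, Units.val_mul]

section FaithfulRepresentations

open QuaternionGroup

variable {K : Type*} [Field K] [CharZero K]

/-- Faithful two-dimensional representations of `Q₈` are conjugate. -/
lemma exists_conj_of_injective {ρ ρ' : QuaternionGroup 2 →* GL (Fin 2) K}
    (hρ : Function.Injective ρ) (hρ' : Function.Injective ρ') :
    ∃ g : GL (Fin 2) K, ∀ x, ρ' x = g * ρ x * g⁻¹ := by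
  obtain ⟨g, -, hg, hA, hB⟩ := (quatPair_of_injective hρ).exists_conj (quatPair_of_injective hρ') ⊤
    (fun _ _ => trivial) (fun _ _ => trivial) (fun _ _ => trivial) (fun _ _ => trivial)
  refine ⟨Matrix.GeneralLinearGroup.mkOfDetNeZero g hg, fun x => ?_⟩
  rw [Matrix.GeneralLinearGroup.eq_conj_iff]
  exact intertwine_of_generators (g := g) hA hB x

variable [Algebra ℤ_[2] K]

lemma algebraMap_integerRing_injective :
    Function.Injective (algebraMap (IntegerRing K) K) := Subtype.val_injective

/-- The integral representations conjugate to a faithful one are the faithful ones. -/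
lemma isIntegralRep_iff_injective {ρ : QuaternionGroup 2 →* GL (Fin 2) K}
    (hρ : Function.Injective ρ) (σ : QuaternionGroup 2 →* GL (Fin 2) (IntegerRing K)) :
    (∃ g : GL (Fin 2) K, ∀ x,
      Matrix.GeneralLinearGroup.map (algebraMap (IntegerRing K) K) (σ x) = g * ρ x * g⁻¹) ↔
    Function.Injective σ := by
  constructor
  · rintro ⟨g, hg⟩ x y hxy
    apply hρ
    have := hg x
    rw [hxy, hg y] at this
    simpa using this.symm
  · intro h
    exact exists_conj_of_injective (ρ' := (Matrix.GeneralLinearGroup.map _).comp σ) hρ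
      ((Matrix.GeneralLinearGroup.map_injective algebraMap_integerRing_injective).comp h)

end FaithfulRepresentations

/-! ### Integral forms as lattice classes. -/

namespace Omega

open QuaternionGroup DyadicData

/-- Entrywise inclusion of matrices over the integers. -/
def toMat : Matrix (Fin 2) (Fin 2) (IntegerRing Omega) →+* Matrix (Fin 2) (Fin 2) Omega :=
  (algebraMap (IntegerRing Omega) Omega).mapMatrix

lemma toMat_injective : Function.Injective toMat :=
  RingHom.mapMatrix_injective algebraMap_integerRing_injective

/-- The matrix `g` conjugates the explicit representation into the integral representation `σ`. -/
structure IsFrame (D : DyadicData Omega)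
    (σ : QuaternionGroup 2 →* GL (Fin 2) (IntegerRing Omega))
    (g : Matrix (Fin 2) (Fin 2) Omega) : Prop where
  det_ne : g.det ≠ 0
  left : toMat (σ (a 1) : Matrix (Fin 2) (Fin 2) (IntegerRing Omega)) * g = g * D.A₀
  right : toMat (σ (xa 0) : Matrix (Fin 2) (Fin 2) (IntegerRing Omega)) * g = g * D.B₀

variable {D : DyadicData Omega} {σ τ : QuaternionGroup 2 →* GL (Fin 2) (IntegerRing Omega)}
  {g g' : Matrix (Fin 2) (Fin 2) Omega}

lemma exists_isFrame (D : DyadicData Omega) (hσ : Function.Injective σ) : ∃ g, IsFrame D σ g := by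
  have hinj : Function.Injective
      ((Matrix.GeneralLinearGroup.map (algebraMap (IntegerRing Omega) Omega)).comp σ) :=
    (Matrix.GeneralLinearGroup.map_injective algebraMap_integerRing_injective).comp hσ
  obtain ⟨g, -, hg, hA, hB⟩ := D.quatPair.exists_conj (quatPair_of_injective hinj) ⊤
    (fun _ _ => trivial) (fun _ _ => trivial) (fun _ _ => trivial) (fun _ _ => trivial)
  exact ⟨g, hg, hA, hB⟩

lemma IsFrame.injective (h : IsFrame D σ g) : Function.Injective σ := by
  have := injective_of_quatPair
    (ρ := (Matrix.GeneralLinearGroup.map (algebraMap (IntegerRing Omega) Omega)).comp σ)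
    (quatPair_of_intertwine h.det_ne h.left h.right)
  rw [MonoidHom.coe_comp] at this
  exact this.of_comp

variable (D) in
/-- The valuation ring is the ring of integers. -/
def Spectral : Prop := ∀ x : Omega, IsIntegral ℤ_[2] x ↔ D.N x ≤ 1

lemma intM_toMat (hD : Spectral D) (X : Matrix (Fin 2) (Fin 2) (IntegerRing Omega)) :
    D.IntM (toMat X) := fun i j => (hD _).mp (X i j).2

lemma exists_toMat (hD : Spectral D) {X : Matrix (Fin 2) (Fin 2) Omega} (hX : D.IntM X) :
    ∃ Y, toMat Y = X :=
  ⟨fun i j => ⟨X i j, (hD _).mpr (hX i j)⟩, rfl⟩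

/-- The determinants of `u` and `u⁻¹` are integral with product 1, so both have norm 1. -/
lemma unim_toMat (hD : Spectral D) (u : GL (Fin 2) (IntegerRing Omega)) :
    D.Unim (toMat (u : Matrix (Fin 2) (Fin 2) (IntegerRing Omega))) := by
  refine ⟨intM_toMat hD _, ?_⟩
  have h1 : ∀ v : GL (Fin 2) (IntegerRing Omega),
      D.N (toMat (v : Matrix (Fin 2) (Fin 2) (IntegerRing Omega))).det ≤ 1 := by
    intro v
    rw [toMat, ← RingHom.map_det]
    exact (hD _).mp (Matrix.det (v : Matrix (Fin 2) (Fin 2) (IntegerRing Omega))).2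
  have h2 : D.N (toMat (u : Matrix (Fin 2) (Fin 2) (IntegerRing Omega))).det *
      D.N (toMat ((u⁻¹ : GL (Fin 2) (IntegerRing Omega)) :
        Matrix (Fin 2) (Fin 2) (IntegerRing Omega))).det = 1 := by
    rw [← map_mul, ← Matrix.det_mul, ← map_mul, Units.mul_inv]
    simp
  have := h1 u
  have := h1 u⁻¹
  have := D.N.nonneg (toMat (u : Matrix (Fin 2) (Fin 2) (IntegerRing Omega))).det
  nlinarith

lemma exists_unit_of_unim (hD : Spectral D) {U : Matrix (Fin 2) (Fin 2) Omega} (hU : D.Unim U) :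
    ∃ u : GL (Fin 2) (IntegerRing Omega),
      toMat (u : Matrix (Fin 2) (Fin 2) (IntegerRing Omega)) = U := by
  obtain ⟨U', hU', h1, h2⟩ := hU.exists_inv
  obtain ⟨u, rfl⟩ := exists_toMat hD hU.1
  obtain ⟨v, rfl⟩ := exists_toMat hD hU'.1
  rw [← map_mul] at h1 h2
  exact ⟨⟨u, v, toMat_injective (h2.trans (map_one _).symm),
    toMat_injective (h1.trans (map_one _).symm)⟩, rfl⟩

/-- Integral conjugacy in terms of frames. -/
lemma conj_iff_eqv (hD : Spectral D) (h : IsFrame D σ g) (h' : IsFrame D τ g') :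
    (∃ u : GL (Fin 2) (IntegerRing Omega), ∀ x, τ x = u * σ x * u⁻¹) ↔ D.Eqv g g' := by
  constructor
  · rintro ⟨u, hu⟩
    have hu' := fun x => congrArg toMat ((Matrix.GeneralLinearGroup.eq_conj_iff _ _ _).mp (hu x))
    simp only [map_mul] at hu'
    have hU := unim_toMat hD u
    have e1 : D.Eqv g (toMat (u : Matrix (Fin 2) (Fin 2) (IntegerRing Omega)) * g) :=
      ⟨1, one_ne_zero, _, hU, one_smul _ _⟩
    refine e1.trans (eqv_of_intertwine (e1.det_ne h.det_ne) h'.det_ne ?_ ?_ h'.left h'.right)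
    · rw [← mul_assoc, hu', mul_assoc, h.left, mul_assoc]
    · rw [← mul_assoc, hu', mul_assoc, h.right, mul_assoc]
  · rintro ⟨c, hc, U, hU, hg⟩
    obtain ⟨u, rfl⟩ := exists_unit_of_unim hD hU
    refine ⟨u, fun x => (Matrix.GeneralLinearGroup.eq_conj_iff _ _ _).mpr
      (intertwine_of_generators (toMat_injective ?_) (toMat_injective ?_) x)⟩
    · apply mul_right_cancel_of_det h.det_ne
      simp only [map_mul]
      rw [mul_assoc, ← hg, Matrix.mul_smul, h'.left, mul_assoc, h.left, ← mul_assoc, ← hg,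
        Matrix.smul_mul]
    · apply mul_right_cancel_of_det h.det_ne
      simp only [map_mul]
      rw [mul_assoc, ← hg, Matrix.mul_smul, h'.right, mul_assoc, h.right, ← mul_assoc, ← hg,
        Matrix.smul_mul]

lemma exists_hom_of_frame (hD : Spectral D) (hg : g.det ≠ 0) (h : D.Intg g) :
    ∃ σ, IsFrame D σ g := by
  obtain ⟨A, B, hA, hB, hAg, hBg⟩ := h
  obtain ⟨A, rfl⟩ := exists_toMat hD hA
  obtain ⟨B, rfl⟩ := exists_toMat hD hB
  obtain ⟨σ, hσA, hσB⟩ := exists_hom (QuatPair.of_map algebraMap_integerRing_injective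
    (quatPair_of_intertwine hg hAg hBg))
  exact ⟨σ, hg, by rw [hσA]; exact hAg, by rw [hσB]; exact hBg⟩

lemma integerInclusion_injective (L : IntermediateField ℚ_[2] Omega) :
    Function.Injective (integerInclusion L) := by
  intro x y h
  have := congrArg (algebraMap (IntegerRing Omega) Omega) h
  exact Subtype.ext (Subtype.ext this)

/-- A frame for a form defined over `L` yields a homomorphism over the integers of `L`. -/
lemma exists_hom_of_defOver (hD : Spectral D) {L : IntermediateField ℚ_[2] Omega} (hg : g.det ≠ 0)
    (h : D.Intg g) {A B : Matrix (Fin 2) (Fin 2) Omega} (hA : ∀ i j, A i j ∈ L)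
    (hB : ∀ i j, B i j ∈ L) (hAg : A * g = g * D.A₀) (hBg : B * g = g * D.B₀) :
    ∃ σ : QuaternionGroup 2 →* GL (Fin 2) (IntegerRing L),
      IsFrame D ((Matrix.GeneralLinearGroup.map (integerInclusion L)).comp σ) g := by
  obtain ⟨A', B', hA', hB', hAg', hBg'⟩ := h
  -- The invertible frame determines the conjugated matrices, so the integral pair and the
  -- `L`-rational pair coincide.
  obtain rfl : A = A' := mul_right_cancel_of_det hg (hAg.trans hAg'.symm)
  obtain rfl : B = B' := mul_right_cancel_of_det hg (hBg.trans hBg'.symm)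
  have lift : ∀ {X : Matrix (Fin 2) (Fin 2) Omega}, D.IntM X → (∀ i j, X i j ∈ L) →
      ∃ Y : Matrix (Fin 2) (Fin 2) (IntegerRing L),
        toMat ((integerInclusion L).mapMatrix Y) = X := by
    intro X hX hXL
    refine ⟨fun i j => ⟨⟨X i j, hXL i j⟩, ?_⟩, rfl⟩
    have := (hD _).mpr (hX i j)
    exact (isIntegral_algHom_iff (L.val.restrictScalars ℤ_[2]) L.val.injective).mp this
  obtain ⟨A, rfl⟩ := lift hA' hA
  obtain ⟨B, rfl⟩ := lift hB' hB
  obtain ⟨σ, hσA, hσB⟩ := exists_hom (QuatPair.of_map (integerInclusion_injective L)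
    (QuatPair.of_map algebraMap_integerRing_injective (quatPair_of_intertwine hg hAg hBg)))
  refine ⟨σ, hg, ?_, ?_⟩
  · rw [← hAg, ← hσA]; rfl
  · rw [← hBg, ← hσB]; rfl

/-- The dictionary that reduces the theorem to matrices: integral conjugacy is equality of cosets of
frames, and rationality over `L` can be tested on any frame in the coset. -/
lemma exists_param (hD : Spectral D) (hu : D.Unif ⊤ D.p)
    {ρ : QuaternionGroup 2 →* GL (Fin 2) Omega} (hρ : Function.Injective ρ) :
    ∃ f : Idx → IntegralForms ρ, Function.Bijective f ∧
      ∀ (L : IntermediateField ℚ_[2] Omega) (i : Idx),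
        f i ∈ definedOver ρ L ↔ D.DefOver L.toSubfield (D.M i) := by
  choose σ hσ using fun i => exists_hom_of_frame hD (det_M (D := D) i) (intg_M i)
  let s : Idx → IntegralRep ρ := fun i =>
    ⟨σ i, (isIntegralRep_iff_injective hρ _).mpr (hσ i).injective⟩
  refine ⟨fun i => Quotient.mk _ (s i), ⟨fun i j hij => ?_, fun c => ?_⟩, fun L i => ?_⟩
  · exact M_injective ((conj_iff_eqv hD (hσ i) (hσ j)).mp (Quotient.exact hij))
  · obtain ⟨τ, rfl⟩ := Quotient.exists_rep c
    obtain ⟨g, hg⟩ := exists_isFrame D ((isIntegralRep_iff_injective hρ _).mp τ.2)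
    have hgi : D.Intg g := ⟨_, _, intM_toMat hD _, intM_toMat hD _, hg.left, hg.right⟩
    obtain ⟨i, hi⟩ := exists_M hu hg.det_ne hgi
    exact ⟨i, Quotient.sound ((conj_iff_eqv hD (hσ i) hg).mpr hi.symm)⟩
  · constructor
    · rintro ⟨σ', τ, hτ, hc⟩
      obtain ⟨g, hg⟩ := exists_isFrame D ((isIntegralRep_iff_injective hρ _).mp τ.2)
      refine ⟨g, (conj_iff_eqv hD (hσ i) hg).mp (Quotient.exact hc.symm), _, _, ?_, ?_, hg.left,
        hg.right⟩
      · intro k l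
        rw [hτ]
        exact (σ' (a 1) k l : L).2
      · intro k l
        rw [hτ]
        exact (σ' (xa 0) k l : L).2
    · rintro ⟨g, hg, A, B, hA, hB, hAg, hBg⟩
      obtain ⟨σ', hσ'⟩ := exists_hom_of_defOver hD (hg.det_ne (det_M i)) (hg.intg (intg_M i))
        hA hB hAg hBg
      exact ⟨σ', ⟨_, (isIntegralRep_iff_injective hρ _).mpr hσ'.injective⟩, fun x => rfl,
        Quotient.sound ((conj_iff_eqv hD hσ' (hσ i)).mpr hg.symm)⟩

end Omega

/-! ### Integral forms over the ring of integers of a subfield. -/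

lemma conj_map {R S G : Type*} [CommRing R] [CommRing S] [Group G] (φ : R →+* S)
    {σ τ : G →* GL (Fin 2) R} (h : ∃ g : GL (Fin 2) R, ∀ x, τ x = g * σ x * g⁻¹) :
    ∃ g : GL (Fin 2) S, ∀ x, Matrix.GeneralLinearGroup.map φ (τ x) =
      g * Matrix.GeneralLinearGroup.map φ (σ x) * g⁻¹ := by
  obtain ⟨g, hg⟩ := h
  exact ⟨Matrix.GeneralLinearGroup.map φ g, fun x => by rw [hg x, map_mul, map_mul, map_inv]⟩

lemma mapMatrix_mul_of_conj {R S T : Type*} [CommRing R] [CommRing S] [CommRing T] {φ : R →+* S}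
    {ψ : S →+* T} {χ : R →+* T} (hχ : ψ.comp φ = χ) {x y : GL (Fin 2) R} {u : GL (Fin 2) S}
    (h : Matrix.GeneralLinearGroup.map φ y = u * Matrix.GeneralLinearGroup.map φ x * u⁻¹) :
    χ.mapMatrix (y : Matrix (Fin 2) (Fin 2) R) * ψ.mapMatrix (u : Matrix (Fin 2) (Fin 2) S) =
      ψ.mapMatrix (u : Matrix (Fin 2) (Fin 2) S) * χ.mapMatrix (x : Matrix (Fin 2) (Fin 2) R) := by
  subst hχ
  have := congrArg ψ.mapMatrix ((Matrix.GeneralLinearGroup.eq_conj_iff _ _ _).mp h)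
  rw [map_mul, map_mul] at this
  exact this

lemma eq_conj_of_mapMatrix {R S : Type*} [CommRing R] [CommRing S] {φ : R →+* S}
    (hφ : Function.Injective φ) {x y u : GL (Fin 2) R}
    (h : φ.mapMatrix (y : Matrix (Fin 2) (Fin 2) R) * φ.mapMatrix (u : Matrix (Fin 2) (Fin 2) R) =
      φ.mapMatrix (u : Matrix (Fin 2) (Fin 2) R) * φ.mapMatrix (x : Matrix (Fin 2) (Fin 2) R)) :
    y = u * x * u⁻¹ := by
  rw [Matrix.GeneralLinearGroup.eq_conj_iff]
  apply RingHom.mapMatrix_injective hφ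
  rwa [map_mul, map_mul]

namespace Omega

open QuaternionGroup DyadicData

variable {D : DyadicData Omega} {L : IntermediateField ℚ_[2] Omega}

/-- If all entries were in the maximal ideal, so would be the determinant. -/
lemma exists_entry_of_unim {U : Matrix (Fin 2) (Fin 2) Omega} (hU : D.Unim U) :
    ∃ i j, D.N (U i j) = 1 := by
  by_contra! h
  have hlt : ∀ i j, D.N (U i j) < 1 := fun i j => lt_of_le_of_ne (hU.1 i j) (h i j)
  have h1 := hU.2
  rw [Matrix.det_fin_two] at h1
  have h3 : D.N (U 0 0 * U 1 1 - U 0 1 * U 1 0) ≤ max (D.N (U 0 0)) (D.N (U 0 1)) :=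
    D.sub_le (D.mul_le' (le_max_left _ _) (hlt _ _).le) (D.mul_le' (le_max_right _ _) (hlt _ _).le)
  rw [h1] at h3
  exact absurd h3 (not_le.mpr (max_lt (hlt _ _) (hlt _ _)))

lemma isUnit_integerRing (hD : Spectral D) {x : IntegerRing L} (hx : D.N ((x : L) : Omega) = 1) :
    IsUnit x := by
  have hx0 : ((x : L) : Omega) ≠ 0 := D.ne_zero_of_N one_pos hx
  have hxL : (x : L) ≠ 0 := by
    intro h; apply hx0; rw [h]; rfl
  have hint : IsIntegral ℤ_[2] ((x : L)⁻¹) := by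
    refine (isIntegral_algHom_iff (L.val.restrictScalars ℤ_[2]) L.val.injective).mp ((hD _).mpr ?_)
    change D.N (((x : L)⁻¹ : L) : Omega) ≤ 1
    rw [IntermediateField.coe_inv, map_inv₀, hx, inv_one]
  exact IsUnit.of_mul_eq_one ⟨_, hint⟩ (Subtype.ext (mul_inv_cancel₀ hxL))

/-- Two intertwining matrices, one of them unimodular, differ by a scalar. -/
lemma exists_smul_eq {A B A' B' U H : Matrix (Fin 2) (Fin 2) Omega} {g : Matrix (Fin 2) (Fin 2) Omega}
    (hg : g.det ≠ 0) (hA : A * g = g * D.A₀) (hB : B * g = g * D.B₀) (hU : U.det ≠ 0) (hH : H ≠ 0)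
    (hUA : A' * U = U * A) (hUB : B' * U = U * B) (hHA : A' * H = H * A) (hHB : B' * H = H * B) :
    ∃ c : Omega, c ≠ 0 ∧ H = c • U := by
  obtain ⟨c, hc⟩ := smul_of_intertwine (D := D) (g := U * g) (g' := H * g) (A := A') (B := B')
    (by rw [Matrix.det_mul]; exact mul_ne_zero hU hg)
    (by rw [← mul_assoc, hUA, mul_assoc, hA, mul_assoc])
    (by rw [← mul_assoc, hUB, mul_assoc, hB, mul_assoc])
    (by rw [← mul_assoc, hHA, mul_assoc, hA, mul_assoc])
    (by rw [← mul_assoc, hHB, mul_assoc, hB, mul_assoc])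
  have hHU : H = c • U :=
    mul_right_cancel_of_det hg (by rw [hc, Matrix.smul_mul])
  refine ⟨c, ?_, hHU⟩
  rintro rfl
  exact hH (by rw [hHU, zero_smul])

/-- Dividing by an entry cancels the unknown scalar. The position is chosen where `U` has a unit, so
the quotient stays unimodular. -/
lemma exists_unim_div {U H : Matrix (Fin 2) (Fin 2) Omega} (hU : D.Unim U) {c : Omega} (hc : c ≠ 0)
    (h : H = c • U) : ∃ i j, D.Unim ((H i j)⁻¹ • H) ∧ (H i j)⁻¹ • H = (U i j)⁻¹ • U := by
  obtain ⟨i, j, h1⟩ := exists_entry_of_unim hU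
  have e : (H i j)⁻¹ • H = (U i j)⁻¹ • U := by
    rw [h, Matrix.smul_apply, smul_eq_mul, smul_smul, mul_inv_rev, mul_assoc, inv_mul_cancel₀ hc,
      mul_one]
  refine ⟨i, j, ?_, e⟩
  rw [e]
  refine ⟨fun k l => ?_, ?_⟩
  · rw [Matrix.smul_apply, smul_eq_mul, map_mul, map_inv₀, h1, inv_one, one_mul]
    exact hU.1 k l
  · rw [Matrix.det_smul, map_mul, map_pow, map_inv₀, h1, hU.2]; simp

/-- The inclusion of the integers of `L` in `Ω`. -/
def integerVal (L : IntermediateField ℚ_[2] Omega) : IntegerRing L →+* Omega :=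
  (algebraMap L Omega).comp (algebraMap (IntegerRing L) L)

lemma integerVal_eq (L : IntermediateField ℚ_[2] Omega) :
    (algebraMap (IntegerRing Omega) Omega).comp (integerInclusion L) = integerVal L := rfl

lemma integerVal_injective (L : IntermediateField ℚ_[2] Omega) :
    Function.Injective (integerVal L) :=
  (algebraMap L Omega).injective.comp algebraMap_integerRing_injective

lemma exists_integerVal (hD : Spectral D) {x : L} (hx : D.N (algebraMap L Omega x) ≤ 1) :
    ∃ y, integerVal L y = algebraMap L Omega x :=
  ⟨⟨x, (isIntegral_algHom_iff (L.val.restrictScalars ℤ_[2]) L.val.injective).mp ((hD _).mpr hx)⟩,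
    rfl⟩

lemma exists_unit_integerVal (hD : Spectral D) {h : Matrix (Fin 2) (Fin 2) L} {x : L}
    (hU : D.Unim ((algebraMap L Omega x)⁻¹ • (algebraMap L Omega).mapMatrix h)) :
    ∃ k : GL (Fin 2) (IntegerRing L),
      (integerVal L).mapMatrix (k : Matrix (Fin 2) (Fin 2) (IntegerRing L)) =
        (algebraMap L Omega x)⁻¹ • (algebraMap L Omega).mapMatrix h := by
  have hk : ∀ i j, ∃ y, integerVal L y = algebraMap L Omega (x⁻¹ * h i j) := fun i j => by
    apply exists_integerVal hD
    rw [map_mul (algebraMap L Omega), map_inv₀ (algebraMap L Omega)]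
    exact hU.1 i j
  choose k hk using hk
  have e : (integerVal L).mapMatrix (Matrix.of k) =
      (algebraMap L Omega x)⁻¹ • (algebraMap L Omega).mapMatrix h := by
    ext i j : 2
    rw [RingHom.mapMatrix_apply, Matrix.map_apply, Matrix.of_apply, hk, map_mul, map_inv₀]
    rfl
  have hunit : IsUnit (Matrix.of k) := by
    rw [Matrix.isUnit_iff_isUnit_det]
    apply isUnit_integerRing hD
    have h1 := hU.2
    rw [← e, ← RingHom.map_det] at h1
    exact h1
  exact ⟨hunit.unit, e⟩

/-- Integral representations over `L` that become integrally conjugate over `Ω` are integrally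
conjugate over `L`. -/
lemma conj_descends (hD : Spectral D) {σ σ' : QuaternionGroup 2 →* GL (Fin 2) (IntegerRing L)}
    (hσ : Function.Injective σ) (hσ' : Function.Injective σ')
    (hu : ∃ u : GL (Fin 2) (IntegerRing Omega), ∀ x,
      Matrix.GeneralLinearGroup.map (integerInclusion L) (σ' x) =
        u * Matrix.GeneralLinearGroup.map (integerInclusion L) (σ x) * u⁻¹) :
    ∃ v : GL (Fin 2) (IntegerRing L), ∀ x, σ' x = v * σ x * v⁻¹ := by
  obtain ⟨u, hu⟩ := hu
  have hcoe := Matrix.GeneralLinearGroup.map_injective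
    (algebraMap_integerRing_injective (K := L))
  obtain ⟨h, hh⟩ := exists_conj_of_injective
    (ρ := (Matrix.GeneralLinearGroup.map (algebraMap (IntegerRing L) L)).comp σ)
    (ρ' := (Matrix.GeneralLinearGroup.map (algebraMap (IntegerRing L) L)).comp σ')
    (hcoe.comp hσ) (hcoe.comp hσ')
  have hUσ := fun x => mapMatrix_mul_of_conj (integerVal_eq L) (hu x)
  have hHσ := fun x => mapMatrix_mul_of_conj (χ := integerVal L) rfl (hh x)
  have hU : D.Unim (toMat (u : Matrix (Fin 2) (Fin 2) (IntegerRing Omega))) := unim_toMat hD u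
  have hH : (algebraMap L Omega).mapMatrix (h : Matrix (Fin 2) (Fin 2) L) ≠ 0 := fun h0 =>
    h.ne_zero (RingHom.mapMatrix_injective (algebraMap L Omega).injective
      (h0.trans (map_zero _).symm))
  have hinj : Function.Injective ((Matrix.GeneralLinearGroup.map (integerVal L)).comp σ) :=
    (Matrix.GeneralLinearGroup.map_injective (integerVal_injective L)).comp hσ
  obtain ⟨g, -, hg, hA, hB⟩ := D.quatPair.exists_conj (quatPair_of_injective hinj) ⊤
    (fun _ _ => trivial) (fun _ _ => trivial) (fun _ _ => trivial) (fun _ _ => trivial)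
  -- Both the rational intertwiner over `L` and the integral one over `Ω` relate the same
  -- irreducible representations, so they are proportional over `Ω`.
  obtain ⟨c, hc, hHU⟩ := exists_smul_eq hg hA hB (D.ne_zero_of_N one_pos hU.2) hH (hUσ _) (hUσ _)
    (hHσ _) (hHσ _)
  obtain ⟨i, j, hunim, e⟩ := exists_unim_div hU hc hHU
  obtain ⟨k, hk⟩ := exists_unit_integerVal hD (x := (h : Matrix (Fin 2) (Fin 2) L) i j) hunim
  refine ⟨k, fun x => eq_conj_of_mapMatrix (integerVal_injective L) ?_⟩
  rw [hk, Matrix.mul_smul, Matrix.smul_mul]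
  exact congrArg _ (hHσ x)

/-- Extension of scalars of integral representations from `L` to `Ω`. -/
def extendRep {ρ : QuaternionGroup 2 →* GL (Fin 2) Omega} (hρ : Function.Injective ρ)
    {ρL : QuaternionGroup 2 →* GL (Fin 2) L} (hρL : Function.Injective ρL) (σ : IntegralRep ρL) :
    IntegralRep ρ :=
  ⟨(Matrix.GeneralLinearGroup.map (integerInclusion L)).comp σ.1,
    (isIntegralRep_iff_injective hρ _).mpr
      ((Matrix.GeneralLinearGroup.map_injective (integerInclusion_injective L)).comp
        ((isIntegralRep_iff_injective hρL _).mp σ.2))⟩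

lemma extendRep_apply {ρ : QuaternionGroup 2 →* GL (Fin 2) Omega} (hρ : Function.Injective ρ)
    {ρL : QuaternionGroup 2 →* GL (Fin 2) L} (hρL : Function.Injective ρL) (σ : IntegralRep ρL)
    (x : QuaternionGroup 2) : (extendRep hρ hρL σ).1 x =
      Matrix.GeneralLinearGroup.map (integerInclusion L) (σ.1 x) := rfl

/-- Extension of scalars of integral forms from `L` to `Ω`. -/
def extendForm {ρ : QuaternionGroup 2 →* GL (Fin 2) Omega} (hρ : Function.Injective ρ)
    {ρL : QuaternionGroup 2 →* GL (Fin 2) L} (hρL : Function.Injective ρL) :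
    IntegralForms ρL → IntegralForms ρ :=
  Quotient.map (extendRep hρ hρL) fun _ _ h => conj_map (integerInclusion L) h

lemma extendForm_injective (hD : Spectral D) {ρ : QuaternionGroup 2 →* GL (Fin 2) Omega}
    (hρ : Function.Injective ρ) {ρL : QuaternionGroup 2 →* GL (Fin 2) L}
    (hρL : Function.Injective ρL) : Function.Injective (extendForm hρ hρL) := by
  intro c d
  obtain ⟨σ, rfl⟩ := Quotient.exists_rep c
  obtain ⟨τ, rfl⟩ := Quotient.exists_rep d
  intro h
  exact Quotient.sound (conj_descends hD ((isIntegralRep_iff_injective hρL _).mp σ.2)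
    ((isIntegralRep_iff_injective hρL _).mp τ.2) (Quotient.exact h))

/-- No conjugacy with `ρL` is built into `definedOver`. It is automatic: a homomorphism over `O_L`
with faithful extension is faithful, and faithful representations over `L` are conjugate. -/
lemma range_extendForm {ρ : QuaternionGroup 2 →* GL (Fin 2) Omega}
    (hρ : Function.Injective ρ) {ρL : QuaternionGroup 2 →* GL (Fin 2) L}
    (hρL : Function.Injective ρL) : Set.range (extendForm hρ hρL) = definedOver ρ L := by
  apply Set.Subset.antisymm
  · rintro _ ⟨c, rfl⟩
    obtain ⟨σ, rfl⟩ := Quotient.exists_rep c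
    exact ⟨σ.1, extendRep hρ hρL σ, extendRep_apply hρ hρL σ, rfl⟩
  · rintro _ ⟨σ, τ, hτ, rfl⟩
    have hσ : Function.Injective σ := by
      have h := (isIntegralRep_iff_injective hρ _).mp τ.2
      intro x y hxy
      apply h
      rw [hτ, hτ, hxy]
    have e : extendRep hρ hρL ⟨σ, (isIntegralRep_iff_injective hρL _).mpr hσ⟩ = τ :=
      Subtype.ext (MonoidHom.ext fun x => (hτ x).symm)
    exact ⟨Quotient.mk _ ⟨σ, (isIntegralRep_iff_injective hρL _).mpr hσ⟩, by rw [← e]; rfl⟩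

/-- The forms over the integers of `L` correspond to the forms over `O_Ω` defined over `L`. -/
lemma natCard_integralForms (hD : Spectral D) {ρ : QuaternionGroup 2 →* GL (Fin 2) Omega}
    (hρ : Function.Injective ρ) {ρL : QuaternionGroup 2 →* GL (Fin 2) L}
    (hρL : Function.Injective ρL) :
    Nat.card (IntegralForms ρL) = (definedOver ρ L).ncard := by
  rw [← range_extendForm hρ hρL, ← Nat.card_coe_set_eq,
    Nat.card_range_of_injective (extendForm_injective hD hρ hρL)]

end Omega

/-! ### Classification of the quadratic and quartic subfields. -/

namespace DyadicField

variable {E : Type*} [Field E] [CharZero E] [Algebra ℚ_[2] E] (D : DyadicField E)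

open DyadicData

/-- The fixed field of one automorphism. -/
def fixedBy (τ : E ≃ₐ[ℚ_[2]] E) : IntermediateField ℚ_[2] E :=
  IntermediateField.fixedField (Subgroup.zpowers τ)

lemma mem_fixedBy {τ : E ≃ₐ[ℚ_[2]] E} {x : E} : x ∈ fixedBy τ ↔ τ x = x := by
  rw [fixedBy, IntermediateField.mem_fixedField_iff]
  constructor
  · intro h
    exact h τ (Subgroup.mem_zpowers τ)
  · intro h f hf
    have : Subgroup.zpowers τ ≤ MulAction.stabilizer (E ≃ₐ[ℚ_[2]] E) x := by
      rw [Subgroup.zpowers_le]; exact h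
    exact this hf

lemma sqrtAdjoin_pair_le {a b : ℤ} {x y : E} (hx : x ^ 2 = (a : E)) (hy : y ^ 2 = (b : E))
    {L : IntermediateField ℚ_[2] E} (hxL : x ∈ L) (hyL : y ∈ L) : sqrtAdjoin E {a, b} ≤ L := by
  apply sqrtAdjoin_le
  rintro c (rfl | rfl)
  · exact ⟨x, hxL, hx⟩
  · exact ⟨y, hyL, hy⟩

lemma finrank_sqrtAdjoin_singleton_le [FiniteDimensional ℚ_[2] E] {a : ℤ} {x : E}
    (hx : x ^ 2 = (a : E)) : Module.finrank ℚ_[2] (sqrtAdjoin E {a}) ≤ 2 := by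
  have h := finrank_quadExt_le (sqrtAdjoin E ∅) x (sq_mem_of_int hx)
  rw [← sqrtAdjoin_insert hx (by simp), sqrtAdjoin_empty, insert_empty_eq,
    IntermediateField.finrank_bot] at h
  omega

section Finite

variable [FiniteDimensional ℚ_[2] E]

/-- The degree of `F` is a proper divisor of 8, hence at most 4, so both subfields fill `F`. -/
lemma eq_of_le_of_ne_top {F L K : IntermediateField ℚ_[2] E} (hF : F ≠ ⊤) (hL : L ≤ F) (hK : K ≤ F)
    (hL4 : 4 ≤ Module.finrank ℚ_[2] L) (hK4 : 4 ≤ Module.finrank ℚ_[2] K)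
    (h8 : Module.finrank ℚ_[2] E = 8) : L = K := by
  have hlt : Module.finrank ℚ_[2] F < 8 := by
    refine lt_of_le_of_ne ?_ fun h => hF ?_
    · rw [← h8, ← IntermediateField.finrank_top' (F := ℚ_[2]) (E := E)]
      exact IntermediateField.finrank_le_of_le_right le_top
    · exact IntermediateField.eq_of_le_of_finrank_eq le_top
        (by rw [h, IntermediateField.finrank_top', h8])
  have hdvd : Module.finrank ℚ_[2] F ∣ 8 := by
    rw [← h8]; exact ⟨_, (Module.finrank_mul_finrank ℚ_[2] F E).symm⟩
  have hF4 : Module.finrank ℚ_[2] F ≤ 4 := by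
    obtain ⟨k, hk⟩ := hdvd
    have : k ≠ 1 := by rintro rfl; omega
    have : k ≠ 0 := by rintro rfl; omega
    nlinarith [show 2 ≤ k by omega]
  rw [IntermediateField.eq_of_le_of_finrank_le hL (hF4.trans hL4),
    IntermediateField.eq_of_le_of_finrank_le hK (hF4.trans hK4)]

/-- Adjoining the single square root `v` to `K` already gives the whole field of degree 8. -/
lemma four_le_finrank {K : IntermediateField ℚ_[2] E} {v : E} {n : ℤ} (hv : v ^ 2 = (n : E))
    (h : ∀ L : IntermediateField ℚ_[2] E, K ≤ L → v ∈ L → D.I ∈ L ∧ D.r ∈ L ∧ D.s ∈ L) :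
    4 ≤ Module.finrank ℚ_[2] K := by
  have hle := finrank_quadExt_le K v (sq_mem_of_int hv)
  obtain ⟨h1, h2, h3⟩ := h _ (le_quadExt (hv := sq_mem_of_int hv)) self_mem_quadExt
  rw [D.eq_top h1 h2 h3, IntermediateField.finrank_top', D.finrank_eq_eight] at hle
  omega

variable [IsGalois ℚ_[2] E]

/-- The quartic subfields. -/
lemma quartic_cases (D : DyadicField E) {L : IntermediateField ℚ_[2] E} (hL : Module.finrank ℚ_[2] L = 4) :
    (L = sqrtAdjoin E {-1, 3} ∨ L = sqrtAdjoin E {-3, 2} ∨ L = sqrtAdjoin E {-3, -2}) ∨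
      L = sqrtAdjoin E {-1, 2} ∨ L = sqrtAdjoin E {-1, 6} ∨ L = sqrtAdjoin E {3, 2} ∨
        L = sqrtAdjoin E {3, -2} := by
  have h8 := D.finrank_eq_eight
  -- The fixed field of a nontrivial automorphism over `L` is proper and contains `L`; the signs of
  -- `τ` on the three generators identify it.
  obtain ⟨τ, hτ, hne⟩ : ∃ τ : E ≃ₐ[ℚ_[2]] E, (∀ x ∈ L, τ x = x) ∧ fixedBy τ ≠ ⊤ := by
    by_contra! h
    have : L = ⊤ := by
      rw [eq_top_iff]
      intro x _
      refine mem_of_fixed fun τ hτ => mem_fixedBy.mp ?_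
      rw [h τ hτ]; trivial
    rw [this, IntermediateField.finrank_top', h8] at hL
    omega
  have key : ∀ {a b : ℤ} {x y v : E} {n : ℤ}, x ^ 2 = (a : E) → y ^ 2 = (b : E) →
      v ^ 2 = (n : E) → τ x = x → τ y = y →
      (∀ K : IntermediateField ℚ_[2] E, x ∈ K → y ∈ K → v ∈ K → D.I ∈ K ∧ D.r ∈ K ∧ D.s ∈ K) →
      L = sqrtAdjoin E {a, b} := by
    intro a b x y v n hx hy hv hτx hτy h
    exact eq_of_le_of_ne_top hne (fun z hz => mem_fixedBy.mpr (hτ z hz))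
      (sqrtAdjoin_pair_le hx hy (mem_fixedBy.mpr hτx) (mem_fixedBy.mpr hτy)) hL.ge
      (D.four_le_finrank hv fun K hK hvK =>
        h K (hK (mem_sqrtAdjoin (by simp) hx)) (hK (mem_sqrtAdjoin (by simp) hy)) hvK) h8
  have hI := sq_root_map (τ : E →+* E) D.sqrt_neg_one
  have hr := sq_root_map (τ : E →+* E) D.sqrt_neg_three
  have hs := sq_root_map (τ : E →+* E) D.sqrt_two
  simp only [RingHom.coe_coe] at hI hr hs
  -- Seven of the eight sign patterns are nontrivial, one for each quartic subfield.
  rcases hr with hr | hr <;> rcases hI with hI | hI <;> rcases hs with hs | hs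
  · exact absurd (D.eq_top (mem_fixedBy.mpr hI) (mem_fixedBy.mpr hr) (mem_fixedBy.mpr hs)) hne
  · refine .inl (.inl (key D.sqrt_neg_one D.sqrt_three D.sqrt_two hI (by simp [hI, hr])
      fun K h1 h2 h3 => ⟨h1, ?_, h3⟩))
    have := div_mem h2 h1
    rwa [mul_div_cancel_left₀ _ D.I_ne] at this
  · exact .inl (.inr (.inl (key D.sqrt_neg_three D.sqrt_two D.sqrt_neg_one hr hs
      fun K h1 h2 h3 => ⟨h3, h1, h2⟩)))
  · exact .inl (.inr (.inr (key D.sqrt_neg_three D.sqrt_neg_two D.sqrt_neg_one hr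
      (by simp [hI, hs]) fun K h1 h2 h3 => ⟨h3, h1, D.s_mem_of h3 h2⟩)))
  · exact .inr (.inl (key D.sqrt_neg_one D.sqrt_two D.sqrt_neg_three hI hs
      fun K h1 h2 h3 => ⟨h1, h3, h2⟩))
  · refine .inr (.inr (.inl (key D.sqrt_neg_one D.sqrt_six D.sqrt_neg_three hI
      (by simp [hI, hr, hs]) fun K h1 h2 h3 => ⟨h1, h3, ?_⟩)))
    have := div_mem h2 (mul_mem h1 h3)
    rwa [mul_div_cancel_left₀ _ (mul_ne_zero D.I_ne D.r_ne)] at this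
  · exact .inr (.inr (.inr (.inl (key D.sqrt_three D.sqrt_two D.sqrt_neg_three
      (by simp [hI, hr]) hs fun K h1 h2 h3 => ⟨D.I_mem_of h3 h1, h3, h2⟩))))
  · exact .inr (.inr (.inr (.inr (key D.sqrt_three D.sqrt_neg_two D.sqrt_neg_three
      (by simp [hI, hr]) (by simp [hI, hs])
      fun K h1 h2 h3 => ⟨D.I_mem_of h3 h1, h3, D.s_mem_of (D.I_mem_of h3 h1) h2⟩))))

/-- An element of `L` is expanded in the basis `1, r, v, r * v` and averaged with its image under a
`τ` that fixes `L` and negates `r`. What survives is the `v` coordinate if `τ` fixes `v`, and the `r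
* v` coordinate otherwise. -/
lemma quadratic_cases_of_le {L : IntermediateField ℚ_[2] E} (hL : Module.finrank ℚ_[2] L = 2)
    (hr : D.r ∉ L) {b c : ℤ} {v : E} (hv : v ^ 2 = (b : E)) (hc : (D.r * v) ^ 2 = (c : E))
    (hle : L ≤ sqrtAdjoin E {-3, b}) : L = sqrtAdjoin E {b} ∨ L = sqrtAdjoin E {c} := by
  obtain ⟨τ, hτ, hτr⟩ := D.exists_conj_of_r_notMem hr
  have hbot : ∀ x ∈ (⊥ : IntermediateField ℚ_[2] E), τ x = x := by
    intro x hx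
    obtain ⟨q, rfl⟩ := IntermediateField.mem_bot.mp hx
    exact τ.commutes q
  have hform : ∀ x ∈ L, ∃ q₀ ∈ (⊥ : IntermediateField ℚ_[2] E),
      ∃ q₁ ∈ (⊥ : IntermediateField ℚ_[2] E), ∃ q₂ ∈ (⊥ : IntermediateField ℚ_[2] E),
      ∃ q₃ ∈ (⊥ : IntermediateField ℚ_[2] E), x = q₀ + q₁ * D.r + (q₂ + q₃ * D.r) * v ∧
        x = q₀ - q₁ * D.r + (q₂ - q₃ * D.r) * τ v := by
    intro x hx
    obtain ⟨x₀, h₀, x₁, h₁, rfl⟩ := D.exists_insert_neg_three hv (hle hx)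
    obtain ⟨q₀, k₀, q₁, k₁, rfl⟩ := D.exists_neg_three h₀
    obtain ⟨q₂, k₂, q₃, k₃, rfl⟩ := D.exists_neg_three h₁
    refine ⟨q₀, k₀, q₁, k₁, q₂, k₂, q₃, k₃, rfl, ?_⟩
    have := hτ _ hx
    simp only [map_add, map_mul, hbot _ k₀, hbot _ k₁, hbot _ k₂, hbot _ k₃, hτr] at this
    rw [← this]; ring
  rcases sq_root_map (τ : E →+* E) hv with h | h <;> simp only [RingHom.coe_coe] at h <;>
    rw [h] at hform
  · left
    refine IntermediateField.eq_of_le_of_finrank_le (fun x hx => ?_)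
      (by rw [hL]; exact finrank_sqrtAdjoin_singleton_le hv)
    obtain ⟨q₀, k₀, q₁, k₁, q₂, k₂, q₃, k₃, e1, e2⟩ := hform x hx
    have e : x = q₀ + q₂ * v := by linear_combination (e1 + e2) / 2
    rw [e]
    exact add_mem (bot_le (α := IntermediateField ℚ_[2] E) k₀)
      (mul_mem (bot_le (α := IntermediateField ℚ_[2] E) k₂) (mem_sqrtAdjoin (by simp) hv))
  · right
    refine IntermediateField.eq_of_le_of_finrank_le (fun x hx => ?_)
      (by rw [hL]; exact finrank_sqrtAdjoin_singleton_le hc)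
    obtain ⟨q₀, k₀, q₁, k₁, q₂, k₂, q₃, k₃, e1, e2⟩ := hform x hx
    have e : x = q₀ + q₃ * (D.r * v) := by linear_combination (e1 + e2) / 2
    rw [e]
    exact add_mem (bot_le (α := IntermediateField ℚ_[2] E) k₀)
      (mul_mem (bot_le (α := IntermediateField ℚ_[2] E) k₃) (mem_sqrtAdjoin (by simp) hc))

/-- The quadratic subfields. -/
lemma quadratic_cases (D : DyadicField E) {L : IntermediateField ℚ_[2] E} (hL : Module.finrank ℚ_[2] L = 2) :
    L = sqrtAdjoin E {-3} ∨ (L = sqrtAdjoin E {-1} ∨ L = sqrtAdjoin E {3}) ∨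
      (L = sqrtAdjoin E {2} ∨ L = sqrtAdjoin E {-6}) ∨
      (L = sqrtAdjoin E {-2} ∨ L = sqrtAdjoin E {6}) := by
  by_cases hr : D.r ∈ L
  · left
    have h1 : Module.finrank ℚ_[2] (sqrtAdjoin E {-3}) = 2 := by
      rw [show ({-3} : Set ℤ) = insert (-3) ∅ by simp,
        sqrtAdjoin_insert D.sqrt_neg_three (by simp), finrank_quadExt, sqrtAdjoin_empty]
      · simp
      · rw [sqrtAdjoin_empty]; exact D.r_notMem_bot
    exact (IntermediateField.eq_of_le_of_finrank_eq
      (sqrtAdjoin_singleton_le D.sqrt_neg_three hr) (by rw [hL, h1])).symm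
  · right
    -- Adjoining `√-3` gives a quartic field containing it, and only three of the seven qualify.
    have h4 := finrank_quadExt L D.r (sq_mem_of_int D.sqrt_neg_three) hr
    rw [hL] at h4
    have hle : L ≤ quadExt L D.r (sq_mem_of_int D.sqrt_neg_three) := le_quadExt
    have hrm : D.r ∈ quadExt L D.r (sq_mem_of_int D.sqrt_neg_three) := self_mem_quadExt
    rcases D.quartic_cases h4 with (h | h | h) | h | h | h | h <;> rw [h] at hle hrm
    · rw [D.sqrtAdjoin_neg_one_three] at hle
      exact .inl (D.quadratic_cases_of_le hL hr D.sqrt_neg_one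
        (by rw [mul_comm]; exact D.sqrt_three) hle)
    · exact .inr (.inl (D.quadratic_cases_of_le hL hr D.sqrt_two D.sqrt_neg_six hle))
    · exact .inr (.inr (D.quadratic_cases_of_le hL hr D.sqrt_neg_two
        (by rw [mul_left_comm, ← mul_assoc]; exact D.sqrt_six) hle))
    · exact absurd hrm D.r_notMem_neg_one_two
    · exact absurd hrm D.r_notMem_neg_one_six
    · exact absurd hrm D.r_notMem_three_two
    · exact absurd hrm D.r_notMem_three_neg_two

end Finite

end DyadicField

/-! ### Assembly of the theorem. -/

lemma Omega.definedOver_eq_image {ρ : QuaternionGroup 2 →* GL (Fin 2) Omega}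
    {D : DyadicData Omega} {f : DyadicData.Idx → IntegralForms ρ} (hf : Function.Bijective f)
    (hfD : ∀ (L : IntermediateField ℚ_[2] Omega) (i : DyadicData.Idx),
      f i ∈ definedOver ρ L ↔ D.DefOver L.toSubfield (D.M i))
    {L : IntermediateField ℚ_[2] Omega} {T : Finset DyadicData.Idx}
    (hT : ∀ i, D.DefOver L.toSubfield (D.M i) ↔ i ∈ T) :
    definedOver ρ L = f '' T := by
  ext c
  obtain ⟨i, rfl⟩ := hf.2 c
  rw [hfD, hT, hf.1.mem_set_image, Finset.mem_coe]

lemma Omega.exists_faithful :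
    ∃ ρ : QuaternionGroup 2 →* GL (Fin 2) Omega, Function.Injective ρ := by
  obtain ⟨D, -⟩ := Omega.exists_dyadicField
  obtain ⟨ρ, hA, hB⟩ := QuaternionGroup.exists_hom D.quatPair
  exact ⟨ρ, QuaternionGroup.injective_of_quatPair (by rw [hA, hB]; exact D.quatPair)⟩

theorem theorem5 :
    (∃ ρ : QuaternionGroup 2 →* GL (Fin 2) Omega, Function.Injective ρ) ∧
    ∀ ρ : QuaternionGroup 2 →* GL (Fin 2) Omega, Function.Injective ρ →
      -- the number of integral forms over `O_Ω`
      Nat.card (IntegralForms ρ) = 26 ∧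
      -- quadratic subfields
      (∀ L : IntermediateField ℚ_[2] Omega, Module.finrank ℚ_[2] L = 2 →
        (L ≠ sqrtField {-3} → (definedOver ρ L).ncard = 4) ∧
        (L = sqrtField {-3} → (definedOver ρ L).ncard = 2)) ∧
      -- quartic subfields
      (∀ L : IntermediateField ℚ_[2] Omega, Module.finrank ℚ_[2] L = 4 →
        ((¬ ∃ x : L, x ^ 2 = -3) → (definedOver ρ L).ncard = 10) ∧
        ((∃ x : L, x ^ 2 = -3) → (definedOver ρ L).ncard = 6)) ∧
      -- these are also the numbers of integral forms over `O_L` itself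
      (∀ L : IntermediateField ℚ_[2] Omega,
        Module.finrank ℚ_[2] L = 2 ∨ Module.finrank ℚ_[2] L = 4 →
        ∀ ρL : QuaternionGroup 2 →* GL (Fin 2) L, Function.Injective ρL →
          Nat.card (IntegralForms ρL) = (definedOver ρ L).ncard) ∧
      -- the table of fields of definition
      ∃ star circ diam club spade : Set (IntegralForms ρ),
        (star.ncard = 2 ∧ circ.ncard = 3 ∧ diam.ncard = 3 ∧ club.ncard = 3 ∧ spade.ncard = 1) ∧
        [star, circ, diam, club, spade].Pairwise Disjoint ∧
        definedOver ρ (sqrtField {-1}) = diam ∪ spade ∧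
        definedOver ρ (sqrtField {3}) = diam ∪ spade ∧
        definedOver ρ (sqrtField {-3}) = star ∧
        definedOver ρ (sqrtField {2}) = circ ∪ spade ∧
        definedOver ρ (sqrtField {-2}) = circ ∪ spade ∧
        definedOver ρ (sqrtField {6}) = circ ∪ spade ∧
        definedOver ρ (sqrtField {-6}) = circ ∪ spade ∧
        definedOver ρ (sqrtField {-1, 3}) = star ∪ diam ∪ spade ∧
        definedOver ρ (sqrtField {-1, 2}) = circ ∪ diam ∪ club ∪ spade ∧
        definedOver ρ (sqrtField {-1, 6}) = circ ∪ diam ∪ club ∪ spade ∧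
        definedOver ρ (sqrtField {3, 2}) = circ ∪ diam ∪ club ∪ spade ∧
        definedOver ρ (sqrtField {3, -2}) = circ ∪ diam ∪ club ∪ spade ∧
        definedOver ρ (sqrtField {-3, 2}) = star ∪ circ ∪ spade ∧
        definedOver ρ (sqrtField {-3, -2}) = star ∪ circ ∪ spade := by
  refine ⟨Omega.exists_faithful, fun ρ hρ => ?_⟩
  obtain ⟨D, hN⟩ := Omega.exists_dyadicField
  have hD : Omega.Spectral D.toDyadicData := fun x => by
    rw [isIntegral_iff_spectralNorm_le_one, hN]
  obtain ⟨f, hf, hfD⟩ := Omega.exists_param hD D.unif_top hρ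
  have key : ∀ {L : IntermediateField ℚ_[2] Omega} {T : Finset DyadicData.Idx},
      (∀ i, D.DefOver L.toSubfield (D.M i) ↔ i ∈ T) → definedOver ρ L = f '' T :=
    Omega.definedOver_eq_image hf hfD
  have hcard : ∀ T : Finset DyadicData.Idx, (f '' T).ncard = T.card := fun T => by
    rw [Set.ncard_image_of_injective _ hf.1, Set.ncard_coe_finset]
  have hdisj : ∀ {S T : Finset DyadicData.Idx}, Disjoint S T →
      Disjoint (f '' (S : Set DyadicData.Idx)) (f '' T) := fun h =>
    (Set.disjoint_image_iff hf.1).mpr (Finset.disjoint_coe.mpr h)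
  refine ⟨?_, fun L hL => ⟨fun hne => ?_, fun h => ?_⟩, fun L hL => ⟨fun hr => ?_, fun hr => ?_⟩,
    fun L _ ρL hρL => Omega.natCard_integralForms hD hρ hρL,
    f '' starIdx, f '' circIdx, f '' diamIdx, f '' clubIdx, f '' spadeIdx,
    ⟨hcard _, hcard _, hcard _, hcard _, hcard _⟩, ?_, ?_⟩
  -- The labels number 1 + (4 + 1) + (16 + 4): the centre and the spheres of radius one and two.
  · rw [← Nat.card_eq_of_bijective f hf, Nat.card_eq_fintype_card]; rfl
  · rcases D.quadratic_cases hL with h | (rfl | rfl) | (rfl | rfl) | (rfl | rfl)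
    · exact absurd h hne
    · rw [key D.defOver_neg_one_iff, hcard]; rfl
    · rw [key D.defOver_three_iff, hcard]; rfl
    · rw [key D.defOver_two_iff, hcard]; rfl
    · rw [key D.defOver_neg_six_iff, hcard]; rfl
    · rw [key D.defOver_neg_two_iff, hcard]; rfl
    · rw [key D.defOver_six_iff, hcard]; rfl
  · subst h
    exact (congrArg Set.ncard (key D.defOver_neg_three_iff)).trans (hcard _)
  · have hr' : D.r ∉ L := fun h => hr ⟨⟨D.r, h⟩, Subtype.ext (D.hr.trans rfl)⟩
    rcases D.quartic_cases hL with (rfl | rfl | rfl) | rfl | rfl | rfl | rfl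
    · exact absurd D.r_mem_neg_one_three hr'
    · exact absurd (mem_sqrtAdjoin (by simp) D.sqrt_neg_three) hr'
    · exact absurd (mem_sqrtAdjoin (by simp) D.sqrt_neg_three) hr'
    · rw [key D.defOver_neg_one_two_iff, hcard]; rfl
    · rw [key D.defOver_neg_one_six_iff, hcard]; rfl
    · rw [key D.defOver_three_two_iff, hcard]; rfl
    · rw [key D.defOver_three_neg_two_iff, hcard]; rfl
  · have hr' : D.r ∈ L := by
      obtain ⟨x, hx⟩ := hr
      have hx' : (x : Omega) ^ 2 = D.r ^ 2 := by
        rw [D.hr, ← IntermediateField.coe_pow, hx]; rfl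
      rcases sq_eq_sq_iff_eq_or_eq_neg.mp hx' with h | h
      · rw [← h]; exact x.2
      · rw [← neg_neg D.r, ← h]; exact neg_mem x.2
    rcases D.quartic_cases hL with (rfl | rfl | rfl) | rfl | rfl | rfl | rfl
    · rw [key D.defOver_neg_one_three_iff, hcard]; rfl
    · rw [key D.defOver_neg_three_two_iff, hcard]; rfl
    · rw [key D.defOver_neg_three_neg_two_iff, hcard]; rfl
    · exact absurd hr' D.r_notMem_neg_one_two
    · exact absurd hr' D.r_notMem_neg_one_six
    · exact absurd hr' D.r_notMem_three_two
    · exact absurd hr' D.r_notMem_three_neg_two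
  · have h : ∀ {S T : Finset DyadicData.Idx}, Disjoint S T →
      Disjoint (f '' (S : Set DyadicData.Idx)) (f '' T) := hdisj
    simp only [List.pairwise_cons, List.mem_cons, forall_eq_or_imp, List.not_mem_nil,
      IsEmpty.forall_iff, implies_true, and_true, List.Pairwise.nil]
    refine ⟨⟨h ?_, h ?_, h ?_, h ?_⟩, ⟨h ?_, h ?_, h ?_⟩, ⟨h ?_, h ?_⟩, h ?_⟩ <;> decide
  · simp only [← Set.image_union, ← Finset.coe_union]
    exact ⟨key D.defOver_neg_one_iff, key D.defOver_three_iff, key D.defOver_neg_three_iff,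
      key D.defOver_two_iff, key D.defOver_neg_two_iff, key D.defOver_six_iff,
      key D.defOver_neg_six_iff, key D.defOver_neg_one_three_iff, key D.defOver_neg_one_two_iff,
      key D.defOver_neg_one_six_iff, key D.defOver_three_two_iff, key D.defOver_three_neg_two_iff,
      key D.defOver_neg_three_two_iff, key D.defOver_neg_three_neg_two_iff⟩

end
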